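/- **Setting.** Let $n\ge 0$, $p\in(0,1]$, and let $x_1\prec x_2\prec\dots\prec x_n$ be an arbitrary (unknown) linear order of the vertex set $V=\{0,\dots,n-1\}$. The input graph $G=(V,E)$ is the random graph $G(n,p)$ to which the Hamiltonian path $x_1x_2\cdots x_n$ is added: the pairs $\{x_i,x_{i+1}\}$ are always edges, and every other pair is an edge independently with probability $p$. An algorithm knows $n$, $p$ and $G$; it learns about the order only by comparing the endpoints of edges of $G$. The number of comparisons is the number of distinct edges that are compared. **The algorithm StochasticSort** (with an integer constant $c$). Put $q=\max(1,\lceil\log_2(pn)\rceil)$ and $s_i=2^i/p$. All loops over vertices run in the order of the labels $0,\dots,n-1$. *Edge sets.* Let $\alpha\in[1,2]$ satisfy $\prod_{i=1}^q(1-\alpha p/2^i)=1-p$. Independently for each edge $e\in E$ draw indicators $(X_1,\dots,X_q)$, where $X_i$ are independent with $\Pr[X_i=1]=\alpha p/2^i$, conditioned on not all $X_i$ being $0$; put $e$ into $E_i$ iff $X_i=1$. *Levels.* The algorithm maintains sets $L_1\subseteq L_2\subseteq\cdots$, where $L_i$ for $i>q$ consists of all undiscovered vertices. To (re)build $L_i$,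 for each $v\in L_{i+1}$ it compares $v$ with all $u\in L_{i+c}$ such that $uv\in E_i$; if some such $u$ satisfies $u\prec v$, then $v\notin L_i$, and $v$ is recorded as blocked by the last such $u$; otherwise $v\in L_i$ and $v$ is not blocked. Initially $L_q,L_{q-1},\dots,L_1$ are built in this order. *First vertex.* Keep a vertex $v_0$ (initially the vertex $0$) and a set $S$ (initially empty). While $v_0$ has a neighbour $u\notin S$, compare the first such $u$ with $v_0$: if $u\prec v_0$, add $v_0$ to $S$ and replace $v_0$ by $u$; otherwise add $u$ to $S$. At the end $v_0$ is declared to be $x_1$. *Update after discovering $x_\ell$.* Remove $x_\ell$ from all levels. For each $v$ recorded as blocked by $x_\ell$, cancel the record, and starting from the lowest level $L_{i+1}$ containing $v$, compare $v$ with the $u\in L_{i+c}$ such that $uv\in E_i$, one by one, until some $u\prec v$ is found, in which case $v$ is recorded as blocked by $u$; if none is found, add $v$ to $L_i$ and continue in the same way with $i-1$, until $v$ is blocked or in $L_1$. Then, if $i$ is the largest index $\le q$ such that $\ell=\lfloor k s_i/32\rfloor$ for some integer $k$, rebuild $L_i,L_{i-1},\dots,L_1$ in this order. *Next vertex.* Let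 $C$ be the set of neighbours of $x_\ell$ in $L_1$. For $i=1,2,\dots,q+1$, as long as $|C|>1$, compare each $v\in C$ with all its neighbours in $L_i$ and remove from $C$ those $v$ for which some such neighbour $u$ satisfies $u\prec v$. The remaining vertex is declared to be $x_{\ell+1}$. In this way $x_1,\dots,x_{\lceil n/2\rceil}$ are found, and $x_n,x_{n-1},\dots,x_{\lceil n/2\rceil+1}$ are found by the same procedure, with the same sets $E_i$, applied to the reverse order. (For $n\le 1$ no comparison is made.) **Theorem.** There is a constant $c_0$ such that for every fixed integer $c\ge c_0$ there is a constant $K$, depending only on $c$, such that the following holds for all $n$, all $p\in(0,1]$ and every true order $x_1\prec\dots\prec x_n$. 1. StochasticSort always outputs the correct order $x_1,\dots,x_n$ and compares only endpoints of edges: this holds for every graph $G$ that contains the path $x_1x_2\cdots x_n$ and every outcome of the algorithm's random choices. 2. On $G(n,p)$ with the planted path, the expected number of comparisons, over the random graph and the random choices of the algorithm, is at most $K\,n\max(1,\log(pn))$; in particular it is $O(n\log(pn))$ for $pn\ge 2$. -/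

import Mathlib

/-! ### Comparison algorithms as decision trees -/

/-- A comparison algorithm on the vertex set `V` with output in `α`. It learns about the unknown
order only through `query u v`, which is answered by `true` exactly if `u` precedes `v`. -/
inductive Comp (V : Type) (α : Type) : Type
  | done (a : α) : Comp V α
  | query (u v : V) (next : Bool → Comp V α) : Comp V α

namespace Comp

variable {V α β : Type}

def bind : Comp V α → (α → Comp V β) → Comp V β
  | done a, f => f a
  | query u v next, f => query u v fun b => (next b).bind f

instance : Monad (Comp V) where
  pure := done
  bind := bind

/-- Compare two vertices. -/
def ask (u v : V) : Comp V Bool := query u v done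

/-- The output if the true order is `prec`. -/
def output (prec : V → V → Bool) : Comp V α → α
  | done a => a
  | query u v next => (next (prec u v)).output prec

/-- The set of vertex pairs that are compared if the true order is `prec`. -/
def asked [DecidableEq V] (prec : V → V → Bool) : Comp V α → Finset (Sym2 V)
  | done _ => ∅
  | query u v next => insert s(u, v) ((next (prec u v)).asked prec)

/-- The same algorithm, run on the reverse of the true order. -/
def reversed : Comp V α → Comp V α
  | done a => done a
  | query u v next => query v u fun b => (next b).reversed

end Comp

/-! ### The sorting algorithm

In this section `adj` is the adjacency relation of the input graph, `E i` is the `i`-th of the edge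
sets `E 1, …, E q`, `c` is the constant offset between levels, and `sched ℓ` is the highest level
that is rebuilt after the `ℓ`-th vertex has been discovered (`0` if there is none). All loops over
vertices run in the order of the labels `0, …, n - 1`. -/

namespace StochSort

/-- The levels `L i` (`i ≥ 1`; those with `i > q` contain all undiscovered vertices), and for each
vertex the vertex, if any, by which it is recorded to be blocked. -/
structure State (n : ℕ) where
  level : ℕ → Finset (Fin n)
  elim : Fin n → Option (Fin n)

/-- Compare `v` with each member of `us`, and return those members that precede `v`. -/
def predecessors {n : ℕ} (us : List (Fin n)) (v : Fin n) : Comp (Fin n) (List (Fin n)) :=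
  us.filterM fun u => Comp.ask u v

/-- Compare `v` with the members of `us` one by one, until one is found that precedes `v`. -/
def firstPredecessor {n : ℕ} : List (Fin n) → Fin n → Comp (Fin n) (Option (Fin n))
  | [], _ => pure none
  | u :: us, v => do
    if ← Comp.ask u v then pure (some u) else firstPredecessor us v

/-- The vertices `u ∈ L (i + c)` with `(u, v) ∈ E i`: those that can block `v` from level `i`. -/
def potentialBlockers {n : ℕ} (E : ℕ → Fin n → Fin n → Bool) (c i : ℕ) (S : State n) (v : Fin n) :
    List (Fin n) :=
  (List.finRange n).filter fun u => u ∈ S.level (i + c) ∧ E i u v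

/-- Decide from scratch whether `v`, a vertex of level `i + 1`, belongs to level `i`. -/
def rebuildVertex {n : ℕ} (E : ℕ → Fin n → Fin n → Bool) (c i : ℕ) (S : State n) (v : Fin n) :
    Comp (Fin n) (State n) := do
  let blockers ← predecessors (potentialBlockers E c i S v) v
  pure <| match blockers.getLast? with
    | none => { S with elim := Function.update S.elim v none }
    | some u =>
      { level := Function.update S.level i ((S.level i).erase v)
        elim := Function.update S.elim v (some u) }

/-- Rebuild level `i`: start with `L i = L (i + 1)` and remove the blocked vertices. -/
def rebuildLevel {n : ℕ} (E : ℕ → Fin n → Fin n → Bool) (c i : ℕ) (S : State n) :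
    Comp (Fin n) (State n) :=
  ((List.finRange n).filter fun v => v ∈ S.level (i + 1)).foldlM (rebuildVertex E c i)
    { S with level := Function.update S.level i (S.level (i + 1)) }

/-- Rebuild the levels `i, i - 1, …, 1`, in this order. -/
def createLevels {n : ℕ} (E : ℕ → Fin n → Fin n → Bool) (c : ℕ) :
    ℕ → State n → Comp (Fin n) (State n)
  | 0, S => pure S
  | i + 1, S => do createLevels E c i (← rebuildLevel E c (i + 1) S)

/-- Move `v`, whose lowest level is `i`, to lower levels until it is blocked or in level `1`. -/
def advance {n : ℕ} (E : ℕ → Fin n → Fin n → Bool) (c : ℕ) (v : Fin n) :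
    ℕ → State n → Comp (Fin n) (State n)
  | 0, S => pure S
  | 1, S => pure S
  | i + 2, S =>
    firstPredecessor (potentialBlockers E c (i + 1) S v) v >>= fun blocker =>
      match blocker with
      | some u => pure { S with elim := Function.update S.elim v (some u) }
      | none => advance E c v (i + 1)
          { S with level := Function.update S.level (i + 1) (insert v (S.level (i + 1))) }

/-- The lowest level that contains `v` (every undiscovered vertex is in level `q + 1`). -/
def lowestLevel {n : ℕ} (q : ℕ) (S : State n) (v : Fin n) : ℕ :=
  ((List.range' 1 (q + 1)).find? fun i => v ∈ S.level i).getD (q + 1)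

/-- The incremental update after `x` has been discovered: remove `x` from all levels, then let the
vertices that were blocked by `x` advance. -/
def increment {n : ℕ} (E : ℕ → Fin n → Fin n → Bool) (q c : ℕ) (x : Fin n) (S : State n) :
    Comp (Fin n) (State n) :=
  ((List.finRange n).filter fun v => S.elim v = some x).foldlM
    (fun S v => advance E c v (lowestLevel q S v)
      { S with elim := Function.update S.elim v none })
    { S with level := fun i => (S.level i).erase x }

/-- The search for the first vertex: `v₀` is the earliest vertex found so far, and `S` is a set of
vertices known to come after `v₀`. Each round adds one vertex to `S`, so `n` rounds suffice; the
first argument counts the remaining rounds. -/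
def findFirst {n : ℕ} (adj : Fin n → Fin n → Bool) :
    ℕ → Fin n → Finset (Fin n) → Comp (Fin n) (Fin n)
  | 0, v₀, _ => pure v₀
  | k + 1, v₀, S =>
    match (List.finRange n).find? fun u => adj u v₀ ∧ u ∉ S with
    | none => pure v₀
    | some u => do
      if ← Comp.ask u v₀ then findFirst adj k u (insert v₀ S)
      else findFirst adj k v₀ (insert u S)

/-- One round of elimination: query all edges between the candidates and level `i`, and keep the
candidates for which no predecessor shows up. -/
def eliminate {n : ℕ} (adj : Fin n → Fin n → Bool) (i : ℕ) (S : State n) (C : List (Fin n)) :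
    Comp (Fin n) (List (Fin n)) :=
  C.filterM fun v => do
    let us ← predecessors ((List.finRange n).filter fun u => u ∈ S.level i ∧ adj u v) v
    pure us.isEmpty

/-- Go through the given levels until at most one candidate is left. -/
def narrow {n : ℕ} (adj : Fin n → Fin n → Bool) (S : State n) :
    List ℕ → List (Fin n) → Comp (Fin n) (List (Fin n))
  | [], C => pure C
  | i :: is, C => if C.length ≤ 1 then pure C else do narrow adj S is (← eliminate adj i S C)

/-- The search for the successor of `x`, the most recently discovered vertex: the candidates are
the vertices of level `1` that are adjacent to `x`; they are tested against the levels
`1, …, q + 1`. -/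
def findNext {n : ℕ} (adj : Fin n → Fin n → Bool) (q : ℕ) (x : Fin n) (S : State n) :
    Comp (Fin n) (Fin n) := do
  let C ← narrow adj S (List.range' 1 (q + 1))
    ((List.finRange n).filter fun v => v ∈ S.level 1 ∧ adj x v)
  pure (C.headD x)

/-- The main loop, entered when `x` has been discovered as the `ℓ`-th vertex: update the levels,
and find `k` further vertices. Returns the vertices from `x` on. -/
def discover {n : ℕ} (adj : Fin n → Fin n → Bool) (E : ℕ → Fin n → Fin n → Bool) (q c : ℕ)
    (sched : ℕ → ℕ) : ℕ → ℕ → Fin n → State n → Comp (Fin n) (List (Fin n))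
  | k, ℓ, x, S => do
    let S₁ ← increment E q c x S
    let S₂ ← createLevels E c (sched ℓ) S₁
    match k with
    | 0 => pure [x]
    | k + 1 => do
      let y ← findNext adj q x S₂
      let rest ← discover adj E q c sched k (ℓ + 1) y S₂
      pure (x :: rest)

/-- Find the first `m` vertices of the true order. -/
def sortPrefix {n : ℕ} (adj : Fin n → Fin n → Bool) (E : ℕ → Fin n → Fin n → Bool) (q c : ℕ)
    (sched : ℕ → ℕ) (m : ℕ) : Comp (Fin n) (List (Fin n)) :=
  match m, (List.finRange n).head? with
  | k + 1, some v => do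
    let S ← createLevels E c q { level := fun _ => Finset.univ, elim := fun _ => none }
    let x ← findFirst adj n v ∅
    discover adj E q c sched k 1 x S
  | _, _ => pure []

/-- The whole algorithm: find the first half of the order, and find the second half by running the
same procedure on the reverse order. -/
def sortAll {n : ℕ} (adj : Fin n → Fin n → Bool) (E : ℕ → Fin n → Fin n → Bool) (q c : ℕ)
    (sched : ℕ → ℕ) : Comp (Fin n) (List (Fin n)) := do
  let front ← sortPrefix adj E q c sched ((n + 1) / 2)
  let back ← (sortPrefix adj E q c sched (n / 2)).reversed
  pure (front ++ back.reverse)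

noncomputable section

/-! ### Parameters and random choices -/

/-- The number `q` of edge sets: `log₂ (p n)`, rounded up, and at least `1`. -/
def numSets (n : ℕ) (p : unitInterval) : ℕ := max 1 ⌈Real.logb 2 ((p : ℝ) * n)⌉₊

/-- The target size `2 ^ i / p` of level `i`. -/
def targetSize (p : unitInterval) (i : ℕ) : ℝ := 2 ^ i / (p : ℝ)

open Classical in
/-- After the `ℓ`-th discovery the levels `i, …, 1` are rebuilt, where `i ≤ q` is the largest index
such that `ℓ` is a multiple of a 32nd of the target size of level `i` (up to rounding down). -/
def schedule (q : ℕ) (p : unitInterval) (ℓ : ℕ) : ℕ :=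
  ((Finset.Icc 1 q).filter fun i => ∃ k : ℕ, ⌊(k : ℝ) * (targetSize p i / 32)⌋₊ = ℓ).sup id

theorem exists_alpha {q : ℕ} (hq : 1 ≤ q) (p : unitInterval) :
    ∃ a ∈ Set.Icc (1 : ℝ) 2, ∏ i : Fin q, (1 - a * p / 2 ^ (i.val + 1)) = 1 - (p : ℝ) := by
  have hp0 : (0 : ℝ) ≤ p := p.2.1
  have hp1 : (p : ℝ) ≤ 1 := p.2.2
  have hcont : ContinuousOn
      (fun a : ℝ => ∏ i : Fin q, (1 - a * p / 2 ^ (i.val + 1))) (Set.Icc 1 2) := by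
    fun_prop
  refine intermediate_value_Icc' (by norm_num) hcont ⟨?_, ?_⟩
  · obtain ⟨r, rfl⟩ : ∃ r, q = r + 1 := ⟨q - 1, by omega⟩
    simp only [Fin.prod_univ_succ, Fin.val_zero, Fin.val_succ]
    have h : ∏ i : Fin r, (1 - 2 * (p : ℝ) / 2 ^ (i.val + 1 + 1)) ≤ 1 := by
      refine Finset.prod_le_one (fun i _ => ?_) (fun i _ => ?_)
      · rw [sub_nonneg, div_le_one (by positivity)]
        have : (1 : ℝ) ≤ 2 ^ i.val := one_le_pow₀ (by norm_num)
        rw [pow_add, pow_add]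
        linarith
      · have : (0 : ℝ) ≤ 2 * (p : ℝ) / 2 ^ (i.val + 1 + 1) := by positivity
        linarith
    have h2 : (1 : ℝ) - 2 * p / 2 ^ (0 + 1) = 1 - p := by norm_num
    rw [h2]
    exact mul_le_of_le_one_right (by linarith) h
  · have key : ∀ r : ℕ, 1 - (p : ℝ) * (1 - (1 / 2) ^ r) ≤
        ∏ i : Fin r, (1 - 1 * (p : ℝ) / 2 ^ (i.val + 1)) := by
      intro r
      induction r with
      | zero => simp
      | succ r ih =>
        rw [Fin.prod_univ_castSucc]
        simp only [Fin.val_castSucc, Fin.val_last]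
        have hx : (1 : ℝ) * p / 2 ^ (r + 1) = p * ((1 / 2) ^ r / 2) := by
          rw [pow_succ, one_div, inv_pow]; field_simp
        have ht0 : (0 : ℝ) ≤ (1 / 2) ^ r := by positivity
        have ht1 : ((1 : ℝ) / 2) ^ r ≤ 1 := pow_le_one₀ (by norm_num) (by norm_num)
        rw [hx]
        have hf : 0 ≤ 1 - (p : ℝ) * ((1 / 2) ^ r / 2) := by nlinarith
        refine le_trans ?_ (mul_le_mul_of_nonneg_right ih hf)
        rw [pow_succ]
        generalize ((1 : ℝ) / 2) ^ r = t at *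
        nlinarith [mul_nonneg (mul_nonneg hp0 hp0) (mul_nonneg ht0 (sub_nonneg.2 ht1))]
    refine le_trans ?_ (key q)
    have : (0 : ℝ) ≤ (1 / 2) ^ q := by positivity
    nlinarith

open Classical in
/-- The number `α ∈ [1, 2]` with `∏_{i=1}^q (1 - α p / 2 ^ i) = 1 - p`. -/
def alpha (q : ℕ) (p : unitInterval) : ℝ :=
  if h : ∃ a ∈ Set.Icc (1 : ℝ) 2, ∏ i : Fin q, (1 - a * p / 2 ^ (i.val + 1)) = 1 - (p : ℝ)
  then h.choose else 1

theorem alpha_mem (q : ℕ) (p : unitInterval) : alpha q p ∈ Set.Icc (1 : ℝ) 2 := by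
  unfold alpha
  split_ifs with h
  · exact h.choose_spec.1
  · norm_num

theorem prod_alpha {q : ℕ} (hq : 1 ≤ q) (p : unitInterval) :
    ∏ i : Fin q, (1 - alpha q p * p / 2 ^ (i.val + 1)) = 1 - (p : ℝ) := by
  unfold alpha
  rw [dif_pos (exists_alpha hq p)]
  exact (exists_alpha hq p).choose_spec.2

/-- The probability `α p / 2 ^ i` (the index `i : Fin q` stands for the edge set `E (i + 1)`). -/
def setProb (q : ℕ) (p : unitInterval) (i : Fin q) : unitInterval :=
  ⟨alpha q p * p / 2 ^ (i.val + 1), by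
    have h := alpha_mem q p
    have hp0 : (0 : ℝ) ≤ p := p.2.1
    have hp1 : (p : ℝ) ≤ 1 := p.2.2
    have h1 : (1 : ℝ) ≤ 2 ^ i.val := one_le_pow₀ (by norm_num)
    constructor
    · have := h.1
      positivity
    · rw [div_le_one (by positivity), pow_succ]
      nlinarith [h.1, h.2]⟩

open MeasureTheory ProbabilityTheory

/-- The law of independent indicators `X_1, …, X_q`, the `i`-th of which is `1` with probability
`α p / 2 ^ i`, conditioned on at least one of them being `1`. -/
def tupleLaw (q : ℕ) (p : unitInterval) : Measure (Fin q → Bool) :=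
  ProbabilityTheory.cond (Measure.pi fun i => bernoulliMeasure true false (setProb q p i)) {t | ∃ i, t i = true}

/-- The internal random choices of the algorithm: an independent tuple for each vertex pair. Only
the tuples of the pairs that are edges of the input graph are used. -/
def coinLaw (n q : ℕ) (p : unitInterval) : Measure (Sym2 (Fin n) → Fin q → Bool) :=
  Measure.pi fun _ => tupleLaw q p

open Classical in
/-- The edge sets `E 1, …, E q` obtained from the graph and the random tuples: `E i` consists of
the edges of `G` whose tuple has a `1` at position `i`. -/
def edgeSets {n q : ℕ} (G : SimpleGraph (Fin n)) (T : Sym2 (Fin n) → Fin q → Bool) (i : ℕ)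
    (u v : Fin n) : Bool :=
  decide (G.Adj u v ∧ ∃ j : Fin q, j.val + 1 = i ∧ T s(u, v) j = true)

open Classical in
/-- The algorithm, with constant `c`, on the input graph `G` with the random choices `T`. -/
def stochasticSort (c : ℕ) {n : ℕ} (p : unitInterval) (G : SimpleGraph (Fin n))
    (T : Sym2 (Fin n) → Fin (numSets n p) → Bool) : Comp (Fin n) (List (Fin n)) :=
  sortAll (fun u v => decide (G.Adj u v)) (edgeSets G T) (numSets n p) c
    (schedule (numSets n p) p)

/-! ### Instances -/

/-- `u` precedes `v` in the order `x 0, x 1, …, x (n - 1)`. -/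
def precedes {n : ℕ} (x : Equiv.Perm (Fin n)) (u v : Fin n) : Bool :=
  decide (x.symm u < x.symm v)

/-- The Hamiltonian path `x 0, x 1, …, x (n - 1)`. -/
def hamPath {n : ℕ} (x : Equiv.Perm (Fin n)) : SimpleGraph (Fin n) :=
  (SimpleGraph.pathGraph n).map x.toEmbedding

/-- The expected number of comparisons on `G(n, p)` with the planted Hamiltonian path of the true
order `x`, over the random graph and the random choices of the algorithm. -/
def expectedComparisons (c n : ℕ) (p : unitInterval) (x : Equiv.Perm (Fin n)) : ℝ :=
  ∫ ω, (((stochasticSort c p (ω.1 ⊔ hamPath x) ω.2).asked (precedes x)).card : ℝ)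
    ∂((SimpleGraph.binomialRandom (Fin n) p).prod (coinLaw n (numSets n p) p))

end

end StochSort

/-! Correctness is deterministic. The levels stay nested, and every undiscovered vertex is in level
1 or is kept out of a level by a recorded undiscovered predecessor (`Inv`). The next vertex of the
order has no undiscovered predecessor, so it is in level 1, is a candidate through its path edge and
is never eliminated. Any other candidate falls at the latest against level q + 1, which contains its
path predecessor (`narrow_spec`). The first vertex costs at most n comparisons, and the second half
is the same procedure for `reverseOrder x`.

For the count, the history of the algorithm is replaced by properties of the edge sets alone.
Suppose v is in level k although some undiscovered u before v has uv in E_k. Then u was missing from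
level k + c when v was tested, so an edge of some E_k' with k' ≥ k + c joins u to an earlier vertex
that was undiscovered at the last rebuild of level k. This is `Unblocked`. Outside the search for
the first vertex, every compared pair is a `RebuildPair`, `AdvancePair` or `SearchPair`
(`sortPrefix_spec`). Whether t blocks v depends only on the pair tv and on the pairs of t with
earlier vertices. These sets of pairs are disjoint for different t, so the blocking events are
independent although the algorithm is adaptive.

Write s_i = 2^i / p, and measure distances from the first undiscovered position ℓ. For t at distance
d > s_(i+c)/16 take the level k with s_(k+c)/32 < d ≤ s_(k+c)/16. The pair tv is in E_k with
probability at least 8/d, and t is not itself kept out of level k + c with probability at least 1/2.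
So t fails to block v with probability at most 1 - 4/d ≤ (1 - 1/d)^4. The product over t telescopes:
a vertex at distance j is unblocked at level i with probability O((s_i/(s_i + j))^4)
(`prob_unblocked_le`), and level i behaves like a set of O(s_i) vertices.

Consequently a rebuild of level i costs O(s_i) in expectation and happens O((n + 1)/s_i) times after
the first build, which costs O(n). The incremental update costs O(1) per level and discovery, and a
search costs O(1) per round. For the search one also needs that a candidate at distance j survives
the levels that are large compared with j only with probability exponentially small in pj
(`prob_survives_le`). There are q levels and at most n + 1 times to consider, and q = O(max(1,
log(pn))). The path edges, fewer than n or none, are counted outright, so probabilities are needed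
only for pairs off the path. -/

namespace Comp

/-! ### Outputs and compared pairs of composite algorithms -/

variable {V α β σ : Type}

@[simp] theorem output_pure (prec : V → V → Bool) (a : α) :
    (pure a : Comp V α).output prec = a := rfl

@[simp] theorem output_bind (prec : V → V → Bool) (m : Comp V α) (f : α → Comp V β) :
    (m >>= f).output prec = (f (m.output prec)).output prec := by
  change (m.bind f).output prec = _
  induction m with
  | done a => rfl
  | query u v next ih => exact ih _

@[simp] theorem output_ask (prec : V → V → Bool) (u v : V) :
    (ask u v).output prec = prec u v := rfl

theorem output_reversed (prec : V → V → Bool) (m : Comp V α) :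
    m.reversed.output prec = m.output fun u v => prec v u := by
  induction m with
  | done a => rfl
  | query u v next ih => exact ih _

theorem output_filterAuxM (prec : V → V → Bool) (f : β → Comp V Bool) (l acc : List β) :
    (l.filterAuxM f acc).output prec = (l.filter fun b => (f b).output prec).reverse ++ acc := by
  induction l generalizing acc with
  | nil => rfl
  | cons b l ih =>
    simp only [List.filterAuxM, output_bind, ih, List.filter_cons]
    cases (f b).output prec <;> simp

@[simp] theorem output_filterM (prec : V → V → Bool) (f : β → Comp V Bool) (l : List β) :
    (l.filterM f).output prec = l.filter fun b => (f b).output prec := by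
  simp [List.filterM, output_filterAuxM]

variable [DecidableEq V]

@[simp] theorem asked_pure (prec : V → V → Bool) (a : α) :
    (pure a : Comp V α).asked prec = ∅ := rfl

@[simp] theorem asked_bind (prec : V → V → Bool) (m : Comp V α) (f : α → Comp V β) :
    (m >>= f).asked prec = m.asked prec ∪ (f (m.output prec)).asked prec := by
  change (m.bind f).asked prec = _
  induction m with
  | done a => exact (Finset.empty_union _).symm
  | query u v next ih =>
    change insert _ _ = insert _ _ ∪ _
    rw [Finset.insert_union]
    exact congrArg _ (ih _)

@[simp] theorem asked_ask (prec : V → V → Bool) (u v : V) :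
    (ask u v).asked prec = {s(u, v)} := rfl

theorem asked_reversed (prec : V → V → Bool) (m : Comp V α) :
    m.reversed.asked prec = m.asked fun u v => prec v u := by
  induction m with
  | done a => rfl
  | query u v next ih =>
    change insert s(v, u) _ = insert s(u, v) _
    rw [Sym2.eq_swap]
    exact congrArg _ (ih _)

theorem mem_asked_filterM {prec : V → V → Bool} {f : β → Comp V Bool} {l : List β} {e : Sym2 V} :
    e ∈ (l.filterM f).asked prec ↔ ∃ b ∈ l, e ∈ (f b).asked prec := by
  have key : ∀ acc : List β,
      e ∈ (l.filterAuxM f acc).asked prec ↔ ∃ b ∈ l, e ∈ (f b).asked prec := by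
    induction l with
    | nil => simp [List.filterAuxM]
    | cons b l ih => intro acc; simp [List.filterAuxM, ih]
  simp [List.filterM, key]

/-- A rule for loops: `I l s` is an invariant, where `l` is the list of remaining items. -/
theorem foldlM_induction {prec : V → V → Bool} {f : σ → β → Comp V σ} (I : List β → σ → Prop)
    (A : Sym2 V → Prop)
    (hf : ∀ b l s, I (b :: l) s →
      I l ((f s b).output prec) ∧ ∀ e ∈ (f s b).asked prec, A e)
    (l : List β) (s : σ) (hs : I l s) :
    I [] ((l.foldlM f s).output prec) ∧ ∀ e ∈ (l.foldlM f s).asked prec, A e := by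
  induction l generalizing s with
  | nil => simpa using hs
  | cons b l ih =>
    obtain ⟨h1, h2⟩ := hf b l s hs
    obtain ⟨h3, h4⟩ := ih _ h1
    simp only [List.foldlM_cons, output_bind, asked_bind, Finset.mem_union]
    exact ⟨h3, fun e he => he.elim (h2 e) (h4 e)⟩

end Comp

namespace StochSort

theorem output_predecessors {n : ℕ} (prec : Fin n → Fin n → Bool) (us : List (Fin n)) (v : Fin n) :
    (predecessors us v).output prec = us.filter fun u => prec u v := by
  simp [predecessors]

theorem mem_asked_predecessors {n : ℕ} {prec : Fin n → Fin n → Bool} {us : List (Fin n)}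
    {v : Fin n} {e : Sym2 (Fin n)} :
    e ∈ (predecessors us v).asked prec ↔ ∃ u ∈ us, e = s(u, v) := by
  simp [predecessors, Comp.mem_asked_filterM]

theorem output_firstPredecessor {n : ℕ} (prec : Fin n → Fin n → Bool) (us : List (Fin n))
    (v : Fin n) :
    (firstPredecessor us v).output prec = us.find? fun u => prec u v := by
  induction us with
  | nil => rfl
  | cons u us ih =>
    by_cases h : prec u v = true
    · simp [firstPredecessor, h]
    · simp [firstPredecessor, h, ih]

theorem mem_asked_firstPredecessor {n : ℕ} {prec : Fin n → Fin n → Bool} {us : List (Fin n)}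
    {v : Fin n} {e : Sym2 (Fin n)} (he : e ∈ (firstPredecessor us v).asked prec) :
    ∃ u ∈ us, e = s(u, v) := by
  induction us with
  | nil => simp [firstPredecessor] at he
  | cons u us ih =>
    by_cases h : prec u v = true
    · exact ⟨u, by simp, by simpa [firstPredecessor, h] using he⟩
    · simp only [firstPredecessor, Comp.asked_bind, Comp.output_ask, Comp.asked_ask, h,
        Finset.mem_union, Finset.mem_singleton] at he
      rcases he with rfl | he
      · exact ⟨u, by simp, rfl⟩
      · obtain ⟨w, hw, rfl⟩ := ih (by simpa using he)
        exact ⟨w, by simp [hw], rfl⟩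

theorem mem_potentialBlockers {n : ℕ} {E : ℕ → Fin n → Fin n → Bool} {c i : ℕ} {S : State n}
    {u v : Fin n} : u ∈ potentialBlockers E c i S v ↔ u ∈ S.level (i + c) ∧ E i u v = true := by
  simp [potentialBlockers]

end StochSort

/-! ### The invariant of the levels, and rebuilding -/

namespace StochSort

variable {n : ℕ}

/-- The position of `v` in the order `x 0, x 1, …, x (n - 1)`. -/
def pos (x : Equiv.Perm (Fin n)) (v : Fin n) : ℕ := (x.symm v : ℕ)

theorem precedes_eq_true {x : Equiv.Perm (Fin n)} {u v : Fin n} :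
    precedes x u v = true ↔ pos x u < pos x v := by
  simp [precedes, pos]

theorem pos_injective (x : Equiv.Perm (Fin n)) : Function.Injective (pos x) :=
  Fin.val_injective.comp x.symm.injective

theorem pos_lt (x : Equiv.Perm (Fin n)) (v : Fin n) : pos x v < n := (x.symm v).isLt

theorem exists_pos_eq (x : Equiv.Perm (Fin n)) {k : ℕ} (hk : k < n) : ∃ v, pos x v = k :=
  ⟨x ⟨k, hk⟩, by simp [pos]⟩

/-- No edge of the sets `E i, …, E q` joins `v` to an undiscovered predecessor that has been in the
levels long enough to block `v`. Here `ℓ` vertices have been discovered, and `R k` bounds the time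
of the last rebuild of level `k` from below. -/
def Unblocked (x : Equiv.Perm (Fin n)) (E : ℕ → Fin n → Fin n → Bool) (q c : ℕ) (R : ℕ → ℕ)
    (ℓ i : ℕ) (v : Fin n) : Prop :=
  ∀ k, i ≤ k → k ≤ q → ∀ u, ℓ ≤ pos x u → pos x u < pos x v → E k u v = true →
    ∃ k' s, k + c ≤ k' ∧ k' ≤ q ∧ R k ≤ pos x s ∧ pos x s < pos x u ∧ E k' s u = true

/-- The part of the invariant that concerns the levels from `b` on, after `ℓ` discoveries. -/
structure LevelInv (x : Equiv.Perm (Fin n)) (E : ℕ → Fin n → Fin n → Bool) (q c : ℕ) (R : ℕ → ℕ)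
    (b ℓ : ℕ) (S : State n) : Prop where
  mono : ∀ i, b ≤ i → S.level i ⊆ S.level (i + 1)
  top : ∀ i, q < i → ∀ v, v ∈ S.level i ↔ ℓ ≤ pos x v
  elim_lt : ∀ v u, S.elim v = some u → pos x u < pos x v
  unblocked : ∀ k, b ≤ k → k ≤ q → ∀ v ∈ S.level k, ∀ u, ℓ ≤ pos x u → pos x u < pos x v →
    E k u v = true →
    ∃ k' s, k + c ≤ k' ∧ k' ≤ q ∧ R k ≤ pos x s ∧ pos x s < pos x u ∧ E k' s u = true

/-- `v` is in level `b`, or it is kept out of it by the vertex that is recorded to block it, which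
is among the last `n - ℓ` vertices. -/
def Recorded (x : Equiv.Perm (Fin n)) (E : ℕ → Fin n → Fin n → Bool) (q b ℓ : ℕ) (S : State n)
    (v : Fin n) : Prop :=
  v ∈ S.level b ∨ ∃ u, S.elim v = some u ∧ ℓ ≤ pos x u ∧ pos x u < pos x v ∧
    ∃ k, b ≤ k ∧ k ≤ q ∧ E k u v = true ∧ v ∈ S.level (k + 1) ∧ v ∉ S.level k

/-- The invariant of the algorithm for the levels from `b` on, after `ℓ` discoveries. -/
structure Inv (x : Equiv.Perm (Fin n)) (E : ℕ → Fin n → Fin n → Bool) (q c : ℕ) (R : ℕ → ℕ)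
    (b ℓ : ℕ) (S : State n) : Prop where
  levels : LevelInv x E q c R b ℓ S
  recorded : ∀ v, ℓ ≤ pos x v → Recorded x E q b ℓ S v

section

variable {x : Equiv.Perm (Fin n)} {E : ℕ → Fin n → Fin n → Bool} {q c b ℓ ℓ₀ : ℕ} {R : ℕ → ℕ}
  {S : State n} {i j : ℕ} {v : Fin n}

theorem LevelInv.subset (h : LevelInv x E q c R b ℓ S) (hi : b ≤ i) (hij : i ≤ j) :
    S.level i ⊆ S.level j := by
  induction j, hij using Nat.le_induction with
  | base => exact subset_rfl
  | succ j hij ih => exact ih.trans (h.mono j (hi.trans hij))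

theorem LevelInv.le_pos (h : LevelInv x E q c R b ℓ S) (hi : b ≤ i) (hv : v ∈ S.level i) :
    ℓ ≤ pos x v :=
  (h.top (max i (q + 1)) (by omega) v).1 (h.subset hi (le_max_left _ _) hv)

theorem LevelInv.unblocked_of_mem (h : LevelInv x E q c R b ℓ S) (hi : b ≤ i)
    (hv : v ∈ S.level i) : Unblocked x E q c R ℓ i v :=
  fun k hik hkq => h.unblocked k (hi.trans hik) hkq v (h.subset hi hik hv)

/-- Read contrapositively, this is the source of all witnesses in `Unblocked`: a vertex missing from
level `i` has a recorded blocker joined to it by an edge of some `E k` with `k ≥ i`, because a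
record for a lower level would place it in level `k + 1` and hence in level `i`. The record may date
from another time `ℓ₀` than the levels. -/
theorem Recorded.mem_of_forall_not (hr : Recorded x E q b ℓ₀ S v)
    (h : LevelInv x E q c R b ℓ S) (hi : b ≤ i)
    (hE : ∀ k s, i ≤ k → k ≤ q → ℓ₀ ≤ pos x s → pos x s < pos x v → ¬ E k s v = true) :
    v ∈ S.level i := by
  rcases hr with hv | ⟨u, -, h1, h2, k, h3, h4, h5, h6, -⟩
  · exact h.subset le_rfl hi hv
  · by_cases hik : i ≤ k
    · exact absurd h5 (hE k u hik h4 h1 h2)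
    · exact h.subset (by omega) (by omega) h6

theorem Unblocked.mono {R' : ℕ → ℕ} {i' : ℕ} (h : Unblocked x E q c R ℓ i v)
    (hR : ∀ k, R' k ≤ R k) (hi : i ≤ i') : Unblocked x E q c R' ℓ i' v := by
  intro k hk hkq u h1 h2 h3
  obtain ⟨k', s, h4, h5, h6, h7, h8⟩ := h k (hi.trans hk) hkq u h1 h2 h3
  exact ⟨k', s, h4, h5, (hR k).trans h6, h7, h8⟩

/-- The levels below `b` are about to be rebuilt, so their content and rebuild times are forgotten.
A record that concerns one of them still shows that the vertex is in level `b`. -/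
theorem Inv.weaken (h : Inv x E q c R 1 ℓ S) {R' : ℕ → ℕ} (hb : 1 ≤ b)
    (hR : ∀ k, b ≤ k → R' k = R k) : Inv x E q c R' b ℓ S where
  levels :=
    { mono := fun i hi => h.levels.mono i (hb.trans hi)
      top := h.levels.top
      elim_lt := h.levels.elim_lt
      unblocked := fun k hk => by
        rw [hR k hk]
        exact h.levels.unblocked k (hb.trans hk) }
  recorded := fun v hv => by
    rcases h.recorded v hv with h1 | ⟨u, h1, h2, h3, k, h4, h5, h6, h7, h8⟩
    · exact Or.inl (h.levels.subset le_rfl hb h1)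
    · by_cases hbk : b ≤ k
      · exact Or.inr ⟨u, h1, h2, h3, k, hbk, h5, h6, h7, h8⟩
      · exact Or.inl (h.levels.subset (by omega) (by omega) h7)

/-- A pair that may be compared while level `i` is rebuilt. -/
def RebuildPair (x : Equiv.Perm (Fin n)) (E : ℕ → Fin n → Fin n → Bool) (q c : ℕ) (R : ℕ → ℕ)
    (ℓ i : ℕ) (e : Sym2 (Fin n)) : Prop :=
  ∃ u v, e = s(u, v) ∧ E i u v = true ∧ ℓ ≤ pos x u ∧ ℓ ≤ pos x v ∧
    Unblocked x E q c R ℓ (i + c) u ∧ Unblocked x E q c R ℓ (i + c) v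

theorem rebuildVertex_output (S : State n) :
    (rebuildVertex E c i S v).output (precedes x) =
      match ((potentialBlockers E c i S v).filter fun u => precedes x u v).getLast? with
      | none => { S with elim := Function.update S.elim v none }
      | some u =>
        { level := Function.update S.level i ((S.level i).erase v)
          elim := Function.update S.elim v (some u) } := by
  rw [rebuildVertex, Comp.output_bind, output_predecessors]
  rfl

theorem mem_asked_rebuildVertex {e : Sym2 (Fin n)}
    (he : e ∈ (rebuildVertex E c i S v).asked (precedes x)) :
    ∃ u, u ∈ S.level (i + c) ∧ E i u v = true ∧ e = s(u, v) := by
  simp only [rebuildVertex, Comp.asked_bind, Comp.asked_pure, Finset.union_empty,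
    mem_asked_predecessors, mem_potentialBlockers] at he
  obtain ⟨u, ⟨h1, h2⟩, h3⟩ := he
  exact ⟨u, h1, h2, h3⟩

/-- The state `S` of the loop that rebuilds level `i` from the state `S₀`, when the vertices `l` are
still to be treated. -/
structure RebuildInv (x : Equiv.Perm (Fin n)) (E : ℕ → Fin n → Fin n → Bool) (c i : ℕ)
    (S₀ : State n) (l : List (Fin n)) (S : State n) : Prop where
  nodup : l.Nodup
  mem_above : ∀ v ∈ l, v ∈ S₀.level (i + 1)
  level_ne : ∀ k, k ≠ i → S.level k = S₀.level k
  subset : S.level i ⊆ S₀.level (i + 1)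
  pending : ∀ v ∈ l, v ∈ S.level i
  not_blocked : ∀ v ∈ S.level i, v ∉ l → ∀ u ∈ S₀.level (i + c), E i u v = true →
    ¬ pos x u < pos x v
  blocked : ∀ v ∈ S₀.level (i + 1), v ∉ S.level i → ∃ u ∈ S₀.level (i + c), E i u v = true ∧
    pos x u < pos x v ∧ S.elim v = some u
  elim_eq : ∀ v, v ∉ S₀.level (i + 1) → S.elim v = S₀.elim v
  elim_lt : ∀ v u, S.elim v = some u → pos x u < pos x v

/-- Since `c ≥ 1`, the level `i + c` that supplies the blockers is not the one being modified, so
all tests refer to the initial state `S₀`. -/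
theorem RebuildInv.step {S₀ : State n} {l : List (Fin n)} (hc : 1 ≤ c)
    (h : RebuildInv x E c i S₀ (v :: l) S) :
    RebuildInv x E c i S₀ l ((rebuildVertex E c i S v).output (precedes x)) := by
  have hvl : v ∉ l := (List.nodup_cons.1 h.nodup).1
  have hvS : v ∈ S.level i := h.pending v (by simp)
  have hv0 : v ∈ S₀.level (i + 1) := h.mem_above v (by simp)
  have hlev : S.level (i + c) = S₀.level (i + c) := h.level_ne _ (by omega)
  rw [rebuildVertex_output]
  split
  · rename_i hnone
    rw [List.getLast?_eq_none_iff, List.filter_eq_nil_iff] at hnone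
    refine ⟨(List.nodup_cons.1 h.nodup).2, fun w hw => h.mem_above w (by simp [hw]), h.level_ne,
      h.subset, fun w hw => h.pending w (by simp [hw]), ?_, ?_, ?_, ?_⟩
    · intro w hw hwl u hu hE
      by_cases hwv : w = v
      · subst hwv
        have := hnone u (mem_potentialBlockers.2 ⟨hlev ▸ hu, hE⟩)
        rwa [precedes_eq_true] at this
      · exact h.not_blocked w hw (by simp [hwv, hwl]) u hu hE
    · intro w hw hwS
      have hwv : w ≠ v := fun hwv => hwS (hwv ▸ hvS)
      simpa [Function.update_of_ne hwv] using h.blocked w hw hwS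
    · intro w hw
      have hwv : w ≠ v := fun hwv => hw (hwv ▸ hv0)
      simpa [Function.update_of_ne hwv] using h.elim_eq w hw
    · intro w u hwu
      by_cases hwv : w = v
      · subst hwv
        simp at hwu
      · exact h.elim_lt w u (by simpa [Function.update_of_ne hwv] using hwu)
  · rename_i u₀ hsome
    have hu₀ := List.mem_of_getLast? hsome
    rw [List.mem_filter, mem_potentialBlockers, precedes_eq_true, hlev] at hu₀
    obtain ⟨⟨hu₀, hE₀⟩, hlt⟩ := hu₀
    refine ⟨(List.nodup_cons.1 h.nodup).2, fun w hw => h.mem_above w (by simp [hw]), ?_, ?_, ?_,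
      ?_, ?_, ?_, ?_⟩
    · intro k hk
      simpa [Function.update_of_ne hk] using h.level_ne k hk
    · intro w hw
      simp only [Function.update_self, Finset.mem_erase] at hw
      exact h.subset hw.2
    · intro w hw
      simp only [Function.update_self, Finset.mem_erase]
      exact ⟨fun hwv => hvl (hwv ▸ hw), h.pending w (by simp [hw])⟩
    · intro w hw hwl u hu hE
      simp only [Function.update_self, Finset.mem_erase] at hw
      exact h.not_blocked w hw.2 (by simp [hw.1, hwl]) u hu hE
    · intro w hw hwS
      simp only [Function.update_self, Finset.mem_erase] at hwS
      by_cases hwv : w = v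
      · subst hwv
        exact ⟨u₀, hu₀, hE₀, hlt, by simp⟩
      · simpa [Function.update_of_ne hwv] using h.blocked w hw (fun hw' => hwS ⟨hwv, hw'⟩)
    · intro w hw
      have hwv : w ≠ v := fun hwv => hw (hwv ▸ hv0)
      simpa [Function.update_of_ne hwv] using h.elim_eq w hw
    · intro w u hwu
      by_cases hwv : w = v
      · subst hwv
        simp only [Function.update_self, Option.some.injEq] at hwu
        exact hwu ▸ hlt
      · exact h.elim_lt w u (by simpa [Function.update_of_ne hwv] using hwu)

theorem rebuildLevel_spec (hc : 1 ≤ c) (hiq : i ≤ q) (hR : R i ≤ ℓ)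
    (h : Inv x E q c R (i + 1) ℓ S) :
    Inv x E q c R i ℓ ((rebuildLevel E c i S).output (precedes x)) ∧
      ∀ e ∈ (rebuildLevel E c i S).asked (precedes x), RebuildPair x E q c R ℓ i e := by
  have key := Comp.foldlM_induction (prec := precedes x) (f := rebuildVertex E c i)
    (RebuildInv x E c i S) (RebuildPair x E q c R ℓ i) ?_
    ((List.finRange n).filter fun v => v ∈ S.level (i + 1))
    { S with level := Function.update S.level i (S.level (i + 1)) } ?_
  · refine ⟨?_, key.2⟩
    have hS := key.1
    change RebuildInv x E c i S [] ((rebuildLevel E c i S).output (precedes x)) at hS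
    generalize (rebuildLevel E c i S).output (precedes x) = S' at hS
    have hlev : ∀ k, i + 1 ≤ k → S'.level k = S.level k := fun k hk => hS.level_ne k (by omega)
    refine ⟨⟨?_, ?_, hS.elim_lt, ?_⟩, ?_⟩
    · intro k hk
      rcases hk.eq_or_lt with rfl | hk
      · rw [hlev (i + 1) le_rfl]
        exact hS.subset
      · rw [hlev k hk, hlev (k + 1) (by omega)]
        exact h.levels.mono k hk
    · intro k hk v
      rw [hlev k (by omega)]
      exact h.levels.top k hk v
    · intro k hk hkq v hv u h1 h2 h3
      rcases hk.eq_or_lt with rfl | hk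
      -- Without a witness `u` would be in level `i + c`, and the test of `v` against it would have
      -- removed `v`. A recorded blocker of `u` is undiscovered now, so its position is at least `ℓ
      -- ≥ R i`.
      · by_contra hcon
        push Not at hcon
        refine hS.not_blocked v hv (by simp) u ?_ h3 h2
        refine (h.recorded u h1).mem_of_forall_not h.levels (by omega) ?_
        intro k' s h4 h5 h6 h7 h8
        exact hcon k' s h4 h5 (hR.trans h6) h7 h8
      · rw [hlev k hk] at hv
        exact h.levels.unblocked k hk hkq v hv u h1 h2 h3
    · intro v hv
      by_cases hv1 : v ∈ S.level (i + 1)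
      · by_cases hvi : v ∈ S'.level i
        · exact Or.inl hvi
        · obtain ⟨u, hu, hE, hlt, hel⟩ := hS.blocked v hv1 hvi
          refine Or.inr ⟨u, hel, h.levels.le_pos (by omega) hu, hlt, i, le_rfl, hiq, hE, ?_, hvi⟩
          rwa [hlev _ le_rfl]
      · rcases h.recorded v hv with h1 | ⟨u, h1, h2, h3, k, h4, h5, h6, h7, h8⟩
        · exact absurd h1 hv1
        · refine Or.inr ⟨u, (hS.elim_eq v hv1).trans h1, h2, h3, k, by omega, h5, h6, ?_, ?_⟩
          · rwa [hlev _ (by omega)]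
          · rwa [hlev _ h4]
  · intro v l S' hS'
    refine ⟨hS'.step hc, fun e he => ?_⟩
    obtain ⟨u, hu, hE, rfl⟩ := mem_asked_rebuildVertex he
    rw [hS'.level_ne (i + c) (by omega)] at hu
    have hv : v ∈ S.level (i + c) :=
      h.levels.subset le_rfl (by omega) (hS'.mem_above v (by simp))
    exact ⟨u, v, rfl, hE, h.levels.le_pos (by omega) hu, h.levels.le_pos (by omega) hv,
      h.levels.unblocked_of_mem (by omega) hu, h.levels.unblocked_of_mem (by omega) hv⟩
  · refine ⟨(List.nodup_finRange n).filter _, by simp, ?_, by simp, by simp, ?_, ?_, by simp,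
      h.levels.elim_lt⟩
    · intro k hk
      simp [Function.update_of_ne hk]
    · intro v hv hvl
      simp only [Function.update_self] at hv
      simp [hv] at hvl
    · intro v hv hvS
      simp only [Function.update_self] at hvS
      exact absurd hv hvS

theorem createLevels_spec (hc : 1 ≤ c) (hiq : i ≤ q) (hR : ∀ k, 1 ≤ k → k ≤ i → R k ≤ ℓ)
    (h : Inv x E q c R (i + 1) ℓ S) :
    Inv x E q c R 1 ℓ ((createLevels E c i S).output (precedes x)) ∧
      ∀ e ∈ (createLevels E c i S).asked (precedes x),
        ∃ k, 1 ≤ k ∧ k ≤ i ∧ RebuildPair x E q c R ℓ k e := by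
  induction i generalizing S with
  | zero => exact ⟨h, by simp [createLevels]⟩
  | succ i ih =>
    obtain ⟨h1, h2⟩ := rebuildLevel_spec hc hiq (hR (i + 1) (by omega) le_rfl) h
    obtain ⟨h3, h4⟩ := ih (by omega) (fun k hk hki => hR k hk (by omega)) h1
    simp only [createLevels, Comp.output_bind, Comp.asked_bind, Finset.mem_union]
    refine ⟨h3, fun e he => ?_⟩
    rcases he with he | he
    · exact ⟨i + 1, by omega, le_rfl, h2 e he⟩
    · obtain ⟨k, hk, hki, hk'⟩ := h4 e he
      exact ⟨k, hk, by omega, hk'⟩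

theorem initial_inv :
    Inv x E q c R (q + 1) 0
      { level := fun _ => Finset.univ, elim := fun _ => (none : Option (Fin n)) } where
  levels :=
    { mono := fun _ _ => subset_rfl
      top := by simp
      elim_lt := by simp
      unblocked := fun k hk hkq => by omega }
  recorded := fun v _ => Or.inl (by simp)

end

end StochSort

/-! ### The incremental update -/

namespace StochSort

variable {n : ℕ} {x : Equiv.Perm (Fin n)} {E : ℕ → Fin n → Fin n → Bool} {q c ℓ ℓ₀ : ℕ}
  {R : ℕ → ℕ} {S : State n} {i : ℕ} {v : Fin n}

/-- A pair that may be compared while `v` advances through level `i`. -/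
def AdvancePairOf (x : Equiv.Perm (Fin n)) (E : ℕ → Fin n → Fin n → Bool) (q c : ℕ) (R : ℕ → ℕ)
    (ℓ i : ℕ) (v : Fin n) (e : Sym2 (Fin n)) : Prop :=
  ∃ u, e = s(u, v) ∧ E i u v = true ∧ ℓ ≤ pos x u ∧ ℓ ≤ pos x v ∧
    Unblocked x E q c R ℓ (i + c) u ∧ Unblocked x E q c R ℓ (i + c) v

/-- The states `S` and `S'` differ at most in what they record about `v`. -/
def AgreeExcept (v : Fin n) (S S' : State n) : Prop :=
  ∀ w, w ≠ v → (∀ k, w ∈ S'.level k ↔ w ∈ S.level k) ∧ S'.elim w = S.elim w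

theorem AgreeExcept.trans {S₁ S₂ S₃ : State n} (h₁ : AgreeExcept v S₁ S₂)
    (h₂ : AgreeExcept v S₂ S₃) : AgreeExcept v S₁ S₃ := fun w hw =>
  ⟨fun k => ((h₂ w hw).1 k).trans ((h₁ w hw).1 k), (h₂ w hw).2.trans (h₁ w hw).2⟩

theorem AgreeExcept.recorded {S' : State n} {b : ℕ} {w : Fin n} (h : AgreeExcept v S S')
    (hw : w ≠ v) (hr : Recorded x E q b ℓ S w) : Recorded x E q b ℓ S' w := by
  obtain ⟨h1, h2⟩ := h w hw
  rcases hr with hr | ⟨u, h3, h4, h5, k, h6, h7, h8, h9, h10⟩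
  · exact Or.inl ((h1 b).2 hr)
  · exact Or.inr ⟨u, h2.trans h3, h4, h5, k, h6, h7, h8, (h1 _).2 h9, fun h => h10 ((h1 _).1 h)⟩

/-- The levels already reflect `ℓ` discoveries, while records may still date from `ℓ₀`: during the
update, a predecessor of `v` may still be waiting with the discovered vertex as its recorded
blocker. That vertex is an admissible witness, since `Unblocked` asks for `R k ≤ pos x s` and not
for `ℓ ≤ pos x s`. -/
theorem advance_spec (hc : 1 ≤ c) (hR : ∀ k, 1 ≤ k → k ≤ q → R k ≤ ℓ₀) (hi : 1 ≤ i)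
    (hiq : i ≤ q + 1) (hS : LevelInv x E q c R 1 ℓ S) (hvi : v ∈ S.level i)
    (hvk : ∀ k, 1 ≤ k → k < i → v ∉ S.level k)
    (hrec : ∀ u, ℓ ≤ pos x u → pos x u < pos x v → Recorded x E q 1 ℓ₀ S u) :
    LevelInv x E q c R 1 ℓ ((advance E c v i S).output (precedes x)) ∧
      AgreeExcept v S ((advance E c v i S).output (precedes x)) ∧
      Recorded x E q 1 ℓ ((advance E c v i S).output (precedes x)) v ∧
      ∀ e ∈ (advance E c v i S).asked (precedes x),
        ∃ k, 1 ≤ k ∧ k < i ∧ AdvancePairOf x E q c R ℓ k v e := by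
  induction i generalizing S with
  | zero => omega
  | succ i ih =>
    match i with
    | 0 =>
      refine ⟨hS, fun w _ => ⟨fun k => Iff.rfl, rfl⟩, Or.inl hvi, ?_⟩
      simp [advance]
    | j + 1 =>
      have hv : ℓ ≤ pos x v := hS.le_pos (by omega) hvi
      have hasked : ∀ e ∈ (firstPredecessor (potentialBlockers E c (j + 1) S v) v).asked
          (precedes x), ∃ k, 1 ≤ k ∧ k < j + 1 + 1 ∧ AdvancePairOf x E q c R ℓ k v e := by
        intro e he
        obtain ⟨u, hu, rfl⟩ := mem_asked_firstPredecessor he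
        rw [mem_potentialBlockers] at hu
        have hvc : v ∈ S.level (j + 1 + c) := hS.subset (by omega) (by omega) hvi
        exact ⟨j + 1, by omega, by omega, u, rfl, hu.2, hS.le_pos (by omega) hu.1, hv,
          hS.unblocked_of_mem (by omega) hu.1, hS.unblocked_of_mem (by omega) hvc⟩
      rw [advance]
      simp only [Comp.output_bind, Comp.asked_bind, output_firstPredecessor, Finset.mem_union]
      cases hf : (potentialBlockers E c (j + 1) S v).find? fun u => precedes x u v with
      | some u =>
        have hu1 := List.mem_of_find?_eq_some hf
        have hu2 := List.find?_some hf
        rw [mem_potentialBlockers] at hu1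
        rw [precedes_eq_true] at hu2
        simp only [Comp.output_pure, Comp.asked_pure, Finset.notMem_empty, or_false]
        refine ⟨⟨hS.mono, hS.top, ?_, hS.unblocked⟩, ?_, ?_, hasked⟩
        · intro w u' hw
          by_cases hwv : w = v
          · subst hwv
            simp only [Function.update_self, Option.some.injEq] at hw
            exact hw ▸ hu2
          · exact hS.elim_lt w u' (by simpa [Function.update_of_ne hwv] using hw)
        · intro w hw
          simp [Function.update_of_ne hw]
        · exact Or.inr ⟨u, by simp, hS.le_pos (by omega) hu1.1, hu2, j + 1, by omega, by omega,
            hu1.2, hvi, hvk (j + 1) (by omega) (by omega)⟩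
      | none =>
        rw [List.find?_eq_none] at hf
        set S' : State n :=
          { S with level := Function.update S.level (j + 1) (insert v (S.level (j + 1))) } with hS'
        have hne : ∀ k, k ≠ j + 1 → S'.level k = S.level k := fun k hk => by
          simp [hS', Function.update_of_ne hk]
        have heq : S'.level (j + 1) = insert v (S.level (j + 1)) := by simp [hS']
        have hagree : AgreeExcept v S S' := by
          intro w hw
          refine ⟨fun k => ?_, rfl⟩
          by_cases hk : k = j + 1
          · subst hk
            simp [heq, hw]
          · rw [hne k hk]
        have hinv : LevelInv x E q c R 1 ℓ S' := by
          refine ⟨?_, ?_, hS.elim_lt, ?_⟩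
          · intro k hk
            by_cases h1 : k = j + 1
            · subst h1
              rw [heq, hne _ (by omega)]
              exact Finset.insert_subset hvi (hS.mono _ hk)
            · rw [hne k h1]
              by_cases h2 : k + 1 = j + 1
              · rw [h2, heq]
                exact ((hS.mono k hk).trans (by rw [h2])).trans (Finset.subset_insert _ _)
              · rw [hne _ h2]
                exact hS.mono k hk
          · intro k hk w
            rw [hne k (by omega)]
            exact hS.top k hk w
          · intro k hk hkq w hw u h1 h2 h3
            by_cases hkj : k = j + 1
            · subst hkj
              rw [heq, Finset.mem_insert] at hw
              rcases hw with rfl | hw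
              · by_contra hcon
                push Not at hcon
                refine hf u (mem_potentialBlockers.2 ⟨?_, h3⟩) (precedes_eq_true.2 h2)
                refine (hrec u h1 h2).mem_of_forall_not hS (by omega) ?_
                intro k' s h4 h5 h6 h7 h8
                exact hcon k' s h4 h5 ((hR _ hk hkq).trans h6) h7 h8
              · exact hS.unblocked _ hk hkq w hw u h1 h2 h3
            · rw [hne k hkj] at hw
              exact hS.unblocked _ hk hkq w hw u h1 h2 h3
        obtain ⟨h1, h2, h3, h4⟩ := ih (S := S') (by omega) (by omega) hinv (by simp [heq])
          (fun k hk hkj => by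
            rw [hne k (by omega)]
            exact hvk k hk (by omega))
          (fun u hu1 hu2 => hagree.recorded (fun huv => by subst huv; omega) (hrec u hu1 hu2))
        refine ⟨h1, hagree.trans h2, h3, fun e he => ?_⟩
        rcases he with he | he
        · exact hasked e he
        · obtain ⟨k, hk1, hk2, hk3⟩ := h4 e he
          exact ⟨k, hk1, by omega, hk3⟩

theorem lowestLevel_eq (hi : 1 ≤ i) (hiq : i ≤ q + 1) (hvi : v ∈ S.level i)
    (hvk : ∀ k, 1 ≤ k → k < i → v ∉ S.level k) : lowestLevel q S v = i := by
  have : (List.range' 1 (q + 1)).find? (fun i => decide (v ∈ S.level i)) = some i := by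
    rw [List.find?_eq_some_iff_append]
    refine ⟨by simpa using hvi, List.range' 1 (i - 1), List.range' (i + 1) (q + 1 - i), ?_, ?_⟩
    · have h1 : List.range' 1 (q + 1) = List.range' 1 (i - 1) ++ List.range' i (q + 2 - i) := by
        rw [show q + 1 = (i - 1) + (q + 2 - i) by omega, ← List.range'_append_1]
        congr 2; omega
      rw [h1, show q + 2 - i = (q + 1 - i) + 1 by omega, List.range'_succ]
    · intro k hk
      rw [List.mem_range'_1] at hk
      simpa using hvk k (by omega) (by omega)
  simp [lowestLevel, this]

/-- A pair that may be compared at level `i` by the incremental update after the `ℓ`-th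
discovery. -/
def AdvancePair (x : Equiv.Perm (Fin n)) (E : ℕ → Fin n → Fin n → Bool) (q c : ℕ) (R : ℕ → ℕ)
    (ℓ i : ℕ) (e : Sym2 (Fin n)) : Prop :=
  ∃ v, AdvancePairOf x E q c R ℓ i v e ∧
    ∃ y k, pos x y + 1 = ℓ ∧ i ≤ k ∧ k ≤ q ∧ E k y v = true

theorem increment_spec {y : Fin n} (hc : 1 ≤ c) (hR : ∀ k, 1 ≤ k → k ≤ q → R k ≤ ℓ)
    (hy : pos x y = ℓ) (h : Inv x E q c R 1 ℓ S) :
    Inv x E q c R 1 (ℓ + 1) ((increment E q c y S).output (precedes x)) ∧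
      ∀ e ∈ (increment E q c y S).asked (precedes x),
        ∃ i, 1 ≤ i ∧ i ≤ q ∧ AdvancePair x E q c R (ℓ + 1) i e := by
  have hlt : ∀ v, ℓ + 1 ≤ pos x v ↔ v ≠ y ∧ ℓ ≤ pos x v := by
    intro v
    constructor
    · intro hv
      exact ⟨fun hvy => by subst hvy; omega, by omega⟩
    · rintro ⟨h1, h2⟩
      have : pos x v ≠ pos x y := fun h => h1 (pos_injective x h)
      omega
  have key := Comp.foldlM_induction (prec := precedes x)
    (f := fun S v => advance E c v (lowestLevel q S v)
      { S with elim := Function.update S.elim v none })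
    (fun l S => LevelInv x E q c R 1 (ℓ + 1) S ∧ l.Nodup ∧ (∀ v ∈ l, S.elim v = some y) ∧
      ∀ v, ℓ + 1 ≤ pos x v → Recorded x E q 1 ℓ S v ∧ (v ∉ l → Recorded x E q 1 (ℓ + 1) S v))
    (fun e => ∃ i, 1 ≤ i ∧ i ≤ q ∧ AdvancePair x E q c R (ℓ + 1) i e) ?_
    ((List.finRange n).filter fun v => S.elim v = some y)
    { S with level := fun i => (S.level i).erase y } ?_
  · obtain ⟨⟨h1, -, -, h2⟩, h3⟩ := key
    exact ⟨⟨h1, fun v hv => (h2 v hv).2 (by simp)⟩, h3⟩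
  · rintro v l S ⟨hS, hnd, hel, hrec⟩
    obtain ⟨hvl, hnd⟩ := List.nodup_cons.1 hnd
    have helv := hel v (by simp)
    have hv : ℓ + 1 ≤ pos x v := by
      have := hS.elim_lt v y helv
      omega
    -- The lowest level of `v` is the one just above the level from which `y` kept it out. The edge
    -- from `y` that did so is remembered: it makes the advance of `v` unlikely.
    obtain ⟨i, hi, hiq, hvi, hvk, hEi⟩ : ∃ i, 1 ≤ i ∧ i ≤ q + 1 ∧ v ∈ S.level i ∧
        (∀ k, 1 ≤ k → k < i → v ∉ S.level k) ∧
        (1 < i → ∃ k, i ≤ k + 1 ∧ k ≤ q ∧ E k y v = true) := by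
      rcases (hrec v hv).1 with h1 | ⟨u, h1, h2, h3, k, h4, h5, h6, h7, h8⟩
      · exact ⟨1, le_rfl, by omega, h1, fun k _ _ => by omega, fun h => by omega⟩
      · rw [helv, Option.some.injEq] at h1
        subst h1
        exact ⟨k + 1, by omega, by omega, h7,
          fun k' h1 h2 hm => h8 (hS.subset h1 (by omega) hm), fun _ => ⟨k, le_rfl, h5, h6⟩⟩
    rw [lowestLevel_eq hi hiq hvi hvk]
    set S' : State n := { S with elim := Function.update S.elim v none } with hS'
    have hagree : AgreeExcept v S S' := fun w hw => by simp [hS', Function.update_of_ne hw]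
    have hS'inv : LevelInv x E q c R 1 (ℓ + 1) S' := by
      refine ⟨hS.mono, hS.top, ?_, hS.unblocked⟩
      intro w u hw
      by_cases hwv : w = v
      · subst hwv
        simp [hS'] at hw
      · exact hS.elim_lt w u (by simpa [hS', Function.update_of_ne hwv] using hw)
    obtain ⟨h1, h2, h3, h4⟩ := advance_spec hc hR hi hiq hS'inv hvi hvk
      (fun u hu1 hu2 => hagree.recorded (fun huv => by subst huv; omega) (hrec u hu1).1)
    have h5 := hagree.trans h2
    refine ⟨⟨h1, hnd, ?_, ?_⟩, ?_⟩
    · intro w hw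
      rw [(h5 w (fun hwv => hvl (hwv ▸ hw))).2]
      exact hel w (by simp [hw])
    · intro w hw
      by_cases hwv : w = v
      · subst hwv
        refine ⟨?_, fun _ => h3⟩
        rcases h3 with h3 | ⟨u, h6, h7, h8⟩
        · exact Or.inl h3
        · exact Or.inr ⟨u, h6, by omega, h8⟩
      · exact ⟨h5.recorded hwv (hrec w hw).1,
          fun hwl => h5.recorded hwv ((hrec w hw).2 (by simp [hwv, hwl]))⟩
    · intro e he
      obtain ⟨k, hk1, hk2, hk3⟩ := h4 e he
      obtain ⟨k', hk4, hk5, hk6⟩ := hEi (by omega)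
      exact ⟨k, hk1, by omega, v, hk3, y, k', by omega, by omega, hk5, hk6⟩
  · refine ⟨⟨?_, ?_, h.levels.elim_lt, ?_⟩, (List.nodup_finRange n).filter _, by simp, ?_⟩
    · exact fun i hi => Finset.erase_subset_erase _ (h.levels.mono i hi)
    · intro i hi v
      rw [Finset.mem_erase, h.levels.top i hi v, hlt]
    · intro k hk hkq v hv u h1 h2 h3
      exact h.levels.unblocked k hk hkq v (Finset.mem_of_mem_erase hv) u (by omega) h2 h3
    · intro v hv
      obtain ⟨hvy, hv⟩ := (hlt v).1 hv
      rcases h.recorded v hv with h1 | ⟨u, h1, h2, h3, k, h4, h5, h6, h7, h8⟩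
      · have : Recorded x E q 1 (ℓ + 1) { S with level := fun i => (S.level i).erase y } v :=
          Or.inl (Finset.mem_erase.2 ⟨hvy, h1⟩)
        exact ⟨Or.inl (Finset.mem_erase.2 ⟨hvy, h1⟩), fun _ => this⟩
      · have h9 : v ∈ (S.level (k + 1)).erase y := Finset.mem_erase.2 ⟨hvy, h7⟩
        have h10 : v ∉ (S.level k).erase y := fun h => h8 (Finset.mem_of_mem_erase h)
        refine ⟨Or.inr ⟨u, h1, h2, h3, k, h4, h5, h6, h9, h10⟩, fun hvl => ?_⟩
        refine Or.inr ⟨u, h1, (hlt u).2 ⟨?_, h2⟩, h3, k, h4, h5, h6, h9, h10⟩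
        rintro rfl
        simp [h1] at hvl

end StochSort

/-! ### The searches, and the deterministic description of a whole run -/

namespace StochSort

variable {n : ℕ}

/-- `adj` is the adjacency relation of a graph that contains the path `x 0, x 1, …, x (n - 1)`, and
the sets `E k` consist of edges of that graph. -/
structure ValidInput (x : Equiv.Perm (Fin n)) (adj : Fin n → Fin n → Bool)
    (E : ℕ → Fin n → Fin n → Bool) : Prop where
  symm : ∀ u v, adj u v = true → adj v u = true
  irrefl : ∀ v, ¬ adj v v = true
  path : ∀ u v, pos x u + 1 = pos x v → adj u v = true
  sub : ∀ k u v, E k u v = true → adj u v = true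

/-- A pair that may be compared in round `r` of the search for the vertex in position `ℓ`. -/
def SearchPair (x : Equiv.Perm (Fin n)) (adj : Fin n → Fin n → Bool)
    (E : ℕ → Fin n → Fin n → Bool) (q c : ℕ) (R : ℕ → ℕ) (ℓ r : ℕ) (e : Sym2 (Fin n)) : Prop :=
  ∃ y, ℓ < pos x y ∧ (∃ z, pos x z + 1 = ℓ ∧ adj z y = true) ∧ Unblocked x E q c R ℓ 1 y ∧
    (2 ≤ r → ∀ u, ℓ ≤ pos x u → pos x u < pos x y → adj u y = true →
      ∃ k s, r ≤ k + 1 ∧ k ≤ q ∧ ℓ ≤ pos x s ∧ pos x s < pos x u ∧ E k s u = true) ∧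
    ∃ u z, e = s(u, z) ∧ (z = y ∨ pos x z = ℓ) ∧ u ≠ y ∧ adj u z = true ∧ ℓ ≤ pos x u ∧
      Unblocked x E q c R ℓ r u

variable {x : Equiv.Perm (Fin n)} {adj : Fin n → Fin n → Bool} {E : ℕ → Fin n → Fin n → Bool}
  {q c ℓ : ℕ} {R : ℕ → ℕ} {S : State n}

theorem output_eliminate (i : ℕ) (C : List (Fin n)) :
    (eliminate adj i S C).output (precedes x) =
      C.filter fun v => decide (∀ u ∈ S.level i, adj u v = true → ¬ pos x u < pos x v) := by
  simp only [eliminate, Comp.output_filterM, Comp.output_bind, output_predecessors,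
    Comp.output_pure]
  refine List.filter_congr fun v _ => ?_
  rw [Bool.eq_iff_iff, List.isEmpty_iff, List.filter_eq_nil_iff, decide_eq_true_iff]
  simp only [List.mem_filter, List.mem_finRange, true_and, decide_eq_true_eq, precedes_eq_true,
    and_imp]

theorem mem_asked_eliminate {i : ℕ} {C : List (Fin n)} {e : Sym2 (Fin n)}
    (he : e ∈ (eliminate adj i S C).asked (precedes x)) :
    ∃ v ∈ C, ∃ u ∈ S.level i, adj u v = true ∧ e = s(u, v) := by
  simp only [eliminate, Comp.mem_asked_filterM, Comp.asked_bind, Comp.asked_pure,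
    Finset.union_empty, mem_asked_predecessors, List.mem_filter, List.mem_finRange, true_and,
    decide_eq_true_eq] at he
  obtain ⟨v, hv, u, ⟨hu, ha⟩, he⟩ := he
  exact ⟨v, hv, u, hu, ha, he⟩

/-- The next vertex `y₀` stays in `C` because it has no undiscovered predecessor. The equation `r +
m = q + 2` says that level `q + 1` is the last one tested. -/
theorem narrow_spec (hV : ValidInput x adj E) (hS : Inv x E q c R 1 ℓ S) {z y₀ : Fin n}
    (hz : pos x z + 1 = ℓ) (hy₀ : pos x y₀ = ℓ) (m r : ℕ) (hr : 1 ≤ r) (hm : r + m = q + 2)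
    (C : List (Fin n)) (hnd : C.Nodup) (hmem : y₀ ∈ C)
    (hC : ∀ v ∈ C, adj z v = true ∧ v ∈ S.level 1 ∧
      (2 ≤ r → ∀ u ∈ S.level (r - 1), adj u v = true → ¬ pos x u < pos x v)) :
    (narrow adj S (List.range' r m) C).output (precedes x) = [y₀] ∧
      ∀ e ∈ (narrow adj S (List.range' r m) C).asked (precedes x),
        ∃ r', 1 ≤ r' ∧ r' ≤ q + 1 ∧ SearchPair x adj E q c R ℓ r' e := by
  have hsingle : ∀ C : List (Fin n), y₀ ∈ C → C.length ≤ 1 → C = [y₀] := by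
    intro C h1 h2
    match C, h1, h2 with
    | [a], h1, _ => simp_all
    | a :: b :: C, _, h2 => simp at h2
  have hlater : ∀ v ∈ S.level 1, v ≠ y₀ → ℓ < pos x v := by
    intro v hv hne
    have h1 := hS.levels.le_pos le_rfl hv
    have h2 : pos x v ≠ pos x y₀ := fun h => hne (pos_injective x h)
    omega
  induction m generalizing r C with
  | zero =>
    refine ⟨?_, by simp [narrow]⟩
    have hall : ∀ v ∈ C, v = y₀ := by
      intro v hv
      by_contra hne
      obtain ⟨-, h1, h2⟩ := hC v hv
      have h3 := hlater v h1 hne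
      -- The path predecessor of `v` is undiscovered, hence in level `q + 1`, and would have
      -- eliminated `v` in the last round.
      obtain ⟨u, hu⟩ := exists_pos_eq x (k := pos x v - 1) (by have := pos_lt x v; omega)
      exact h2 (by omega) u ((hS.levels.top _ (by omega) u).2 (by omega))
        (hV.path u v (by omega)) (by omega)
    refine hsingle C hmem ?_
    rw [List.eq_replicate_of_mem hall] at hnd
    exact List.nodup_replicate.1 hnd
  | succ m ih =>
    rw [List.range'_succ, narrow]
    split_ifs with hlen
    · exact ⟨hsingle C hmem hlen, by simp⟩
    · simp only [Comp.output_bind, Comp.asked_bind, Finset.mem_union, output_eliminate]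
      obtain ⟨h1, h2⟩ := ih (r + 1) (by omega) (by omega)
        (C.filter fun v => decide (∀ u ∈ S.level r, adj u v = true → ¬ pos x u < pos x v))
        (hnd.filter _)
        (by
          simp only [List.mem_filter, decide_eq_true_eq]
          refine ⟨hmem, fun u hu _ => ?_⟩
          have := hS.levels.le_pos hr hu
          omega)
        (by
          simp only [List.mem_filter, decide_eq_true_eq, Nat.add_sub_cancel]
          rintro v ⟨hv, hv'⟩
          exact ⟨(hC v hv).1, (hC v hv).2.1, fun _ => hv'⟩)
      refine ⟨h1, fun e he => he.elim (fun he => ?_) (h2 e)⟩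
      obtain ⟨v, hv, u, hu, hadj, rfl⟩ := mem_asked_eliminate he
      -- A round takes place only while there are two candidates, so the comparisons made for `y₀`
      -- can be charged to another candidate `y`.
      obtain ⟨y, hyC, hyne⟩ : ∃ y ∈ C, y ≠ y₀ := by
        by_contra hcon
        push Not at hcon
        refine hlen ?_
        rw [List.eq_replicate_of_mem hcon] at hnd
        exact List.nodup_replicate.1 hnd
      have hgen : ∀ y ∈ C, y ≠ y₀ → ∀ u w, u ∈ S.level r → (w = y ∨ pos x w = ℓ) → u ≠ y →
          adj u w = true → SearchPair x adj E q c R ℓ r s(u, w) := by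
        intro y hyC hyne u w hu hw huy hadj
        obtain ⟨h3, h4, h5⟩ := hC y hyC
        refine ⟨y, hlater y h4 hyne, ⟨z, hz, h3⟩, hS.levels.unblocked_of_mem le_rfl h4, ?_,
          u, w, rfl, hw, huy, hadj, hS.levels.le_pos hr hu, hS.levels.unblocked_of_mem hr hu⟩
        intro hr2 t ht1 ht2 ht3
        by_contra hcon
        push Not at hcon
        refine h5 hr2 t ?_ ht3 ht2
        refine (hS.recorded t ht1).mem_of_forall_not hS.levels (by omega) ?_
        intro k s h6 h7 h8 h9 h10
        exact hcon k s (by omega) h7 h8 h9 h10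
      by_cases hvy : v = y₀
      · subst hvy
        by_cases huy : u = y
        · subst huy
          -- The pair of `y₀` and `y` itself has no third vertex. It is booked under round 1 with
          -- the roles exchanged: `y₀`, a member of level 1, is the vertex compared with the
          -- candidate.
          refine ⟨1, le_rfl, by omega, ?_⟩
          obtain ⟨h3, h4, h5⟩ := hC u hyC
          refine ⟨u, hlater u h4 hyne, ⟨z, hz, h3⟩, hS.levels.unblocked_of_mem le_rfl h4,
            fun h => by omega, v, u, Sym2.eq_swap, Or.inl rfl, hyne.symm, hV.symm _ _ hadj, hy₀.ge,
            hS.levels.unblocked_of_mem le_rfl (hC v hmem).2.1⟩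
        · exact ⟨r, hr, by omega, hgen y hyC hyne u v hu (Or.inr hy₀) huy hadj⟩
      · refine ⟨r, hr, by omega, hgen v hv hvy u v hu (Or.inl rfl) ?_ hadj⟩
        rintro rfl
        exact hV.irrefl _ hadj

theorem findNext_spec (hV : ValidInput x adj E) (hS : Inv x E q c R 1 ℓ S) {z y₀ : Fin n}
    (hz : pos x z + 1 = ℓ) (hy₀ : pos x y₀ = ℓ) :
    (findNext adj q z S).output (precedes x) = y₀ ∧
      ∀ e ∈ (findNext adj q z S).asked (precedes x),
        ∃ r, 1 ≤ r ∧ r ≤ q + 1 ∧ SearchPair x adj E q c R ℓ r e := by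
  have hmem : y₀ ∈ S.level 1 := by
    rcases hS.recorded y₀ hy₀.ge with h | ⟨u, -, h1, h2, -⟩
    · exact h
    · omega
  obtain ⟨h1, h2⟩ := narrow_spec hV hS hz hy₀ (q + 1) 1 le_rfl (by omega)
    ((List.finRange n).filter fun v => v ∈ S.level 1 ∧ adj z v)
    ((List.nodup_finRange n).filter _)
    (by simp [hmem, hV.path z y₀ (by omega)])
    (by
      intro v hv
      simp only [List.mem_filter, List.mem_finRange, true_and, decide_eq_true_eq] at hv
      exact ⟨hv.2, hv.1, fun h => by omega⟩)
  simp only [findNext, Comp.output_bind, Comp.output_pure, Comp.asked_bind, Comp.asked_pure,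
    Finset.union_empty, h1]
  exact ⟨rfl, h2⟩

/-- While `v₀` is not first, its path predecessor is a neighbour outside `S`, as `S` contains only
later vertices. Each comparison adds a vertex to `S`, which never contains `v₀`, so the rounds
cannot run out, and their number bounds the comparisons. -/
theorem findFirst_spec (hV : ValidInput x adj E) (k : ℕ) (v₀ : Fin n) (S : Finset (Fin n))
    (hS : ∀ u ∈ S, pos x v₀ < pos x u) (hk : n ≤ k + S.card) :
    pos x ((findFirst adj k v₀ S).output (precedes x)) = 0 ∧
      ((findFirst adj k v₀ S).asked (precedes x)).card ≤ k ∧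
      ∀ e ∈ (findFirst adj k v₀ S).asked (precedes x), ∃ u v, e = s(u, v) ∧ adj u v = true := by
  induction k generalizing v₀ S with
  | zero =>
    have h1 : S = Finset.univ := by
      rw [← Finset.card_eq_iff_eq_univ, Fintype.card_fin]
      have := S.card_le_univ
      rw [Fintype.card_fin] at this
      omega
    exact absurd (hS v₀ (by simp [h1])) (lt_irrefl _)
  | succ k ih =>
    rw [findFirst]
    split
    · rename_i hnone
      rw [List.find?_eq_none] at hnone
      refine ⟨?_, by simp, by simp⟩
      by_contra hpos
      change pos x v₀ ≠ 0 at hpos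
      obtain ⟨u, hu⟩ := exists_pos_eq x (k := pos x v₀ - 1) (by have := pos_lt x v₀; omega)
      have h1 := hnone u (by simp)
      simp only [decide_eq_true_eq, not_and, not_not] at h1
      have := hS u (h1 (hV.path u v₀ (by omega)))
      omega
    · rename_i u hsome
      have hu := List.find?_some hsome
      simp only [decide_eq_true_eq] at hu
      have hne : pos x u ≠ pos x v₀ := fun h => by
        rw [pos_injective x h] at hu
        exact hV.irrefl _ hu.1
      by_cases hprec : precedes x u v₀ = true
      · have hlt := precedes_eq_true.1 hprec
        have hv₀ : v₀ ∉ S := fun h => lt_irrefl _ (hS v₀ h)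
        obtain ⟨h1, h2, h3⟩ := ih u (insert v₀ S)
          (fun w hw => by
            rcases Finset.mem_insert.1 hw with rfl | hw
            · exact hlt
            · exact hlt.trans (hS w hw))
          (by rw [Finset.card_insert_of_notMem hv₀]; omega)
        simp only [Comp.output_bind, Comp.asked_bind, Comp.output_ask, Comp.asked_ask, hprec,
          if_true]
        refine ⟨h1, (Finset.card_union_le _ _).trans (by simp; omega), ?_⟩
        intro e he
        rcases Finset.mem_union.1 he with he | he
        · exact ⟨u, v₀, Finset.mem_singleton.1 he, hu.1⟩
        · exact h3 e he
      · have hlt : pos x v₀ < pos x u := by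
          rw [precedes_eq_true] at hprec
          omega
        obtain ⟨h1, h2, h3⟩ := ih v₀ (insert u S)
          (fun w hw => by
            rcases Finset.mem_insert.1 hw with rfl | hw
            · exact hlt
            · exact hS w hw)
          (by rw [Finset.card_insert_of_notMem hu.2]; omega)
        simp only [Comp.output_bind, Comp.asked_bind, Comp.output_ask, Comp.asked_ask, hprec]
        refine ⟨h1, (Finset.card_union_le _ _).trans (by simp at h2 ⊢; omega), ?_⟩
        intro e he
        rcases Finset.mem_union.1 he with he | he
        · exact ⟨u, v₀, Finset.mem_singleton.1 he, hu.1⟩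
        · exact h3 e he

/-- The time of the last rebuild of level `k`, after `ℓ` discoveries. -/
def lastRebuild (sched : ℕ → ℕ) (k : ℕ) : ℕ → ℕ
  | 0 => 0
  | ℓ + 1 => if k ≤ sched (ℓ + 1) then ℓ + 1 else lastRebuild sched k ℓ

theorem lastRebuild_le (sched : ℕ → ℕ) (k ℓ : ℕ) : lastRebuild sched k ℓ ≤ ℓ := by
  induction ℓ with
  | zero => exact le_rfl
  | succ ℓ ih => rw [lastRebuild]; split_ifs <;> omega

/-- The incremental update after the `ℓ`-th discovery precedes the rebuilds of that step. All
comparisons of the step are therefore described with the rebuild times of step `ℓ - 1`, which is the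
weaker condition. -/
theorem lastRebuild_pred_le (sched : ℕ → ℕ) (k ℓ : ℕ) :
    lastRebuild sched k (ℓ - 1) ≤ lastRebuild sched k ℓ := by
  cases ℓ with
  | zero => exact le_rfl
  | succ ℓ =>
    have := lastRebuild_le sched k ℓ
    rw [lastRebuild, Nat.add_sub_cancel]
    split_ifs <;> omega

/-- The pairs that may be compared when `ℓ` vertices have been discovered. -/
def ComparedAt (x : Equiv.Perm (Fin n)) (adj : Fin n → Fin n → Bool)
    (E : ℕ → Fin n → Fin n → Bool) (q c : ℕ) (sched : ℕ → ℕ) (ℓ : ℕ) (e : Sym2 (Fin n)) : Prop :=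
  (∃ i, 1 ≤ i ∧ i ≤ q ∧ (ℓ = 0 ∨ i ≤ sched ℓ) ∧
    RebuildPair x E q c (fun k => lastRebuild sched k (ℓ - 1)) ℓ i e) ∨
  (∃ i, 1 ≤ i ∧ i ≤ q ∧ AdvancePair x E q c (fun k => lastRebuild sched k (ℓ - 1)) ℓ i e) ∨
  ∃ r, 1 ≤ r ∧ r ≤ q + 1 ∧ SearchPair x adj E q c (fun k => lastRebuild sched k (ℓ - 1)) ℓ r e

theorem RebuildPair.mono {R' : ℕ → ℕ} {i : ℕ} {e : Sym2 (Fin n)}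
    (h : RebuildPair x E q c R ℓ i e) (hR : ∀ k, R' k ≤ R k) : RebuildPair x E q c R' ℓ i e := by
  obtain ⟨u, v, h1, h2, h3, h4, h5, h6⟩ := h
  exact ⟨u, v, h1, h2, h3, h4, h5.mono hR le_rfl, h6.mono hR le_rfl⟩

theorem SearchPair.mono {R' : ℕ → ℕ} {r : ℕ} {e : Sym2 (Fin n)}
    (h : SearchPair x adj E q c R ℓ r e) (hR : ∀ k, R' k ≤ R k) :
    SearchPair x adj E q c R' ℓ r e := by
  obtain ⟨y, h1, h2, h3, h4, u, z, h5, h6, h7, h8, h9, h10⟩ := h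
  exact ⟨y, h1, h2, h3.mono hR le_rfl, h4, u, z, h5, h6, h7, h8, h9, h10.mono hR le_rfl⟩

theorem discover_spec (hV : ValidInput x adj E) (hc : 1 ≤ c) {sched : ℕ → ℕ}
    (hsched : ∀ ℓ, sched ℓ ≤ q) (k ℓ : ℕ) (hkn : ℓ + k < n) (y : Fin n) (S : State n)
    (hy : pos x y = ℓ) (hS : Inv x E q c (fun k => lastRebuild sched k ℓ) 1 ℓ S) :
    ((discover adj E q c sched k (ℓ + 1) y S).output (precedes x)).map (pos x) =
        List.range' ℓ (k + 1) ∧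
      ∀ e ∈ (discover adj E q c sched k (ℓ + 1) y S).asked (precedes x),
        ∃ ℓ', ℓ' ≤ n ∧ ComparedAt x adj E q c sched ℓ' e := by
  induction k generalizing ℓ y S with
  | zero =>
    obtain ⟨h1, h2⟩ := increment_spec hc (fun k _ _ => lastRebuild_le sched k ℓ) hy hS
    obtain ⟨h3, h4⟩ := createLevels_spec hc (hsched (ℓ + 1))
      (fun k _ _ => lastRebuild_le sched k (ℓ + 1))
      (h1.weaken (R' := fun k => lastRebuild sched k (ℓ + 1)) (b := sched (ℓ + 1) + 1) (by omega)
        (fun k hk => by rw [lastRebuild, if_neg (by omega)]))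
    rw [discover]
    simp only [Comp.output_bind, Comp.asked_bind, Comp.output_pure, Comp.asked_pure,
      Finset.mem_union, Finset.notMem_empty, or_false, List.map_cons, List.map_nil, hy]
    refine ⟨rfl, fun e he => ⟨ℓ + 1, by omega, ?_⟩⟩
    rcases he with he | he
    · exact Or.inr (Or.inl (h2 e he))
    · obtain ⟨i, hi1, hi2, hi3⟩ := h4 e he
      exact Or.inl ⟨i, hi1, hi2.trans (hsched _), Or.inr hi2,
        hi3.mono fun k => lastRebuild_pred_le sched k (ℓ + 1)⟩
  | succ k ih =>
    obtain ⟨h1, h2⟩ := increment_spec hc (fun k _ _ => lastRebuild_le sched k ℓ) hy hS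
    obtain ⟨h3, h4⟩ := createLevels_spec hc (hsched (ℓ + 1))
      (fun k _ _ => lastRebuild_le sched k (ℓ + 1))
      (h1.weaken (R' := fun k => lastRebuild sched k (ℓ + 1)) (b := sched (ℓ + 1) + 1) (by omega)
        (fun k hk => by rw [lastRebuild, if_neg (by omega)]))
    obtain ⟨y₀, hy₀⟩ := exists_pos_eq x (k := ℓ + 1) (by omega)
    obtain ⟨h5, h6⟩ := findNext_spec hV h3 (z := y) (by omega) hy₀
    obtain ⟨h7, h8⟩ := ih (ℓ + 1) (by omega) y₀ _ hy₀ h3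
    rw [discover]
    simp only [Comp.output_bind, Comp.asked_bind, Comp.output_pure, Comp.asked_pure,
      Finset.mem_union, Finset.notMem_empty, or_false, List.map_cons, h5, h7, hy]
    refine ⟨rfl, fun e he => ?_⟩
    rcases he with he | he | he | he
    · exact ⟨ℓ + 1, by omega, Or.inr (Or.inl (h2 e he))⟩
    · obtain ⟨i, hi1, hi2, hi3⟩ := h4 e he
      exact ⟨ℓ + 1, by omega, Or.inl ⟨i, hi1, hi2.trans (hsched _), Or.inr hi2,
        hi3.mono fun k => lastRebuild_pred_le sched k (ℓ + 1)⟩⟩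
    · obtain ⟨r, hr1, hr2, hr3⟩ := h6 e he
      exact ⟨ℓ + 1, by omega, Or.inr (Or.inr ⟨r, hr1, hr2,
        hr3.mono fun k => lastRebuild_pred_le sched k (ℓ + 1)⟩)⟩
    · exact h8 e he

/-- This removes the algorithm from the cost analysis: outside the small set `F`, from the search
for the first vertex, membership in the compared set implies a property of the edge sets. The first
build of the levels is time 0. -/
theorem sortPrefix_spec (hV : ValidInput x adj E) (hc : 1 ≤ c) {sched : ℕ → ℕ}
    (hsched : ∀ ℓ, sched ℓ ≤ q) {m : ℕ} (hm : m ≤ n) :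
    ((sortPrefix adj E q c sched m).output (precedes x)).map (pos x) = List.range' 0 m ∧
      ∃ F : Finset (Sym2 (Fin n)), F.card ≤ n ∧
        (∀ e ∈ F, ∃ u v, e = s(u, v) ∧ adj u v = true) ∧
        ∀ e ∈ (sortPrefix adj E q c sched m).asked (precedes x),
          e ∈ F ∨ ∃ ℓ, ℓ ≤ n ∧ ComparedAt x adj E q c sched ℓ e := by
  match m, hm with
  | 0, _ => exact ⟨by simp [sortPrefix], ∅, by simp, by simp, by simp [sortPrefix]⟩
  | k + 1, hm =>
    obtain ⟨m, rfl⟩ : ∃ m, n = m + 1 := ⟨n - 1, by omega⟩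
    have hhead : (List.finRange (m + 1)).head? = some 0 := by simp [List.finRange_succ]
    obtain ⟨h1, h2⟩ := createLevels_spec (x := x) (E := E) (ℓ := 0) hc le_rfl
      (fun k _ _ => lastRebuild_le sched k 0) initial_inv
    obtain ⟨h3, h4, h5⟩ := findFirst_spec hV (m + 1) 0 ∅ (by simp) (by simp)
    obtain ⟨h6, h7⟩ := discover_spec hV hc hsched k 0 (by omega) _ _ h3 h1
    unfold sortPrefix
    rw [hhead]
    simp only [Comp.output_bind, Comp.asked_bind, Finset.mem_union]
    refine ⟨h6, _, h4, h5, fun e he => ?_⟩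
    rcases he with he | he | he
    · obtain ⟨i, hi1, hi2, hi3⟩ := h2 e he
      exact Or.inr ⟨0, by omega, Or.inl ⟨i, hi1, hi2, Or.inl rfl, hi3⟩⟩
    · exact Or.inl he
    · exact Or.inr (h7 e he)

theorem ComparedAt.exists_adj {sched : ℕ → ℕ} {e : Sym2 (Fin n)} (hV : ValidInput x adj E)
    (h : ComparedAt x adj E q c sched ℓ e) : ∃ u v, e = s(u, v) ∧ adj u v = true := by
  rcases h with ⟨i, -, -, -, u, v, h1, h2, -⟩ | ⟨i, -, -, v, ⟨u, h1, h2, -⟩, -⟩ |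
    ⟨r, -, -, y, -, -, -, -, u, z, h1, -, -, h2, -⟩
  · exact ⟨u, v, h1, hV.sub _ _ _ h2⟩
  · exact ⟨u, v, h1, hV.sub _ _ _ h2⟩
  · exact ⟨u, z, h1, h2⟩

/-- The order `x` read backwards. -/
def reverseOrder (x : Equiv.Perm (Fin n)) : Equiv.Perm (Fin n) := Fin.revPerm.trans x

theorem pos_reverseOrder (x : Equiv.Perm (Fin n)) (v : Fin n) :
    pos (reverseOrder x) v = n - 1 - pos x v := by
  simp [pos, reverseOrder, Fin.val_rev]
  omega

theorem precedes_reverseOrder (x : Equiv.Perm (Fin n)) :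
    (fun u v => precedes x v u) = precedes (reverseOrder x) := by
  funext u v
  have := pos_lt x u
  have := pos_lt x v
  rw [Bool.eq_iff_iff, precedes_eq_true, precedes_eq_true, pos_reverseOrder, pos_reverseOrder]
  omega

theorem ValidInput.reverse (h : ValidInput x adj E) : ValidInput (reverseOrder x) adj E where
  symm := h.symm
  irrefl := h.irrefl
  sub := h.sub
  path := fun u v huv => by
    have := pos_lt x u
    have := pos_lt x v
    rw [pos_reverseOrder, pos_reverseOrder] at huv
    exact h.symm _ _ (h.path v u (by omega))

theorem asked_sortAll (sched : ℕ → ℕ) :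
    (sortAll adj E q c sched).asked (precedes x) =
      (sortPrefix adj E q c sched ((n + 1) / 2)).asked (precedes x) ∪
      (sortPrefix adj E q c sched (n / 2)).asked (precedes (reverseOrder x)) := by
  simp [sortAll, Comp.asked_reversed, precedes_reverseOrder]

theorem output_sortAll (hV : ValidInput x adj E) (hc : 1 ≤ c) {sched : ℕ → ℕ}
    (hsched : ∀ ℓ, sched ℓ ≤ q) :
    (sortAll adj E q c sched).output (precedes x) = List.ofFn x := by
  have h1 := (sortPrefix_spec hV hc hsched (m := (n + 1) / 2) (by omega)).1
  have h2 := (sortPrefix_spec hV.reverse hc hsched (m := n / 2) (by omega)).1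
  simp only [sortAll, Comp.output_bind, Comp.output_pure, Comp.output_reversed,
    precedes_reverseOrder]
  generalize (sortPrefix adj E q c sched ((n + 1) / 2)).output (precedes x) = front at h1
  generalize (sortPrefix adj E q c sched (n / 2)).output (precedes (reverseOrder x)) = back at h2
  have h3 : back.map (pos x) = (List.range' 0 (n / 2)).map fun k => n - 1 - k := by
    rw [← h2, List.map_map]
    refine List.map_congr_left fun v _ => ?_
    have := pos_lt x v
    simp only [Function.comp, pos_reverseOrder]
    omega
  refine List.map_injective_iff.2 (pos_injective x) ?_
  rw [List.map_append, List.map_reverse, h1, h3]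
  refine List.ext_getElem ?_ ?_
  · simp
    omega
  · intro i hi1 hi2
    simp only [List.length_append, List.length_range', List.length_reverse, List.length_map] at hi1
    simp only [List.map_ofFn, List.getElem_ofFn, Function.comp, pos, Equiv.symm_apply_apply]
    rw [List.getElem_append]
    split_ifs with h
    · simp
    · simp only [List.length_range'] at h ⊢
      simp
      omega

end StochSort

/-! ### Schedule and number of levels; correctness -/

namespace StochSort

variable {n : ℕ}

theorem hamPath_adj {x : Equiv.Perm (Fin n)} {u v : Fin n} :
    (hamPath x).Adj u v ↔ pos x u + 1 = pos x v ∨ pos x v + 1 = pos x u := by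
  simp only [hamPath, SimpleGraph.map_adj, SimpleGraph.pathGraph_adj, pos]
  constructor
  · rintro ⟨a, b, h, rfl, rfl⟩
    simpa using h
  · intro h
    exact ⟨x.symm u, x.symm v, h, by simp, by simp⟩

theorem hamPath_reverseOrder (x : Equiv.Perm (Fin n)) : hamPath (reverseOrder x) = hamPath x := by
  ext u v
  have := pos_lt x u
  have := pos_lt x v
  rw [hamPath_adj, hamPath_adj, pos_reverseOrder, pos_reverseOrder]
  omega

open Classical in
theorem validInput {q : ℕ} {x : Equiv.Perm (Fin n)} {G : SimpleGraph (Fin n)}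
    (T : Sym2 (Fin n) → Fin q → Bool) (hG : hamPath x ≤ G) :
    ValidInput x (fun u v => decide (G.Adj u v)) (edgeSets G T) where
  symm := fun u v h => by simpa using (of_decide_eq_true h).symm
  irrefl := fun v => by simp
  path := fun u v h => decide_eq_true (hG (hamPath_adj.2 (Or.inl h)))
  sub := fun k u v h => by
    simp only [edgeSets, decide_eq_true_eq] at h ⊢
    exact h.1

theorem schedule_le (q : ℕ) (p : unitInterval) (ℓ : ℕ) : schedule q p ℓ ≤ q := by
  classical
  refine Finset.sup_le fun i hi => ?_
  simp only [Finset.mem_filter, Finset.mem_Icc] at hi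
  exact hi.1.2

/-- The target sizes double from level to level, so a multiple for level `j` is one for each lower
level `i`, with `2 ^ (j - i)` times the coefficient. The two rounded numbers are the same real
number. -/
theorem le_schedule_iff {q : ℕ} {p : unitInterval} {ℓ i : ℕ} (hi : 1 ≤ i) (hiq : i ≤ q) :
    i ≤ schedule q p ℓ ↔ ∃ k : ℕ, ⌊(k : ℝ) * (targetSize p i / 32)⌋₊ = ℓ := by
  classical
  constructor
  · intro h
    have hne : ((Finset.Icc 1 q).filter
        fun i => ∃ k : ℕ, ⌊(k : ℝ) * (targetSize p i / 32)⌋₊ = ℓ).Nonempty := by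
      by_contra hcon
      rw [Finset.not_nonempty_iff_eq_empty] at hcon
      rw [schedule, hcon] at h
      simp at h
      omega
    obtain ⟨j, hj, hj'⟩ := Finset.exists_mem_eq_sup _ hne id
    simp only [Finset.mem_filter, Finset.mem_Icc] at hj
    obtain ⟨-, k, hk⟩ := hj
    have hij : i ≤ j := h.trans_eq hj'
    refine ⟨k * 2 ^ (j - i), ?_⟩
    rw [← hk]
    congr 1
    have : (2 : ℝ) ^ j = 2 ^ (j - i) * 2 ^ i := by rw [← pow_add]; congr 1; omega
    rw [targetSize, targetSize, this]
    push_cast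
    ring
  · intro h
    exact Finset.le_sup (f := id)
      (Finset.mem_filter.2 ⟨Finset.mem_Icc.2 ⟨hi, hiq⟩, h⟩)

theorem le_lastRebuild {sched : ℕ → ℕ} {k τ ℓ : ℕ} (hτ : k ≤ sched τ) (hle : τ ≤ ℓ) :
    τ ≤ lastRebuild sched k ℓ := by
  induction ℓ with
  | zero => omega
  | succ ℓ ih =>
    rw [lastRebuild]
    split_ifs with h
    · exact hle
    · refine ih (Nat.le_of_lt_succ (lt_of_le_of_ne hle ?_))
      rintro rfl
      exact h hτ

/-- Of the additive 2, one unit pays for rounding the multiples down and one for the step from `ℓ`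
to `ℓ - 1`. -/
theorem sub_lastRebuild_le {q : ℕ} {p : unitInterval} (hp : 0 < p) {k : ℕ} (hk : 1 ≤ k)
    (hkq : k ≤ q) (ℓ : ℕ) :
    (ℓ : ℝ) - lastRebuild (schedule q p) k (ℓ - 1) ≤ targetSize p k / 32 + 2 := by
  have hp' : (0 : ℝ) < p := hp
  have hs : 0 < targetSize p k / 32 := by unfold targetSize; positivity
  have key : ∀ ℓ : ℕ, (ℓ : ℝ) - lastRebuild (schedule q p) k ℓ ≤ targetSize p k / 32 + 1 := by
    intro ℓ
    set s := targetSize p k / 32 with hsdef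
    set m := ⌊(ℓ : ℝ) / s⌋₊
    have h1 : (m : ℝ) * s ≤ ℓ := by
      rw [← le_div_iff₀ hs]
      exact Nat.floor_le (by positivity)
    have h2 : (ℓ : ℝ) < (m + 1) * s := by
      rw [← div_lt_iff₀ hs]
      exact Nat.lt_floor_add_one _
    have h3 : ⌊(m : ℝ) * s⌋₊ ≤ lastRebuild (schedule q p) k ℓ :=
      le_lastRebuild ((le_schedule_iff hk hkq).2 ⟨m, rfl⟩)
        (Nat.floor_le_of_le h1)
    have h4 : (⌊(m : ℝ) * s⌋₊ : ℝ) ≤ lastRebuild (schedule q p) k ℓ := by exact_mod_cast h3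
    have h5 := Nat.lt_floor_add_one ((m : ℝ) * s)
    linarith
  cases ℓ with
  | zero => simp [lastRebuild]; linarith
  | succ ℓ =>
    have := key ℓ
    push_cast
    linarith

/-- Level `i` is rebuilt about once in every `targetSize p i / 32` rounds. -/
theorem card_rebuild_le {q : ℕ} {p : unitInterval} (hp : 0 < p) {i : ℕ} (hi : 1 ≤ i)
    (hiq : i ≤ q) (n : ℕ) :
    (((Finset.Icc 1 n).filter fun ℓ => i ≤ schedule q p ℓ).card : ℝ) ≤
      32 * (n + 1) / targetSize p i := by
  have hp' : (0 : ℝ) < p := hp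
  have hs : 0 < targetSize p i := by unfold targetSize; positivity
  have hk : ∀ ℓ : ℕ, ∃ k : ℕ, i ≤ schedule q p ℓ → ⌊(k : ℝ) * (targetSize p i / 32)⌋₊ = ℓ := by
    intro ℓ
    by_cases h : i ≤ schedule q p ℓ
    · obtain ⟨k, hk⟩ := (le_schedule_iff hi hiq).1 h
      exact ⟨k, fun _ => hk⟩
    · exact ⟨0, fun h' => absurd h' h⟩
  choose f hf using hk
  have h1 : ((Finset.Icc 1 n).filter fun ℓ => i ≤ schedule q p ℓ).card ≤
      (Finset.Icc 1 ⌊32 * ((n : ℝ) + 1) / targetSize p i⌋₊).card := by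
    refine Finset.card_le_card_of_injOn f ?_ ?_
    · intro ℓ hℓ
      simp only [Finset.coe_filter, Finset.mem_Icc, Set.mem_ofPred_eq] at hℓ
      obtain ⟨⟨h1, h2⟩, h3⟩ := hℓ
      have h4 := hf ℓ h3
      simp only [Finset.coe_Icc, Set.mem_Icc]
      constructor
      · by_contra h0
        rw [show f ℓ = 0 by omega] at h4
        simp at h4
        omega
      · refine Nat.le_floor ?_
        rw [le_div_iff₀ hs]
        have h5 := Nat.lt_floor_add_one ((f ℓ : ℝ) * (targetSize p i / 32))
        rw [h4] at h5
        have h6 : (ℓ : ℝ) ≤ n := by exact_mod_cast h2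
        linarith
    · intro a ha b hb hab
      simp only [Finset.coe_filter, Set.mem_ofPred_eq] at ha hb
      rw [← hf a ha.2, ← hf b hb.2, hab]
  rw [Nat.card_Icc, Nat.add_sub_cancel] at h1
  calc _ ≤ ((⌊32 * ((n : ℝ) + 1) / targetSize p i⌋₊ : ℕ) : ℝ) := by exact_mod_cast h1
    _ ≤ _ := Nat.floor_le (by positivity)

theorem one_le_numSets (n : ℕ) (p : unitInterval) : 1 ≤ numSets n p := le_max_left _ _

theorem le_targetSize_numSets {p : unitInterval} (hp : 0 < p) (n : ℕ) :
    (n : ℝ) ≤ targetSize p (numSets n p) := by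
  have hp' : (0 : ℝ) < p := hp
  rw [targetSize, le_div_iff₀ hp']
  rcases Nat.eq_zero_or_pos n with rfl | hn
  · simp
  have hn' : (0 : ℝ) < n := by exact_mod_cast hn
  calc (n : ℝ) * p = 2 ^ Real.logb 2 ((p : ℝ) * n) := by
        rw [Real.rpow_logb (by norm_num) (by norm_num) (by positivity), mul_comm]
    _ ≤ 2 ^ (numSets n p : ℝ) := by
        refine Real.rpow_le_rpow_of_exponent_le (by norm_num) ?_
        refine (Nat.le_ceil _).trans ?_
        exact_mod_cast le_max_right _ _
    _ = 2 ^ numSets n p := Real.rpow_natCast _ _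

theorem numSets_add_one_le {p : unitInterval} (n : ℕ) :
    (numSets n p : ℝ) + 1 ≤ 4 * max 1 (Real.log (p * n)) := by
  have h1 : (1 : ℝ) ≤ max 1 (Real.log (p * n)) := le_max_left _ _
  have h2 : Real.log (p * n) ≤ max 1 (Real.log (p * n)) := le_max_right _ _
  set M := max 1 (Real.log (p * n))
  have hlog2 : (0.5 : ℝ) ≤ Real.log 2 := by
    have := Real.log_two_gt_d9
    linarith
  have h3 : Real.logb 2 ((p : ℝ) * n) ≤ 2 * M := by
    rw [Real.logb, div_le_iff₀ (by linarith)]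
    nlinarith
  rw [numSets]
  rcases le_total ⌈Real.logb 2 ((p : ℝ) * n)⌉₊ 1 with h | h
  · rw [max_eq_left h]
    push_cast
    linarith
  · rw [max_eq_right h]
    have h4 : (⌈Real.logb 2 ((p : ℝ) * n)⌉₊ : ℝ) < Real.logb 2 ((p : ℝ) * n) + 1 := by
      refine Nat.ceil_lt_add_one ?_
      by_contra hcon
      rw [Nat.ceil_eq_zero.2 (by linarith)] at h
      omega
    linarith

theorem stochasticSort_correct {c : ℕ} (hc : 1 ≤ c) {p : unitInterval} {x : Equiv.Perm (Fin n)}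
    {G : SimpleGraph (Fin n)} (T : Sym2 (Fin n) → Fin (numSets n p) → Bool) (hG : hamPath x ≤ G) :
    (stochasticSort c p G T).output (precedes x) = List.ofFn x ∧
      ∀ e ∈ (stochasticSort c p G T).asked (precedes x), e ∈ G.edgeSet := by
  classical
  have hV := validInput T hG
  refine ⟨output_sortAll hV hc (schedule_le _ p), fun e he => ?_⟩
  rw [stochasticSort, asked_sortAll, Finset.mem_union] at he
  have key : ∀ y : Equiv.Perm (Fin n), ValidInput y (fun u v => decide (G.Adj u v))
      (edgeSets G T) → ∀ m ≤ n, ∀ e ∈ (sortPrefix (fun u v => decide (G.Adj u v)) (edgeSets G T)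
        (numSets n p) c (schedule (numSets n p) p) m).asked (precedes y), e ∈ G.edgeSet := by
    intro y hy m hm e he
    obtain ⟨-, F, -, hF, h⟩ := sortPrefix_spec hy hc (schedule_le _ p) hm
    obtain ⟨u, v, rfl, huv⟩ : ∃ u v, e = s(u, v) ∧ decide (G.Adj u v) = true := by
      rcases h e he with he | ⟨ℓ, -, he⟩
      · exact hF e he
      · exact he.exists_adj hy
    simpa using huv
  rcases he with he | he
  · exact key x hV _ (by omega) e he
  · exact key _ hV.reverse _ (by omega) e he

end StochSort

/-! ### Independence over vertex pairs -/

open MeasureTheory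

/-- The event `A` is determined by the variables `Z e` with `e ∈ S`. -/
def DeterminedBy {Ω ι β : Type*} (Z : ι → Ω → β) (S : Set ι) (A : Ω → Prop) : Prop :=
  ∀ ω ω', (∀ e ∈ S, Z e ω = Z e ω') → (A ω ↔ A ω')

namespace DeterminedBy

variable {Ω ι β : Type*} {Z : ι → Ω → β} {S T : Set ι} {A B : Ω → Prop}

theorem mono (h : DeterminedBy Z S A) (hST : S ⊆ T) : DeterminedBy Z T A :=
  fun ω ω' hω => h ω ω' fun e he => hω e (hST he)

theorem and (hA : DeterminedBy Z S A) (hB : DeterminedBy Z S B) :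
    DeterminedBy Z S fun ω => A ω ∧ B ω :=
  fun ω ω' h => and_congr (hA ω ω' h) (hB ω ω' h)

theorem imp (hA : DeterminedBy Z S A) (hB : DeterminedBy Z S B) :
    DeterminedBy Z S fun ω => A ω → B ω :=
  fun ω ω' h => imp_congr (hA ω ω' h) (hB ω ω' h)

theorem not (hA : DeterminedBy Z S A) : DeterminedBy Z S fun ω => ¬ A ω :=
  fun ω ω' h => not_congr (hA ω ω' h)

theorem all {τ : Sort*} {A : τ → Ω → Prop} (hA : ∀ t, DeterminedBy Z S (A t)) :
    DeterminedBy Z S fun ω => ∀ t, A t ω :=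
  fun ω ω' h => forall_congr' fun t => hA t ω ω' h

theorem ex {τ : Sort*} {A : τ → Ω → Prop} (hA : ∀ t, DeterminedBy Z S (A t)) :
    DeterminedBy Z S fun ω => ∃ t, A t ω :=
  fun ω₁ ω₂ h => exists_congr fun t => hA t ω₁ ω₂ h

/-- To show that `a ∧ B` is determined by `Z` on `S`, where `a` is not random, one may assume
`a`. -/
theorem const_and {a : Prop} (hB : a → DeterminedBy Z S B) :
    DeterminedBy Z S fun ω => a ∧ B ω :=
  fun ω ω' h => and_congr_right fun ha => hB ha ω ω' h

theorem const_imp {a : Prop} (hB : a → DeterminedBy Z S B) :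
    DeterminedBy Z S fun ω => a → B ω :=
  fun ω ω' h => imp_congr_right fun ha => hB ha ω ω' h

end DeterminedBy

namespace StochSort

/-- A random graph that contains the path `x 0, x 1, …, x (n - 1)`, with random edge sets
`E 1, …, E q`. Different vertex pairs are independent: what happens at the pair `e` is determined
by the variable `Z e`. -/
structure PathModel {n : ℕ} {Ω β : Type*} [MeasurableSpace Ω] (μ : Measure Ω)
    (Z : Sym2 (Fin n) → Ω → β) (x : Equiv.Perm (Fin n)) (adj : Ω → Fin n → Fin n → Bool)
    (E : Ω → ℕ → Fin n → Fin n → Bool) (q : ℕ) (p : ℝ) : Prop where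
  p_pos : 0 < p
  p_le_one : p ≤ 1
  n_le : (n : ℝ) ≤ 2 ^ q / p
  valid : ∀ ω, ValidInput x (adj ω) (E ω)
  E_symm : ∀ ω k u v, E ω k u v = E ω k v u
  indep : ∀ S T A B, Disjoint S T → DeterminedBy Z S A → DeterminedBy Z T B →
    μ.real {ω | A ω ∧ B ω} = μ.real {ω | A ω} * μ.real {ω | B ω}
  adj_det : ∀ u v, DeterminedBy Z {s(u, v)} fun ω => adj ω u v = true
  E_det : ∀ k u v, DeterminedBy Z {s(u, v)} fun ω => E ω k u v = true
  adj_eq : ∀ u v, u ≠ v → ¬ (hamPath x).Adj u v → μ.real {ω | adj ω u v = true} = p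
  E_le : ∀ k u v, 1 ≤ k → k ≤ q → u ≠ v → ¬ (hamPath x).Adj u v →
    μ.real {ω | E ω k u v = true} ≤ 2 * p / 2 ^ k
  E_le' : ∀ k u v, 1 ≤ k → k ≤ q → u ≠ v → μ.real {ω | E ω k u v = true} ≤ 2 / 2 ^ k
  le_E : ∀ k u v, 1 ≤ k → k ≤ q → u ≠ v → p / 2 ^ k ≤ μ.real {ω | E ω k u v = true}

theorem card_pos_mem_Ico_le {n : ℕ} (x : Equiv.Perm (Fin n)) (a b : ℕ) :
    (Finset.univ.filter fun v => a ≤ pos x v ∧ pos x v < b).card ≤ b - a := by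
  rw [← Nat.card_Ico]
  refine Finset.card_le_card_of_injOn (pos x) ?_ ((pos_injective x).injOn)
  intro v hv
  simpa using hv

theorem sum_pos_le {n : ℕ} (x : Equiv.Perm (Fin n)) (ℓ : ℕ) (f : ℕ → ℝ) (hf : ∀ j, 0 ≤ f j) :
    ∑ v ∈ Finset.univ.filter (fun v => ℓ ≤ pos x v), f (pos x v - ℓ) ≤
      ∑ j ∈ Finset.range n, f j := by
  have hinj : Set.InjOn (fun v => pos x v - ℓ)
      (Finset.univ.filter fun v => ℓ ≤ pos x v : Finset (Fin n)) := by
    intro u hu v hv huv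
    simp only [Finset.coe_filter, Finset.mem_univ, true_and, Set.mem_ofPred_eq] at hu hv huv
    exact pos_injective x (by omega)
  rw [← Finset.sum_image (f := f) hinj]
  refine Finset.sum_le_sum_of_subset_of_nonneg ?_ fun j _ _ => hf j
  intro j hj
  simp only [Finset.mem_image, Finset.mem_filter, Finset.mem_univ, true_and] at hj
  obtain ⟨v, -, rfl⟩ := hj
  have := pos_lt x v
  simp
  omega

namespace PathModel

variable {n : ℕ} {Ω β : Type*} [MeasurableSpace Ω] {μ : Measure Ω} {Z : Sym2 (Fin n) → Ω → β}
  {x : Equiv.Perm (Fin n)}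
  {adj : Ω → Fin n → Fin n → Bool} {E : Ω → ℕ → Fin n → Fin n → Bool} {q : ℕ} {p : ℝ}

/-- Independence is applied once per index. Carrying the event `F` along replaces conditioning on
it, so no division by its probability occurs. -/
theorem prob_and_forall_le (M : PathModel μ Z x adj E q p) {τ : Type*} [DecidableEq τ]
    (T : Finset τ) {F : Ω → Prop} {A : τ → Ω → Prop} {S₀ : Set (Sym2 (Fin n))}
    {S : τ → Set (Sym2 (Fin n))} {r : τ → ℝ} (hF : DeterminedBy Z S₀ F)
    (hA : ∀ t ∈ T, DeterminedBy Z (S t) (A t)) (hd : ∀ t ∈ T, Disjoint S₀ (S t))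
    (hdd : ∀ t ∈ T, ∀ t' ∈ T, t ≠ t' → Disjoint (S t) (S t'))
    (hr : ∀ t ∈ T, μ.real {ω | A t ω} ≤ r t) :
    μ.real {ω | F ω ∧ ∀ t ∈ T, A t ω} ≤ μ.real {ω | F ω} * ∏ t ∈ T, r t := by
  induction T using Finset.induction_on with
  | empty => simp
  | insert t T ht ih =>
    have h1 : {ω | F ω ∧ ∀ t' ∈ insert t T, A t' ω} =
        {ω | (F ω ∧ ∀ t' ∈ T, A t' ω) ∧ A t ω} := by
      ext ω
      simp only [Finset.forall_mem_insert, Set.mem_ofPred_eq]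
      tauto
    have h2 : DeterminedBy Z (S₀ ∪ ⋃ t' ∈ T, S t') fun ω => F ω ∧ ∀ t' ∈ T, A t' ω := by
      refine (hF.mono Set.subset_union_left).and ?_
      refine DeterminedBy.all fun t' => DeterminedBy.const_imp fun ht' => ?_
      refine (hA t' (Finset.mem_insert_of_mem ht')).mono ?_
      exact (Set.subset_biUnion_of_mem (u := S) ht').trans Set.subset_union_right
    have h3 : Disjoint (S₀ ∪ ⋃ t' ∈ T, S t') (S t) := by
      rw [Set.disjoint_union_left, Set.disjoint_iUnion₂_left]
      refine ⟨hd t (Finset.mem_insert_self _ _), fun t' ht' => ?_⟩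
      exact hdd t' (Finset.mem_insert_of_mem ht') t (Finset.mem_insert_self _ _)
        (fun h => ht (h ▸ ht'))
    rw [h1, M.indep _ _ _ _ h3 h2 (hA t (Finset.mem_insert_self _ _)),
      Finset.prod_insert ht, mul_left_comm, mul_comm]
    have h4 := ih (fun t' ht' => hA t' (Finset.mem_insert_of_mem ht'))
      (fun t' ht' => hd t' (Finset.mem_insert_of_mem ht'))
      (fun a ha b hb => hdd a (Finset.mem_insert_of_mem ha) b (Finset.mem_insert_of_mem hb))
      (fun t' ht' => hr t' (Finset.mem_insert_of_mem ht'))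
    exact mul_le_mul (hr t (Finset.mem_insert_self _ _)) h4 measureReal_nonneg
      (measureReal_nonneg.trans (hr t (Finset.mem_insert_self _ _)))

/-- The pairs that consist of `t` and an earlier vertex. -/
def earlierPairs (x : Equiv.Perm (Fin n)) (t : Fin n) : Set (Sym2 (Fin n)) :=
  {e | ∃ s, pos x s < pos x t ∧ e = s(s, t)}

theorem det_exists_edge (M : PathModel μ Z x adj E q p) (k a : ℕ) (t : Fin n) :
    DeterminedBy Z (earlierPairs x t) fun ω =>
      ∃ k' s, k ≤ k' ∧ k' ≤ q ∧ a ≤ pos x s ∧ pos x s < pos x t ∧ E ω k' s t = true := by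
  refine DeterminedBy.ex fun k' => DeterminedBy.ex fun s => DeterminedBy.const_and fun _ =>
    DeterminedBy.const_and fun _ => DeterminedBy.const_and fun _ => DeterminedBy.const_and
      fun h => (M.E_det k' s t).mono ?_
  rintro e rfl
  exact ⟨s, h, rfl⟩

variable [IsProbabilityMeasure μ]

theorem sum_Icc_div_two_pow_le {a : ℝ} (ha : 0 ≤ a) (k m : ℕ) :
    ∑ k' ∈ Finset.Icc k m, a / 2 ^ k' ≤ 2 * a / 2 ^ k := by
  rcases Nat.lt_or_ge m k with hkm | hkm
  · rw [Finset.Icc_eq_empty (by omega), Finset.sum_empty]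
    positivity
  · suffices h : ∑ k' ∈ Finset.Icc k m, a / 2 ^ k' ≤ 2 * a / 2 ^ k - a / 2 ^ m by
      have : 0 ≤ a / 2 ^ m := by positivity
      linarith
    induction m, hkm using Nat.le_induction with
    | base =>
      rw [Finset.Icc_self, Finset.sum_singleton]
      apply le_of_eq
      ring
    | succ m hkm ih =>
      rw [← Finset.insert_Icc_right_eq_Icc_add_one (by omega), Finset.sum_insert (by simp)]
      have h4 : a / 2 ^ m = 2 * (a / 2 ^ (m + 1)) := by rw [pow_succ]; field_simp
      linarith

theorem prob_exists_ge_le {k : ℕ} {u v : Fin n} {a : ℝ} (ha0 : 0 ≤ a)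
    (ha : ∀ k', k ≤ k' → k' ≤ q → μ.real {ω | E ω k' u v = true} ≤ a / 2 ^ k') :
    μ.real {ω | ∃ k', k ≤ k' ∧ k' ≤ q ∧ E ω k' u v = true} ≤ 2 * a / 2 ^ k := by
  have h1 : {ω | ∃ k', k ≤ k' ∧ k' ≤ q ∧ E ω k' u v = true} ⊆
      ⋃ k' ∈ Finset.Icc k q, {ω | E ω k' u v = true} := by
    rintro ω ⟨k', h1, h2, h3⟩
    simp only [Set.mem_iUnion, Finset.mem_Icc]
    exact ⟨k', ⟨h1, h2⟩, h3⟩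
  refine (measureReal_mono h1 (measure_ne_top _ _)).trans
    ((measureReal_biUnion_finset_le _ _).trans ?_)
  refine (Finset.sum_le_sum fun k' hk' => ?_).trans (sum_Icc_div_two_pow_le ha0 k q)
  rw [Finset.mem_Icc] at hk'
  exact ha k' hk'.1 hk'.2

theorem prob_edge_ge_le (M : PathModel μ Z x adj E q p) {k : ℕ} (hk : 1 ≤ k) {u v : Fin n}
    (huv : u ≠ v) (hh : ¬ (hamPath x).Adj u v) :
    μ.real {ω | ∃ k', k ≤ k' ∧ k' ≤ q ∧ E ω k' u v = true} ≤ 4 * p / 2 ^ k := by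
  have hp := M.p_pos
  have := prob_exists_ge_le (μ := μ) (E := E) (q := q) (k := k) (u := u) (v := v) (a := 2 * p)
    (by positivity) fun k' h1 h2 => M.E_le k' u v (hk.trans h1) h2 huv hh
  exact this.trans_eq (by ring)

theorem prob_path_edge_ge_le (M : PathModel μ Z x adj E q p) {k : ℕ} (hk : 1 ≤ k) {u v : Fin n}
    (huv : u ≠ v) :
    μ.real {ω | ∃ k', k ≤ k' ∧ k' ≤ q ∧ E ω k' u v = true} ≤ 4 / 2 ^ k := by
  have := prob_exists_ge_le (μ := μ) (E := E) (q := q) (k := k) (u := u) (v := v) (a := 2)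
    (by positivity) fun k' h1 h2 => M.E_le' k' u v (hk.trans h1) h2 huv
  exact this.trans_eq (by ring)

/-- A union bound over `s`. The separate summand 4 belongs to the path predecessor of `t`, whose
edge is always present and therefore lacks the factor `p`. -/
theorem prob_exists_edge_le (M : PathModel μ Z x adj E q p) {k : ℕ} (hk : 1 ≤ k) (t : Fin n)
    {a : ℕ} (ha : a ≤ pos x t) :
    μ.real {ω | ∃ k' s, k ≤ k' ∧ k' ≤ q ∧ a ≤ pos x s ∧ pos x s < pos x t ∧ E ω k' s t = true} ≤
      (4 * p * ((pos x t : ℝ) - a) + 4) / 2 ^ k := by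
  have hp := M.p_pos
  set B := Finset.univ.filter fun s => a ≤ pos x s ∧ pos x s < pos x t with hB
  have h1 : {ω | ∃ k' s, k ≤ k' ∧ k' ≤ q ∧ a ≤ pos x s ∧ pos x s < pos x t ∧ E ω k' s t = true} ⊆
      ⋃ s ∈ B, {ω | ∃ k', k ≤ k' ∧ k' ≤ q ∧ E ω k' s t = true} := by
    rintro ω ⟨k', s, h1, h2, h3, h4, h5⟩
    simp only [hB, Set.mem_iUnion, Finset.mem_filter, Finset.mem_univ, true_and]
    exact ⟨s, ⟨h3, h4⟩, k', h1, h2, h5⟩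
  refine (measureReal_mono h1 (measure_ne_top _ _)).trans
    ((measureReal_biUnion_finset_le _ _).trans ?_)
  have h2 : ∀ s ∈ B, μ.real {ω | ∃ k', k ≤ k' ∧ k' ≤ q ∧ E ω k' s t = true} ≤
      4 * p / 2 ^ k + if pos x s = pos x t - 1 then 4 / 2 ^ k else 0 := by
    intro s hs
    simp only [hB, Finset.mem_filter, Finset.mem_univ, true_and] at hs
    have hst : s ≠ t := by rintro rfl; omega
    split_ifs with h
    · refine (M.prob_path_edge_ge_le hk hst).trans ?_
      have : 0 ≤ 4 * p / 2 ^ k := by positivity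
      linarith
    · rw [add_zero]
      refine M.prob_edge_ge_le hk hst ?_
      rw [hamPath_adj]
      omega
  refine (Finset.sum_le_sum h2).trans ?_
  rw [Finset.sum_add_distrib, Finset.sum_const, nsmul_eq_mul, ← Finset.sum_filter,
    Finset.sum_const, nsmul_eq_mul]
  have h3 : (B.card : ℝ) ≤ (pos x t : ℝ) - a := by
    rw [← Nat.cast_sub ha]
    exact_mod_cast card_pos_mem_Ico_le x a (pos x t)
  have h4 : ((B.filter fun s => pos x s = pos x t - 1).card : ℝ) ≤ 1 := by
    have : (B.filter fun s => pos x s = pos x t - 1).card ≤ 1 := by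
      rw [Finset.card_le_one]
      intro u hu v hv
      rw [Finset.mem_filter] at hu hv
      exact pos_injective x (hu.2.trans hv.2.symm)
    exact_mod_cast this
  calc _ ≤ ((pos x t : ℝ) - a) * (4 * p / 2 ^ k) + 1 * (4 / 2 ^ k) := by gcongr
    _ = _ := by ring

/-- The pairs that decide whether `t` blocks `v`. -/
def blockingPairs (x : Equiv.Perm (Fin n)) (v t : Fin n) : Set (Sym2 (Fin n)) :=
  insert s(t, v) (earlierPairs x t)

/-- Such a pair determines `t`: either its later endpoint is `v` and `t` is the other one, or its
later endpoint is `t`, which differs from `v`. -/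
theorem disjoint_blockingPairs {v t t' : Fin n} (ht : pos x t < pos x v) (ht' : pos x t' < pos x v)
    (hne : t ≠ t') : Disjoint (blockingPairs x v t) (blockingPairs x v t') := by
  rw [Set.disjoint_left]
  rintro e (rfl | ⟨s, hs, rfl⟩) (he | ⟨s', hs', he⟩) <;> rw [Sym2.eq_iff] at he <;>
    rcases he with ⟨h1, h2⟩ | ⟨h1, h2⟩ <;> subst_vars <;> omega

variable [DiscreteMeasurableSpace Ω]

/-- A vertex `t` that is likely to be in a level blocks `v` with a certain probability. -/
theorem prob_not_block_le (M : PathModel μ Z x adj E q p) {A : Ω → Prop} {v t : Fin n} {k a : ℕ}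
    {r : ℝ} (ht : pos x t < pos x v) (hA : DeterminedBy Z {s(t, v)} A)
    (hAr : 2 * r ≤ μ.real {ω | A ω})
    (hk : 1 ≤ k) (ha : a ≤ pos x t) (hr : 0 ≤ r)
    (hsmall : (4 * p * ((pos x t : ℝ) - a) + 4) / 2 ^ k ≤ 1 / 2) :
    μ.real {ω | A ω → ∃ k' s, k ≤ k' ∧ k' ≤ q ∧ a ≤ pos x s ∧ pos x s < pos x t ∧
      E ω k' s t = true} ≤ 1 - r := by
  set B : Ω → Prop := fun ω => ∃ k' s, k ≤ k' ∧ k' ≤ q ∧ a ≤ pos x s ∧ pos x s < pos x t ∧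
      E ω k' s t = true with hB
  have h1 : {ω | A ω → B ω} = {ω | A ω ∧ ¬ B ω}ᶜ := by
    ext ω
    exact not_and_not_right.symm
  -- The pair of `t` and the later `v` is not among the pairs of `t` with earlier vertices. Hence
  -- `t` blocks with probability at least `2 * r` times `1 / 2`.
  have h2 : μ.real {ω | A ω ∧ ¬ B ω} = μ.real {ω | A ω} * μ.real {ω | ¬ B ω} := by
    refine M.indep _ _ _ _ ?_ hA (M.det_exists_edge k a t).not
    rw [Set.disjoint_singleton_left]
    rintro ⟨s, hs, h⟩
    rw [Sym2.eq_iff] at h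
    rcases h with ⟨h, h'⟩ | ⟨h, h'⟩ <;> subst_vars <;> omega
  have h3 : μ.real {ω | ¬ B ω} = 1 - μ.real {ω | B ω} :=
    probReal_compl_eq_one_sub (MeasurableSet.of_discrete (s := {ω | B ω}))
  have h4 := M.prob_exists_edge_le hk t ha
  change μ.real {ω | B ω} ≤ _ at h4
  rw [h1, probReal_compl_eq_one_sub MeasurableSet.of_discrete, h2]
  nlinarith

end PathModel

end StochSort

/-! ### The probability that a vertex is not blocked -/

namespace StochSort

/-- The target size of level `i` when the edge probability is `p`. -/
noncomputable def size (p : ℝ) (i : ℕ) : ℝ := 2 ^ i / p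

/-- A function of `j` that is about `1` for `j ≤ σ` and decays rapidly for `j ≥ σ`. -/
noncomputable def decay (σ : ℝ) (j : ℕ) : ℝ := (σ / (σ + j)) ^ 4

theorem image_pos_filter {n : ℕ} (x : Equiv.Perm (Fin n)) {a b : ℕ} (hb : b ≤ n) :
    (Finset.univ.filter fun v => a ≤ pos x v ∧ pos x v < b).image (pos x) = Finset.Ico a b := by
  ext d
  simp only [Finset.mem_image, Finset.mem_filter, Finset.mem_univ, true_and, Finset.mem_Ico]
  constructor
  · rintro ⟨v, hv, rfl⟩
    exact hv
  · intro hd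
    obtain ⟨v, rfl⟩ := exists_pos_eq x (k := d) (by omega)
    exact ⟨v, hd, rfl⟩

/-- The factors (d - 1)/d telescope. -/
theorem prod_one_sub_inv_pow {A j : ℕ} (hA : 1 ≤ A) (hAj : A < j) :
    ∏ d ∈ Finset.Ico (A + 1) j, (1 - 1 / (d : ℝ)) ^ 4 = (A / ((j : ℝ) - 1)) ^ 4 := by
  induction j, hAj using Nat.le_induction with
  | base =>
    have : (A : ℝ) ≠ 0 := by positivity
    simp [this]
  | succ j hj ih =>
    rw [Finset.prod_Ico_succ_top hj, ih, ← mul_pow]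
    congr 1
    have h1 : (j : ℝ) ≠ 0 := by
      have : 0 < j := by omega
      positivity
    have h2 : (j : ℝ) - 1 ≠ 0 := by
      have : (1 : ℝ) < j := by exact_mod_cast (by omega : 1 < j)
      linarith
    rw [show ((j + 1 : ℕ) : ℝ) - 1 = j by push_cast; ring]
    field_simp

/-- Leaving out one vertex costs at most a factor 16: all distances that occur are at least 2, so
each factor is at least (1/2)^4. -/
theorem prod_filter_one_sub_inv_pow_le {n : ℕ} (x : Equiv.Perm (Fin n)) {ℓ A : ℕ} (hA : 1 ≤ A)
    {v : Fin n} (hAv : ℓ + A < pos x v) (x₀ : Fin n) :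
    ∏ t ∈ Finset.univ.filter (fun t => (ℓ + A < pos x t ∧ pos x t < pos x v) ∧ t ≠ x₀),
      (1 - 1 / ((pos x t - ℓ : ℕ) : ℝ)) ^ 4 ≤ 16 * (A / ((pos x v - ℓ : ℕ) - 1 : ℝ)) ^ 4 := by
  classical
  set T := Finset.univ.filter fun t => ℓ + A + 1 ≤ pos x t ∧ pos x t < pos x v with hT
  have hT' : Finset.univ.filter (fun t => (ℓ + A < pos x t ∧ pos x t < pos x v) ∧ t ≠ x₀) =
      T.erase x₀ := by
    ext t
    simp only [hT, Finset.mem_filter, Finset.mem_univ, true_and, Finset.mem_erase]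
    constructor
    · rintro ⟨h1, h2⟩
      exact ⟨h2, by omega, h1.2⟩
    · rintro ⟨h1, h2⟩
      exact ⟨⟨by omega, h2.2⟩, h1⟩
  have hfull : ∏ t ∈ T, (1 - 1 / ((pos x t - ℓ : ℕ) : ℝ)) ^ 4 =
      (A / ((pos x v - ℓ : ℕ) - 1 : ℝ)) ^ 4 := by
    rw [← prod_one_sub_inv_pow hA (by omega : A < pos x v - ℓ),
      ← Finset.prod_image (s := T) (g := pos x)
        (f := fun d : ℕ => (1 - 1 / ((d - ℓ : ℕ) : ℝ)) ^ 4) ((pos_injective x).injOn),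
      hT, image_pos_filter x (pos_lt x v).le]
    have := Finset.prod_Ico_add' (fun d : ℕ => (1 - 1 / ((d - ℓ : ℕ) : ℝ)) ^ 4) (A + 1)
      (pos x v - ℓ) ℓ
    rw [show A + 1 + ℓ = ℓ + A + 1 by omega, show pos x v - ℓ + ℓ = pos x v by omega] at this
    rw [← this]
    simp
  have hnn : ∀ t, (0 : ℝ) ≤ (1 - 1 / ((pos x t - ℓ : ℕ) : ℝ)) ^ 4 := fun t => by positivity
  rw [hT', ← hfull]
  by_cases hx : x₀ ∈ T
  · rw [← Finset.mul_prod_erase T _ hx, ← mul_assoc]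
    refine le_mul_of_one_le_left (Finset.prod_nonneg fun t _ => hnn t) ?_
    simp only [hT, Finset.mem_filter, Finset.mem_univ, true_and] at hx
    have h2 : (2 : ℝ) ≤ ((pos x x₀ - ℓ : ℕ) : ℝ) := by
      exact_mod_cast (by omega : 2 ≤ pos x x₀ - ℓ)
    have h3 : 1 / ((pos x x₀ - ℓ : ℕ) : ℝ) ≤ 1 / 2 := one_div_le_one_div_of_le (by norm_num) h2
    have h4 : (1 / 2 : ℝ) ^ 4 ≤ (1 - 1 / ((pos x x₀ - ℓ : ℕ) : ℝ)) ^ 4 :=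
      pow_le_pow_left₀ (by norm_num) (by linarith) 4
    norm_num at h4 ⊢
    linarith
  · rw [Finset.erase_eq_of_notMem hx]
    exact le_mul_of_one_le_left (Finset.prod_nonneg fun t _ => hnn t) (by norm_num)

namespace PathModel

variable {n : ℕ} {Ω β : Type*} [MeasurableSpace Ω] {μ : Measure Ω} {Z : Sym2 (Fin n) → Ω → β}
  {x : Equiv.Perm (Fin n)} {adj : Ω → Fin n → Fin n → Bool} {E : Ω → ℕ → Fin n → Fin n → Bool}
  {q : ℕ} {p : ℝ} {c ℓ : ℕ} {R : ℕ → ℕ}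

theorem det_block (M : PathModel μ Z x adj E q p) {A : Ω → Prop} {v t : Fin n}
    (hA : DeterminedBy Z {s(t, v)} A) (k a : ℕ) :
    DeterminedBy Z (blockingPairs x v t) fun ω => A ω → ∃ k' s, k ≤ k' ∧ k' ≤ q ∧ a ≤ pos x s ∧
      pos x s < pos x t ∧ E ω k' s t = true :=
  (hA.mono (Set.singleton_subset_iff.2 (Set.mem_insert _ _))).imp
    ((M.det_exists_edge k a t).mono (Set.subset_insert _ _))

/-- Take the least `k` with `d ≤ size p (k + c) / 16`. It exceeds `i` by the hypothesis on `d`, and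
it is at most `q` because `d < n ≤ size p q` and `2 ^ c ≥ 16`. -/
theorem exists_blocking_level (M : PathModel μ Z x adj E q p) (hc : 8 ≤ c) {i d : ℕ} (hd : d < n)
    (hid : size p (i + c) / 16 < d) :
    ∃ k, i < k ∧ k ≤ q ∧ size p (k + c) / 32 < d ∧ (d : ℝ) ≤ size p (k + c) / 16 := by
  have hp := M.p_pos
  have hmono : ∀ k k', k ≤ k' → size p k ≤ size p k' := by
    intro k k' h
    unfold size
    gcongr
    norm_num
  have hq : (d : ℝ) ≤ size p (q + c) / 16 := by
    have h1 : (d : ℝ) ≤ n := by exact_mod_cast hd.le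
    have h2 : size p (q + c) = size p q * 2 ^ c := by unfold size; rw [pow_add]; ring
    have h3 : (2 : ℝ) ^ 8 ≤ 2 ^ c := pow_le_pow_right₀ (by norm_num) hc
    have h4 : (n : ℝ) ≤ size p q := M.n_le
    have h5 : 0 ≤ size p q := by unfold size; positivity
    nlinarith
  classical
  have hex : ∃ k, (d : ℝ) ≤ size p (k + c) / 16 := ⟨q, hq⟩
  obtain ⟨k, hk, hmin⟩ : ∃ k, (d : ℝ) ≤ size p (k + c) / 16 ∧
      ∀ m, (d : ℝ) ≤ size p (m + c) / 16 → k ≤ m :=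
    ⟨Nat.find hex, Nat.find_spec hex, fun m hm => Nat.find_min' hex hm⟩
  have hik : i < k := by
    by_contra hcon
    have := hmono _ _ (by omega : k + c ≤ i + c)
    linarith
  refine ⟨k, hik, hmin q hq, ?_, hk⟩
  by_contra hcon
  have h2 : size p (k + c) = 2 * size p (k - 1 + c) := by
    unfold size
    rw [show k + c = k - 1 + c + 1 by omega, pow_succ]
    ring
  have := hmin (k - 1) (by linarith)
  omega

variable [IsProbabilityMeasure μ] [DiscreteMeasurableSpace Ω]

/-- The main estimate. Every `t` beyond distance `size p (i + c) / 16` is given its own level `κ t`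
at which it may block `v`. Nearer vertices are ignored, at the price of a constant depending on `c`.
The event `F` fixes what happens at a few other pairs, and `x₀` is the one vertex whose blocking
pairs may meet those of `F`. The fourth power is needed later, where the bound is split into two
squares. -/
theorem prob_unblocked_le (M : PathModel μ Z x adj E q p) (hc : 8 ≤ c) {i : ℕ} (hi : 1 ≤ i)
    (hR : ∀ k, 1 ≤ k → k ≤ q → R k ≤ ℓ ∧ (ℓ : ℝ) - R k ≤ size p k / 32 + 2) {v : Fin n}
    (hv : ℓ ≤ pos x v) (x₀ : Fin n) {F : Ω → Prop} {S₀ : Set (Sym2 (Fin n))}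
    (hF : DeterminedBy Z S₀ F)
    (hS₀ : ∀ t, size p (i + c) / 16 < (pos x t : ℝ) - ℓ → pos x t < pos x v → t ≠ x₀ →
      Disjoint S₀ (blockingPairs x v t)) :
    μ.real {ω | F ω ∧ Unblocked x (E ω) q c R ℓ i v} ≤
      μ.real {ω | F ω} * (16 * (2 ^ c) ^ 4 * decay (size p i) (pos x v - ℓ)) := by
  classical
  have hp := M.p_pos
  have hp1 := M.p_le_one
  have h2c : (2 : ℝ) ^ 8 ≤ 2 ^ c := pow_le_pow_right₀ (by norm_num) hc
  have hsi : 2 ≤ size p i := by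
    unfold size
    rw [le_div_iff₀ hp]
    have : (2 : ℝ) ^ 1 ≤ 2 ^ i := pow_le_pow_right₀ (by norm_num) hi
    nlinarith
  have hsic : size p (i + c) = size p i * 2 ^ c := by unfold size; rw [pow_add]; ring
  set A := ⌊size p (i + c) / 16⌋₊ with hA
  have hAle : (A : ℝ) ≤ size p (i + c) / 16 := Nat.floor_le (by rw [hsic]; positivity)
  have hltA : size p (i + c) / 16 < A + 1 := Nat.lt_floor_add_one _
  have hA1 : 1 ≤ A := by
    rw [hA, Nat.one_le_floor_iff, hsic]
    nlinarith
  set T := Finset.univ.filter (fun t => (ℓ + A < pos x t ∧ pos x t < pos x v) ∧ t ≠ x₀) with hT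
  have hcast : ∀ t, ℓ ≤ pos x t → ((pos x t - ℓ : ℕ) : ℝ) = (pos x t : ℝ) - ℓ :=
    fun t ht => Nat.cast_sub ht
  have hfar : ∀ t ∈ T, size p (i + c) / 16 < ((pos x t - ℓ : ℕ) : ℝ) := by
    intro t ht
    simp only [hT, Finset.mem_filter, Finset.mem_univ, true_and] at ht
    exact (Nat.floor_lt (by rw [hsic]; positivity)).1 (by omega)
  have hlev : ∀ t, ∃ k, t ∈ T → i < k ∧ k ≤ q ∧ size p (k + c) / 32 < ((pos x t - ℓ : ℕ) : ℝ) ∧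
      ((pos x t - ℓ : ℕ) : ℝ) ≤ size p (k + c) / 16 := by
    intro t
    by_cases ht : t ∈ T
    · obtain ⟨k, hk⟩ := M.exists_blocking_level hc (i := i)
        (lt_of_le_of_lt (Nat.sub_le _ _) (pos_lt x t)) (hfar t ht)
      exact ⟨k, fun _ => hk⟩
    · exact ⟨0, fun h => absurd h ht⟩
  choose κ hκ using hlev
  have hprod : μ.real {ω | F ω ∧ ∀ t ∈ T, E ω (κ t) t v = true → ∃ k' s, κ t + c ≤ k' ∧ k' ≤ q ∧
      R (κ t) ≤ pos x s ∧ pos x s < pos x t ∧ E ω k' s t = true} ≤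
      μ.real {ω | F ω} * ∏ t ∈ T, (1 - 1 / ((pos x t - ℓ : ℕ) : ℝ)) ^ 4 := by
    refine M.prob_and_forall_le T (S := blockingPairs x v) hF
      (fun t _ => M.det_block (M.E_det (κ t) t v) _ _) ?_ ?_ ?_
    · intro t ht
      have h1 := hfar t ht
      simp only [hT, Finset.mem_filter, Finset.mem_univ, true_and] at ht
      rw [hcast t (by omega)] at h1
      exact hS₀ t h1 ht.1.2 ht.2
    · intro t ht t' ht' hne
      simp only [hT, Finset.mem_filter, Finset.mem_univ, true_and] at ht ht'
      exact disjoint_blockingPairs ht.1.2 ht'.1.2 hne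
    · intro t ht
      obtain ⟨h1, h2, h3, h4⟩ := hκ t ht
      have h5 := hfar t ht
      simp only [hT, Finset.mem_filter, Finset.mem_univ, true_and] at ht
      obtain ⟨h6, h7⟩ := hR (κ t) (by omega) h2
      set d : ℝ := ((pos x t - ℓ : ℕ) : ℝ) with hd
      have hd1 : 1 ≤ d := by
        rw [hd]
        exact_mod_cast (by omega : 1 ≤ pos x t - ℓ)
      have hbern : 1 - 4 / d ≤ (1 - 1 / d) ^ 4 := by
        have h0 : 0 ≤ 1 / d := by positivity
        have h1 : 1 / d ≤ 1 := by rw [div_le_one (by linarith)]; exact hd1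
        have h2 := one_add_mul_le_pow (a := -(1 / d)) (by linarith) 4
        calc 1 - 4 / d = 1 + ((4 : ℕ) : ℝ) * -(1 / d) := by push_cast; ring
          _ ≤ _ := h2
          _ = _ := by ring
      refine le_trans ?_ hbern
      have h2k : (2 : ℝ) ^ 1 ≤ 2 ^ κ t := pow_le_pow_right₀ (by norm_num) (by omega)
      refine M.prob_not_block_le ht.1.2 (M.E_det (κ t) t v) ?_ (by omega) (by omega)
        (by positivity) ?_
      -- From `d > size p (κ t + c) / 32` and `c ≥ 8` one gets p / 2^κ ≥ 2^c / (32 d) ≥ 8 / d, which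
      -- is twice the 4 / d of Bernoulli's inequality.
      · refine le_trans ?_ (M.le_E (κ t) t v (by omega) h2 (by rintro rfl; omega))
        rw [size, div_div, pow_add, div_lt_iff₀ (by positivity)] at h3
        rw [← mul_div_assoc, div_le_div_iff₀ (by linarith) (by positivity)]
        nlinarith
      · have h8 : (pos x t : ℝ) = d + ℓ := by rw [hd, hcast t (by omega)]; ring
        rw [h8, div_le_iff₀ (by positivity)]
        -- The possible vertices `s` span at most d + s_κ/32 + 2 positions. So the numerator is at
        -- most 2^(κ+c)/4 + 2^κ/8 + 8p + 4, which is below half of 2^(κ+c).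
        have h9 : 4 * p * (size p (κ t + c) / 16) = 2 ^ (κ t + c) / 4 := by
          unfold size; field_simp; ring
        have h10 : 4 * p * (size p (κ t) / 32 + 2) = 2 ^ κ t / 8 + 8 * p := by
          unfold size; field_simp; ring
        have h11 : 4 * p * (d + ℓ - R (κ t)) ≤ 4 * p * (size p (κ t + c) / 16) +
            4 * p * (size p (κ t) / 32 + 2) := by
          rw [← mul_add]
          gcongr
          linarith
        rw [h9, h10] at h11
        rw [pow_add] at h11 ⊢
        nlinarith
  have hsub : {ω | F ω ∧ Unblocked x (E ω) q c R ℓ i v} ⊆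
      {ω | F ω ∧ ∀ t ∈ T, E ω (κ t) t v = true → ∃ k' s, κ t + c ≤ k' ∧ k' ≤ q ∧
      R (κ t) ≤ pos x s ∧ pos x s < pos x t ∧ E ω k' s t = true} := by
    rintro ω ⟨h1, h2⟩
    refine ⟨h1, fun t ht hE => ?_⟩
    obtain ⟨h3, h4, -, -⟩ := hκ t ht
    simp only [hT, Finset.mem_filter, Finset.mem_univ, true_and] at ht
    exact h2 (κ t) h3.le h4 t (by omega) ht.1.2 hE
  refine (measureReal_mono hsub (measure_ne_top _ _)).trans (hprod.trans ?_)
  refine mul_le_mul_of_nonneg_left ?_ measureReal_nonneg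
  have hj : ((pos x v - ℓ : ℕ) : ℝ) = (pos x v : ℝ) - ℓ := hcast v hv
  have hj0 : (0 : ℝ) ≤ ((pos x v - ℓ : ℕ) : ℝ) := by positivity
  rw [decay, mul_assoc, ← mul_pow, ← mul_div_assoc]
  rcases Nat.lt_or_ge (A + 1) (pos x v - ℓ) with hcase | hcase
  · refine (prod_filter_one_sub_inv_pow_le x hA1 (by omega) x₀).trans ?_
    have h1 : (A : ℝ) + 2 ≤ ((pos x v - ℓ : ℕ) : ℝ) := by exact_mod_cast hcase
    set j : ℝ := ((pos x v - ℓ : ℕ) : ℝ)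
    have hA0 : (0 : ℝ) ≤ A := by positivity
    have h2 : (A : ℝ) / (j - 1) ≤ 2 ^ c * size p i / (size p i + j) := by
      rw [div_le_div_iff₀ (by linarith) (by linarith)]
      have h3 : size p i + j ≤ 3 * (j - 1) := by nlinarith
      have h4 : (A : ℝ) ≤ 2 ^ c * size p i / 16 := by rw [hsic] at hAle; linarith
      calc (A : ℝ) * (size p i + j) ≤ (2 ^ c * size p i / 16) * (3 * (j - 1)) := by
            gcongr
        _ ≤ _ := by
          have h5 : 0 ≤ 2 ^ c * size p i * (j - 1) := mul_nonneg (by positivity) (by linarith)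
          linarith
    have h5 : (0 : ℝ) ≤ (A : ℝ) / (j - 1) := div_nonneg hA0 (by linarith)
    have := pow_le_pow_left₀ h5 h2 4
    linarith
  -- Too close to `ℓ` for any far vertex to precede `v`, but there the claimed bound on the product
  -- is at least 1.
  · have hempty : T = ∅ := by
      rw [hT, Finset.filter_eq_empty_iff]
      rintro t - ⟨⟨h1, h2⟩, -⟩
      omega
    rw [hempty, Finset.prod_empty]
    have h1 : ((pos x v - ℓ : ℕ) : ℝ) ≤ A + 1 := by exact_mod_cast hcase
    have h2 : 1 ≤ 2 ^ c * size p i / (size p i + ((pos x v - ℓ : ℕ) : ℝ)) := by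
      rw [le_div_iff₀ (by linarith), one_mul]
      rw [hsic] at hAle
      nlinarith
    have := one_le_pow₀ h2 (n := 4)
    linarith

end PathModel

end StochSort

/-! ### Sums of the decay function, and survival of a candidate -/

namespace StochSort

theorem ratio_nonneg {σ : ℝ} (hσ : 1 ≤ σ) (j : ℕ) : 0 ≤ σ / (σ + j) := by positivity

theorem ratio_le_one {σ : ℝ} (hσ : 1 ≤ σ) (j : ℕ) : σ / (σ + j) ≤ 1 := by
  rw [div_le_one (by positivity)]
  have : (0 : ℝ) ≤ j := by positivity
  linarith

theorem decay_nonneg {σ : ℝ} (hσ : 1 ≤ σ) (j : ℕ) : 0 ≤ decay σ j :=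
  pow_nonneg (ratio_nonneg hσ j) 4

/-- With t = σ + j, compare 1/t² with 1/(t² - 1/4) = 1/(t - 1/2) - 1/(t + 1/2), which telescopes. -/
theorem sum_ratio_sq_le {σ : ℝ} (hσ : 1 ≤ σ) (n : ℕ) :
    ∑ j ∈ Finset.range n, (σ / (σ + j)) ^ 2 ≤ 2 * σ := by
  have key : ∑ j ∈ Finset.range n, (σ / (σ + j)) ^ 2 ≤
      σ ^ 2 / (σ - 1 / 2) - σ ^ 2 / (σ + n - 1 / 2) := by
    induction n with
    | zero => simp
    | succ n ih =>
      rw [Finset.sum_range_succ]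
      have hn : (0 : ℝ) ≤ n := by positivity
      have h1 : (σ / (σ + n)) ^ 2 ≤
          σ ^ 2 / (σ + n - 1 / 2) - σ ^ 2 / (σ + (n + 1 : ℕ) - 1 / 2) := by
        have h2 : σ ^ 2 / (σ + n - 1 / 2) - σ ^ 2 / (σ + (n + 1 : ℕ) - 1 / 2) =
            σ ^ 2 / ((σ + n) ^ 2 - 1 / 4) := by
          have h3 : σ + n - 1 / 2 ≠ 0 := by linarith
          have h4 : σ + ((n + 1 : ℕ) : ℝ) - 1 / 2 ≠ 0 := by push_cast; linarith
          have h5 : (σ + n) ^ 2 - 1 / 4 ≠ 0 := by nlinarith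
          rw [div_sub_div _ _ h3 h4, div_eq_div_iff (mul_ne_zero h3 h4) h5]
          push_cast
          ring
        rw [h2, div_pow]
        refine div_le_div_of_nonneg_left (by positivity) (by nlinarith) (by linarith)
      linarith
  refine key.trans ?_
  have h1 : 0 ≤ σ ^ 2 / (σ + n - 1 / 2) := by
    refine div_nonneg (by positivity) ?_
    have : (0 : ℝ) ≤ n := by positivity
    linarith
  have h2 : σ ^ 2 / (σ - 1 / 2) ≤ 2 * σ := by
    rw [div_le_iff₀ (by linarith)]
    nlinarith
  linarith

theorem decay_le_sq {σ : ℝ} (hσ : 1 ≤ σ) (j : ℕ) : decay σ j ≤ (σ / (σ + j)) ^ 2 :=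
  pow_le_pow_of_le_one (ratio_nonneg hσ j) (ratio_le_one hσ j) (by norm_num)

theorem sum_decay_le {σ : ℝ} (hσ : 1 ≤ σ) (n : ℕ) :
    ∑ j ∈ Finset.range n, decay σ j ≤ 2 * σ :=
  (Finset.sum_le_sum fun j _ => decay_le_sq hσ j).trans (sum_ratio_sq_le hσ n)

/-- One factor σ/(σ + j) absorbs `j` into σ, and a second one is dropped. -/
theorem sum_mul_decay_le {σ : ℝ} (hσ : 1 ≤ σ) (n : ℕ) :
    ∑ j ∈ Finset.range n, (j : ℝ) * decay σ j ≤ 2 * σ ^ 2 := by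
  have h1 : ∀ j : ℕ, (j : ℝ) * decay σ j ≤ σ * (σ / (σ + j)) ^ 2 := by
    intro j
    have h2 := ratio_nonneg hσ j
    have h3 := ratio_le_one hσ j
    have h4 : (j : ℝ) * (σ / (σ + j)) ≤ σ := by
      rw [mul_div_assoc', div_le_iff₀ (by positivity)]
      have : (0 : ℝ) ≤ j := by positivity
      nlinarith
    calc (j : ℝ) * decay σ j = (j * (σ / (σ + j))) * ((σ / (σ + j)) * (σ / (σ + j)) ^ 2) := by
          rw [decay]; ring
      _ ≤ σ * (1 * (σ / (σ + j)) ^ 2) := by gcongr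
      _ = _ := by ring
  calc _ ≤ ∑ j ∈ Finset.range n, σ * (σ / (σ + j)) ^ 2 := Finset.sum_le_sum fun j _ => h1 j
    _ = σ * ∑ j ∈ Finset.range n, (σ / (σ + j)) ^ 2 := by rw [Finset.mul_sum]
    _ ≤ σ * (2 * σ) := by
        have := sum_ratio_sq_le hσ n
        gcongr
    _ = _ := by ring

/-- Needed for the first build of the levels, whose target sizes may exceed `n`. -/
theorem sum_mul_decay_le' {σ : ℝ} (hσ : 1 ≤ σ) (n : ℕ) :
    ∑ j ∈ Finset.range n, (j : ℝ) * decay σ j ≤ n * (2 * σ) := by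
  calc _ ≤ ∑ j ∈ Finset.range n, (n : ℝ) * decay σ j := by
        refine Finset.sum_le_sum fun j hj => ?_
        have h1 : (j : ℝ) ≤ n := by exact_mod_cast (Finset.mem_range.1 hj).le
        have := decay_nonneg hσ j
        gcongr
    _ = n * ∑ j ∈ Finset.range n, decay σ j := by rw [Finset.mul_sum]
    _ ≤ _ := by
        have := sum_decay_le hσ n
        gcongr

/-- Apply y^4 / 24 ≤ e^y to y = 1 + j/σ; the constant is 216 = 9 · 24, from e² < 9. -/
theorem exp_neg_div_le_decay {σ : ℝ} (hσ : 1 ≤ σ) (j : ℕ) :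
    Real.exp (1 - j / σ) ≤ 216 * decay σ j := by
  have hz : (0 : ℝ) ≤ j / σ := by positivity
  have h1 : decay σ j = 1 / (1 + j / σ) ^ 4 := by
    rw [decay, show (1 : ℝ) + j / σ = (σ + j) / σ by field_simp, div_pow, div_pow, one_div_div]
  have h2 := Real.pow_div_factorial_le_exp (x := 1 + j / σ) (by positivity) 4
  have h3 : Real.exp (1 - j / σ) * Real.exp (1 + j / σ) = Real.exp 1 ^ 2 := by
    rw [← Real.exp_add, ← Real.exp_nat_mul]
    congr 1
    push_cast
    ring
  have h4 : Real.exp 1 < 3 := Real.exp_one_lt_d9.trans (by norm_num)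
  have h5 : (Nat.factorial 4 : ℝ) = 24 := by norm_num [Nat.factorial]
  rw [h5, div_le_iff₀ (by norm_num)] at h2
  rw [h1, mul_one_div, le_div_iff₀ (by positivity)]
  calc Real.exp (1 - j / σ) * (1 + j / σ) ^ 4
      ≤ Real.exp (1 - j / σ) * (Real.exp (1 + j / σ) * 24) := by gcongr
    _ = Real.exp 1 ^ 2 * 24 := by rw [← mul_assoc, h3]
    _ ≤ 3 ^ 2 * 24 := by gcongr
    _ = 216 := by norm_num

/-- The vertex `y` is not eliminated by the levels below `r`, in the search for the vertex in
position `ℓ`. -/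
def Survives {n : ℕ} (x : Equiv.Perm (Fin n)) (adj : Fin n → Fin n → Bool)
    (E : ℕ → Fin n → Fin n → Bool) (q ℓ r : ℕ) (y : Fin n) : Prop :=
  2 ≤ r → ∀ u, ℓ ≤ pos x u → pos x u < pos x y → adj u y = true →
    ∃ k s, r ≤ k + 1 ∧ k ≤ q ∧ ℓ ≤ pos x s ∧ pos x s < pos x u ∧ E k s u = true

namespace PathModel

variable {n : ℕ} {Ω β : Type*} [MeasurableSpace Ω] {μ : Measure Ω} {Z : Sym2 (Fin n) → Ω → β}
  {x : Equiv.Perm (Fin n)} {adj : Ω → Fin n → Fin n → Bool} {E : Ω → ℕ → Fin n → Fin n → Bool}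
  {q : ℕ} {p : ℝ} {c ℓ : ℕ} {R : ℕ → ℕ}

variable [IsProbabilityMeasure μ] [DiscreteMeasurableSpace Ω]

/-- About j / (2 · 2^c) vertices `t` before `y` are close enough to `ℓ` to avoid exclusion from
level `r - 1` with probability at least 1/2. Each of them is adjacent to `y` with probability `p`,
so the survival probability is at most (1 - p/2) to the number of such `t`. The scale 4 · 2^c / p
does not depend on `r`. -/
theorem prob_survives_le (M : PathModel μ Z x adj E q p) {r : ℕ} {y : Fin n} (hy : ℓ < pos x y)
    (hnear : (pos x y : ℝ) - ℓ ≤ size p (r + c) / 16) (x₀ : Fin n) {F : Ω → Prop}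
    {S₀ : Set (Sym2 (Fin n))} (hF : DeterminedBy Z S₀ F)
    (hS₀ : ∀ t, ℓ ≤ pos x t → pos x t + 1 < pos x y → t ≠ x₀ →
      Disjoint S₀ (blockingPairs x y t)) :
    μ.real {ω | F ω ∧ Survives x (adj ω) (E ω) q ℓ r y} ≤
      μ.real {ω | F ω} * (216 * decay (4 * 2 ^ c / p) (pos x y - ℓ)) := by
  classical
  have hp := M.p_pos
  have hp1 := M.p_le_one
  have h2c : (1 : ℝ) ≤ 2 ^ c := one_le_pow₀ (by norm_num)
  have hσ : 1 ≤ 4 * 2 ^ c / p := by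
    rw [le_div_iff₀ hp]
    linarith
  have hcast : ((pos x y - ℓ : ℕ) : ℝ) = (pos x y : ℝ) - ℓ := Nat.cast_sub hy.le
  set j := pos x y - ℓ with hj
  rw [← hcast] at hnear
  have hjσ : (j : ℝ) / (4 * 2 ^ c / p) ≤ 2 ^ r / 64 := by
    rw [div_le_iff₀ (by positivity)]
    calc (j : ℝ) ≤ size p (r + c) / 16 := hnear
      _ = _ := by unfold size; rw [pow_add]; field_simp; ring
  rcases Nat.lt_or_ge r 5 with hr | hr
  -- For `r ≤ 4` the hypothesis `hnear` makes j/σ at most 1/4, and the bound is trivial.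
  · have h1 : (1 : ℝ) ≤ 216 * decay (4 * 2 ^ c / p) j := by
      refine le_trans ?_ (exp_neg_div_le_decay hσ j)
      refine Real.one_le_exp ?_
      have : (2 : ℝ) ^ r ≤ 2 ^ 4 := pow_le_pow_right₀ (by norm_num) (by omega)
      linarith
    calc _ ≤ μ.real {ω | F ω} := measureReal_mono (fun ω h => h.1) (measure_ne_top _ _)
      _ ≤ _ := le_mul_of_one_le_right measureReal_nonneg h1
  · set b := ⌊size p (r - 1) / 16⌋₊ with hb
    -- The bound `j - 1` leaves out the path predecessor of `y`, whose adjacency is not random; `b +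
    -- 1` counts the distances from 0 to `b`.
    set m := min (j - 1) (b + 1) with hm
    set T := (Finset.univ.filter fun t => ℓ ≤ pos x t ∧ pos x t < ℓ + m).erase x₀ with hT
    have hTmem : ∀ t ∈ T, t ≠ x₀ ∧ ℓ ≤ pos x t ∧ pos x t + 1 < pos x y ∧ pos x t - ℓ ≤ b := by
      intro t ht
      simp only [hT, Finset.mem_erase, Finset.mem_filter, Finset.mem_univ, true_and] at ht
      exact ⟨ht.1, ht.2.1, by omega, by omega⟩
    have hcard : m - 1 ≤ T.card := by
      have h1 : (Finset.univ.filter fun t => ℓ ≤ pos x t ∧ pos x t < ℓ + m).card = m := by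
        have h2 : ℓ + m ≤ n := by
          have := pos_lt x y
          omega
        rw [← Finset.card_image_of_injective _ (pos_injective x), image_pos_filter x h2,
          Nat.card_Ico]
        omega
      have h3 : (Finset.univ.filter fun t => ℓ ≤ pos x t ∧ pos x t < ℓ + m).card - 1 ≤ T.card :=
        Finset.pred_card_le_card_erase
      omega
    have hsz : 1 ≤ size p (r - 1) / 16 := by
      unfold size
      rw [div_div, le_div_iff₀ (by positivity)]
      have : (2 : ℝ) ^ 4 ≤ 2 ^ (r - 1) := pow_le_pow_right₀ (by norm_num) (by omega)
      linarith
    have hprod : μ.real {ω | F ω ∧ ∀ t ∈ T, adj ω t y = true → ∃ k' s, r - 1 ≤ k' ∧ k' ≤ q ∧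
        ℓ ≤ pos x s ∧ pos x s < pos x t ∧ E ω k' s t = true} ≤
        μ.real {ω | F ω} * ∏ t ∈ T, (1 - p / 2) := by
      refine M.prob_and_forall_le T (S := blockingPairs x y) hF
        (fun t _ => M.det_block (M.adj_det t y) _ _) ?_ ?_ ?_
      · intro t ht
        obtain ⟨h1, h2, h3, -⟩ := hTmem t ht
        exact hS₀ t h2 h3 h1
      · intro t ht t' ht' hne
        exact disjoint_blockingPairs (by have := hTmem t ht; omega)
          (by have := hTmem t' ht'; omega) hne
      · intro t ht
        obtain ⟨h1, h2, h3, h4⟩ := hTmem t ht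
        refine M.prob_not_block_le (by omega) (M.adj_det t y) ?_ (by omega) h2 (by positivity) ?_
        · rw [M.adj_eq t y (by rintro rfl; omega) (by rw [hamPath_adj]; omega)]
          linarith
        · rw [← Nat.cast_sub h2, div_le_iff₀ (by positivity)]
          have h5 : ((pos x t - ℓ : ℕ) : ℝ) ≤ size p (r - 1) / 16 := by
            have : ((pos x t - ℓ : ℕ) : ℝ) ≤ b := by exact_mod_cast h4
            exact this.trans (Nat.floor_le (by linarith))
          have h6 : 4 * p * (size p (r - 1) / 16) = 2 ^ (r - 1) / 4 := by
            unfold size; field_simp; ring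
          have h7 : 4 * p * ((pos x t - ℓ : ℕ) : ℝ) ≤ 4 * p * (size p (r - 1) / 16) := by gcongr
          have : (2 : ℝ) ^ 4 ≤ 2 ^ (r - 1) := pow_le_pow_right₀ (by norm_num) (by omega)
          linarith
    have hsub : {ω | F ω ∧ Survives x (adj ω) (E ω) q ℓ r y} ⊆ {ω | F ω ∧ ∀ t ∈ T,
        adj ω t y = true → ∃ k' s, r - 1 ≤ k' ∧ k' ≤ q ∧
        ℓ ≤ pos x s ∧ pos x s < pos x t ∧ E ω k' s t = true} := by
      rintro ω ⟨h1, h2⟩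
      refine ⟨h1, fun t ht hadj => ?_⟩
      obtain ⟨-, h3, h4, -⟩ := hTmem t ht
      obtain ⟨k, s, h5, h6, h7, h8, h9⟩ := h2 (by omega) t h3 (by omega) hadj
      exact ⟨k, s, by omega, h6, h7, h8, h9⟩
    refine (measureReal_mono hsub (measure_ne_top _ _)).trans (hprod.trans ?_)
    refine mul_le_mul_of_nonneg_left ?_ measureReal_nonneg
    refine le_trans ?_ (exp_neg_div_le_decay hσ j)
    rw [Finset.prod_const]
    have h1 : (1 - p / 2) ^ T.card ≤ Real.exp (-(p / 2)) ^ T.card := by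
      refine pow_le_pow_left₀ (by linarith) ?_ _
      have := Real.add_one_le_exp (-(p / 2))
      linarith
    refine h1.trans ?_
    rw [← Real.exp_nat_mul, Real.exp_le_exp]
    have h2 : (j : ℝ) / (2 * 2 ^ c) - 2 ≤ T.card := by
      have h3 : ((m : ℕ) : ℝ) - 1 ≤ T.card := by
        have : (m : ℝ) ≤ T.card + 1 := by exact_mod_cast (by omega : m ≤ T.card + 1)
        linarith
      have h4 : (j : ℝ) / (2 * 2 ^ c) - 1 ≤ m := by
        rw [hm, Nat.cast_min, le_min_iff]
        constructor
        · have h5 : (j : ℝ) ≤ ((j - 1 : ℕ) : ℝ) + 1 := by exact_mod_cast (by omega : j ≤ j - 1 + 1)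
          have h6 : (j : ℝ) / (2 * 2 ^ c) ≤ j := div_le_self (by positivity) (by linarith)
          linarith
        · have h5 : size p (r - 1) / 16 < b + 1 := Nat.lt_floor_add_one _
          have h6 : (j : ℝ) / (2 * 2 ^ c) ≤ size p (r - 1) / 16 := by
            rw [div_le_iff₀ (by positivity)]
            calc (j : ℝ) ≤ size p (r + c) / 16 := hnear
              _ = _ := by
                unfold size
                rw [show r + c = r - 1 + 1 + c by omega, pow_add, pow_add]
                ring
          push_cast
          linarith
      linarith
    have h3 : (j : ℝ) / (4 * 2 ^ c / p) = p / 2 * (j / (2 * 2 ^ c)) := by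
      field_simp
      ring
    rw [h3]
    nlinarith

end PathModel

end StochSort

/-! ### Expected cost of rebuilds and of incremental updates -/

namespace StochSort

open Classical in
/-- The vertex pairs that are not edges of the path `x 0, x 1, …, x (n - 1)`. -/
noncomputable def offPath {n : ℕ} (x : Equiv.Perm (Fin n)) : Finset (Sym2 (Fin n)) :=
  Finset.univ.filter fun e => e ∉ (hamPath x).edgeSet

theorem mem_offPath {n : ℕ} {x : Equiv.Perm (Fin n)} {u v : Fin n} :
    s(u, v) ∈ offPath x ↔ ¬ (hamPath x).Adj u v := by
  classical
  simp [offPath]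

/-- The expected number of pairs off the path that have the random property `Q`. -/
noncomputable def pairMass {n : ℕ} {Ω : Type*} [MeasurableSpace Ω] (μ : Measure Ω)
    (x : Equiv.Perm (Fin n)) (Q : Ω → Sym2 (Fin n) → Prop) : ℝ :=
  ∑ e ∈ offPath x, μ.real {ω | Q ω e}

/-- A union bound over a fixed family of configurations that can cause a pair to be compared.
Configurations whose pair lies on the path only need a nonnegative `B`. -/
theorem pairMass_le {n : ℕ} {Ω ι : Type*} [MeasurableSpace Ω] {μ : Measure Ω}
    [IsProbabilityMeasure μ] {x : Equiv.Perm (Fin n)} {Q : Ω → Sym2 (Fin n) → Prop}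
    (I : Finset ι) (f : ι → Sym2 (Fin n)) (A : ι → Ω → Prop) (B : ι → ℝ)
    (hQ : ∀ ω e, Q ω e → ∃ a ∈ I, e = f a ∧ A a ω) (hB0 : ∀ a ∈ I, 0 ≤ B a)
    (hB : ∀ a ∈ I, f a ∈ offPath x → μ.real {ω | A a ω} ≤ B a) :
    pairMass μ x Q ≤ ∑ a ∈ I, B a := by
  classical
  have h1 : ∀ e ∈ offPath x, μ.real {ω | Q ω e} ≤ ∑ a ∈ I, if f a = e then B a else 0 := by
    intro e he
    have h2 : {ω | Q ω e} ⊆ ⋃ a ∈ I.filter fun a => f a = e, {ω | A a ω} := by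
      intro ω hω
      obtain ⟨a, ha, rfl, hA⟩ := hQ ω e hω
      simp only [Set.mem_iUnion, Finset.mem_filter]
      exact ⟨a, ⟨ha, rfl⟩, hA⟩
    refine (measureReal_mono h2 (measure_ne_top _ _)).trans
      ((measureReal_biUnion_finset_le _ _).trans ?_)
    rw [← Finset.sum_filter]
    refine Finset.sum_le_sum fun a ha => ?_
    rw [Finset.mem_filter] at ha
    exact hB a ha.1 (ha.2 ▸ he)
  refine (Finset.sum_le_sum h1).trans ?_
  rw [Finset.sum_comm]
  refine Finset.sum_le_sum fun a ha => ?_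
  rw [Finset.sum_ite_eq]
  split_ifs
  · exact le_rfl
  · exact hB0 a ha

/-- The ordered pairs of vertices in positions at least `ℓ`. -/
def laterPairs {n : ℕ} (x : Equiv.Perm (Fin n)) (ℓ : ℕ) : Finset (Fin n × Fin n) :=
  Finset.univ.filter fun ab => ℓ ≤ pos x ab.1 ∧ pos x ab.1 < pos x ab.2

theorem mem_laterPairs {n : ℕ} {x : Equiv.Perm (Fin n)} {ℓ : ℕ} {ab : Fin n × Fin n} :
    ab ∈ laterPairs x ℓ ↔ ℓ ≤ pos x ab.1 ∧ pos x ab.1 < pos x ab.2 := by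
  simp [laterPairs]

theorem sum_laterPairs_le {n : ℕ} (x : Equiv.Perm (Fin n)) (ℓ : ℕ) {h : ℕ → ℝ}
    (hh : ∀ j, 0 ≤ h j) :
    ∑ ab ∈ laterPairs x ℓ, h (pos x ab.2 - ℓ) ≤ ∑ j ∈ Finset.range n, (j : ℝ) * h j := by
  refine le_trans ?_ (sum_pos_le x ℓ (fun j => (j : ℝ) * h j) fun j => by
    have := hh j
    positivity)
  rw [laterPairs, Finset.sum_filter, Fintype.sum_prod_type_right, Finset.sum_filter]
  refine Finset.sum_le_sum fun b _ => ?_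
  rw [← Finset.sum_filter]
  dsimp only
  rw [Finset.sum_const, nsmul_eq_mul]
  have h1 := card_pos_mem_Ico_le x ℓ (pos x b)
  have h2 := hh (pos x b - ℓ)
  split_ifs with hb
  · have h3 : ((Finset.univ.filter fun a => ℓ ≤ pos x a ∧ pos x a < pos x b).card : ℝ) ≤
        ((pos x b - ℓ : ℕ) : ℝ) := by exact_mod_cast h1
    gcongr
  · rw [show (Finset.univ.filter fun a => ℓ ≤ pos x a ∧ pos x a < pos x b).card = 0 by omega]
    simp

theorem sum_laterPairs_fst_le {n : ℕ} (x : Equiv.Perm (Fin n)) (ℓ : ℕ) {h : ℕ → ℝ}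
    (hh : ∀ j, 0 ≤ h j) :
    ∑ ab ∈ laterPairs x ℓ, (if pos x ab.1 = ℓ then h (pos x ab.2 - ℓ) else 0) ≤
      ∑ j ∈ Finset.range n, h j := by
  refine le_trans ?_ (sum_pos_le x ℓ h hh)
  rw [laterPairs, Finset.sum_filter, Fintype.sum_prod_type_right, Finset.sum_filter]
  refine Finset.sum_le_sum fun b _ => ?_
  simp only [← ite_and]
  rw [← Finset.sum_filter, Finset.sum_const, nsmul_eq_mul]
  have h2 := hh (pos x b - ℓ)
  have h1 : (Finset.univ.filter fun a =>
      (ℓ ≤ pos x a ∧ pos x a < pos x b) ∧ pos x a = ℓ).card ≤ 1 := by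
    rw [Finset.card_le_one]
    intro u hu v hv
    rw [Finset.mem_filter] at hu hv
    exact pos_injective x (hu.2.2.trans hv.2.2.symm)
  split_ifs with hb
  · have h3 : ((Finset.univ.filter fun a =>
      (ℓ ≤ pos x a ∧ pos x a < pos x b) ∧ pos x a = ℓ).card : ℝ) ≤ 1 := by exact_mod_cast h1
    nlinarith
  · rw [Finset.filter_eq_empty_iff.2 (by rintro a - ⟨h3, -⟩; omega)]
    simp

theorem size_pos {p : ℝ} (hp : 0 < p) (i : ℕ) : 0 < size p i := by unfold size; positivity

theorem one_le_size {p : ℝ} (hp : 0 < p) (hp1 : p ≤ 1) (i : ℕ) : 1 ≤ size p i := by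
  unfold size
  rw [le_div_iff₀ hp]
  have : (1 : ℝ) ≤ 2 ^ i := one_le_pow₀ (by norm_num)
  linarith

theorem size_add (p : ℝ) (i c : ℕ) : size p (i + c) = 2 ^ c * size p i := by
  unfold size
  rw [pow_add]
  ring

/-- The constant in the bound on the probability that a vertex is not blocked. -/
noncomputable def blockConst (c : ℕ) : ℝ := 16 * (2 ^ c) ^ 4

theorem blockConst_pos (c : ℕ) : 0 < blockConst c := by unfold blockConst; positivity

namespace PathModel

variable {n : ℕ} {Ω β : Type*} [MeasurableSpace Ω] {μ : Measure Ω} {Z : Sym2 (Fin n) → Ω → β}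
  {x : Equiv.Perm (Fin n)} {adj : Ω → Fin n → Fin n → Bool} {E : Ω → ℕ → Fin n → Fin n → Bool}
  {q : ℕ} {p : ℝ} {c ℓ : ℕ} {R : ℕ → ℕ}

variable [IsProbabilityMeasure μ] [DiscreteMeasurableSpace Ω]

/-- Only the later endpoint is required to be unblocked; the earlier one is the exceptional vertex
of `prob_unblocked_le`. A later endpoint at distance `j` has at most `j` partners, whence the weight
`j`. -/
theorem pairMass_rebuild_le (M : PathModel μ Z x adj E q p) (hc : 8 ≤ c)
    (hR : ∀ k, 1 ≤ k → k ≤ q → R k ≤ ℓ ∧ (ℓ : ℝ) - R k ≤ size p k / 32 + 2) {i : ℕ} (hi : 1 ≤ i)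
    (hiq : i ≤ q) :
    pairMass μ x (fun ω => RebuildPair x (E ω) q c R ℓ i) ≤
      2 / size p i * (blockConst c * ∑ j ∈ Finset.range n, (j : ℝ) * decay (size p (i + c)) j) := by
  have hp := M.p_pos
  have hs := size_pos hp i
  have hs1 := one_le_size hp M.p_le_one (i + c)
  have hC := blockConst_pos c
  refine (pairMass_le (laterPairs x ℓ) (fun ab => s(ab.1, ab.2))
    (fun ab ω => E ω i ab.1 ab.2 = true ∧ Unblocked x (E ω) q c R ℓ (i + c) ab.2)
    (fun ab => 2 / size p i * (blockConst c * decay (size p (i + c)) (pos x ab.2 - ℓ)))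
    ?_ ?_ ?_).trans ?_
  · rintro ω e ⟨u, v, rfl, h1, h2, h3, h4, h5⟩
    rcases lt_trichotomy (pos x u) (pos x v) with h | h | h
    · exact ⟨(u, v), mem_laterPairs.2 ⟨h2, h⟩, rfl, h1, h5⟩
    · rw [pos_injective x h] at h1
      exact absurd ((M.valid ω).sub _ _ _ h1) ((M.valid ω).irrefl v)
    · exact ⟨(v, u), mem_laterPairs.2 ⟨h3, h⟩, Sym2.eq_swap, M.E_symm ω i u v ▸ h1, h4⟩
  · intro ab _
    have := decay_nonneg hs1 (pos x ab.2 - ℓ)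
    positivity
  · rintro ⟨a, b⟩ hab hoff
    rw [mem_laterPairs] at hab
    rw [mem_offPath] at hoff
    simp only at hab hoff ⊢
    have hne : a ≠ b := by rintro rfl; omega
    refine (M.prob_unblocked_le hc (by omega : 1 ≤ i + c) hR (by omega) a (M.E_det i a b) ?_).trans
      ?_
    · intro t _ ht2 ht3
      rw [Set.disjoint_singleton_left]
      rintro (he | ⟨s, hs, he⟩) <;> rw [Sym2.eq_iff] at he <;>
        rcases he with ⟨h1, h2⟩ | ⟨h1, h2⟩ <;> subst_vars <;> omega
    · have h1 := M.E_le i a b hi hiq hne hoff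
      have h2 : 2 * p / 2 ^ i = 2 / size p i := by unfold size; field_simp
      rw [h2] at h1
      have := decay_nonneg hs1 (pos x b - ℓ)
      have h3 : 0 ≤ blockConst c * decay (size p (i + c)) (pos x b - ℓ) := by positivity
      exact mul_le_mul_of_nonneg_right h1 h3
  · rw [← Finset.mul_sum, ← Finset.mul_sum]
    have := sum_laterPairs_le x ℓ (h := decay (size p (i + c))) (decay_nonneg hs1)
    gcongr

theorem prob_advance_le (M : PathModel μ Z x adj E q p) (hc : 8 ≤ c)
    (hR : ∀ k, 1 ≤ k → k ≤ q → R k ≤ ℓ ∧ (ℓ : ℝ) - R k ≤ size p k / 32 + 2) {i : ℕ} (hi : 1 ≤ i)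
    (hiq : i ≤ q) {a b y v : Fin n} (ha : ℓ ≤ pos x a) (hab : pos x a < pos x b)
    (hoff : ¬ (hamPath x).Adj a b) (hy : pos x y + 1 = ℓ) (hv : v = a ∨ v = b) {w : ℝ}
    (hw : μ.real {ω | ∃ k, i ≤ k ∧ k ≤ q ∧ E ω k y v = true} ≤ w) :
    μ.real {ω | (∃ k, i ≤ k ∧ k ≤ q ∧ E ω k y v = true) ∧ E ω i a b = true ∧
      Unblocked x (E ω) q c R ℓ (i + c) b} ≤
      w * (2 / size p i) * (blockConst c * decay (size p (i + c)) (pos x b - ℓ)) := by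
  have hp := M.p_pos
  have hs := size_pos hp i
  have hs1 := one_le_size hp M.p_le_one (i + c)
  have hC := blockConst_pos c
  have hne : a ≠ b := by rintro rfl; omega
  have hdet : DeterminedBy Z {s(y, v)} fun ω => ∃ k, i ≤ k ∧ k ≤ q ∧ E ω k y v = true :=
    DeterminedBy.ex fun k => DeterminedBy.const_and fun _ => DeterminedBy.const_and fun _ =>
      M.E_det k y v
  have hF : DeterminedBy Z {s(y, v), s(a, b)} fun ω =>
      (∃ k, i ≤ k ∧ k ≤ q ∧ E ω k y v = true) ∧ E ω i a b = true :=
    (hdet.mono (by simp)).and ((M.E_det i a b).mono (by simp))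
  have h1 := M.prob_unblocked_le hc (by omega : 1 ≤ i + c) hR (by omega : ℓ ≤ pos x b) a hF
    (by
      intro t ht1 ht2 ht3
      have ht1' : ℓ < pos x t := by
        have h0 := size_pos hp (i + c + c)
        have : (ℓ : ℝ) < pos x t := by linarith
        exact_mod_cast this
      rw [Set.disjoint_left]
      rcases hv with rfl | rfl <;>
      rintro e (rfl | rfl) (he | ⟨s, hs, he⟩) <;> rw [Sym2.eq_iff] at he <;>
        rcases he with ⟨h1, h2⟩ | ⟨h1, h2⟩ <;> subst_vars <;> omega)
  simp only [and_assoc] at h1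
  refine h1.trans ?_
  have hdisj : Disjoint ({s(y, v)} : Set (Sym2 (Fin n))) {s(a, b)} := by
    rw [Set.disjoint_singleton]
    intro he
    rw [Sym2.eq_iff] at he
    rcases he with ⟨h1, h2⟩ | ⟨h1, h2⟩ <;> subst_vars <;> omega
  rw [M.indep _ _ _ _ hdisj hdet (M.E_det i a b)]
  have h2 := M.E_le i a b hi hiq hne hoff
  have h3 : 2 * p / 2 ^ i = 2 / size p i := by unfold size; field_simp
  rw [h3] at h2
  have := decay_nonneg hs1 (pos x b - ℓ)
  have h4 : 0 ≤ blockConst c * decay (size p (i + c)) (pos x b - ℓ) := by positivity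
  have hw0 : 0 ≤ w := measureReal_nonneg.trans hw
  refine mul_le_mul_of_nonneg_right ?_ h4
  exact mul_le_mul hw h2 measureReal_nonneg hw0

/-- The edge from the discovered vertex `y` has probability O(1/s_i), the compared edge O(1/s_i),
and effectively O(s_i²) pairs are in question: O(1) altogether. If the first edge is the path edge
from `y`, its probability is only bounded by a constant, but then one endpoint is fixed in position
`ℓ` and only O(s_i) pairs remain. -/
theorem pairMass_advance_le (M : PathModel μ Z x adj E q p) (hc : 8 ≤ c)
    (hR : ∀ k, 1 ≤ k → k ≤ q → R k ≤ ℓ ∧ (ℓ : ℝ) - R k ≤ size p k / 32 + 2) {i : ℕ} (hi : 1 ≤ i)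
    (hiq : i ≤ q) :
    pairMass μ x (fun ω => AdvancePair x (E ω) q c R ℓ i) ≤ 40 * blockConst c * (2 ^ c) ^ 2 := by
  have hp := M.p_pos
  have hs := size_pos hp i
  have hs1 := one_le_size hp M.p_le_one (i + c)
  have hC := blockConst_pos c
  by_cases hex : ∃ y, pos x y + 1 = ℓ
  swap
  · have h0 : pairMass μ x (fun ω => AdvancePair x (E ω) q c R ℓ i) = 0 := by
      refine Finset.sum_eq_zero fun e _ => ?_
      have : {ω | AdvancePair x (E ω) q c R ℓ i e} = ∅ := by
        ext ω
        simp only [Set.mem_ofPred_eq, Set.mem_empty_iff_false, iff_false]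
        rintro ⟨v, -, y, k, hy, -⟩
        exact hex ⟨y, hy⟩
      rw [this, measureReal_empty]
    rw [h0]
    positivity
  obtain ⟨y, hy⟩ := hex
  set g : ℕ → ℝ := fun j => blockConst c * decay (size p (i + c)) j with hg
  have hg0 : ∀ j, 0 ≤ g j := fun j => mul_nonneg hC.le (decay_nonneg hs1 j)
  refine (pairMass_le (laterPairs x ℓ) (fun ab => s(ab.1, ab.2))
    (fun ab ω => ((∃ k, i ≤ k ∧ k ≤ q ∧ E ω k y ab.1 = true) ∧ E ω i ab.1 ab.2 = true ∧
        Unblocked x (E ω) q c R ℓ (i + c) ab.2) ∨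
      ((∃ k, i ≤ k ∧ k ≤ q ∧ E ω k y ab.2 = true) ∧ E ω i ab.1 ab.2 = true ∧
        Unblocked x (E ω) q c R ℓ (i + c) ab.2))
    (fun ab => 16 / size p i ^ 2 * g (pos x ab.2 - ℓ) +
      4 / size p i * if pos x ab.1 = ℓ then g (pos x ab.2 - ℓ) else 0) ?_ ?_ ?_).trans ?_
  · rintro ω e ⟨v, ⟨u, rfl, h1, h2, h3, h4, h5⟩, y', k, h6, h7, h8, h9⟩
    obtain rfl : y' = y := pos_injective x (by omega)
    rcases lt_trichotomy (pos x u) (pos x v) with h | h | h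
    · exact ⟨(u, v), mem_laterPairs.2 ⟨h2, h⟩, rfl, Or.inr ⟨⟨k, h7, h8, h9⟩, h1, h5⟩⟩
    · rw [pos_injective x h] at h1
      exact absurd ((M.valid ω).sub _ _ _ h1) ((M.valid ω).irrefl v)
    · exact ⟨(v, u), mem_laterPairs.2 ⟨h3, h⟩, Sym2.eq_swap,
        Or.inl ⟨⟨k, h7, h8, h9⟩, M.E_symm ω i u v ▸ h1, h4⟩⟩
  · intro ab _
    have := hg0 (pos x ab.2 - ℓ)
    split_ifs <;> positivity
  · rintro ⟨a, b⟩ hab hoff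
    rw [mem_laterPairs] at hab
    rw [mem_offPath] at hoff
    simp only at hab hoff ⊢
    have hsz : 4 * p / 2 ^ i = 4 / size p i := by unfold size; field_simp
    have hb : μ.real {ω | ∃ k, i ≤ k ∧ k ≤ q ∧ E ω k y b = true} ≤ 4 / size p i := by
      rw [← hsz]
      exact M.prob_edge_ge_le hi (by rintro rfl; omega) (by rw [hamPath_adj]; omega)
    have ha : μ.real {ω | ∃ k, i ≤ k ∧ k ≤ q ∧ E ω k y a = true} ≤
        4 / size p i + if pos x a = ℓ then 2 else 0 := by
      split_ifs with h
      · have h1 := M.prob_path_edge_ge_le hi (u := y) (v := a) (by rintro rfl; omega)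
        have h2 : (4 : ℝ) / 2 ^ i ≤ 2 := by
          rw [div_le_iff₀ (by positivity)]
          have : (2 : ℝ) ^ 1 ≤ 2 ^ i := pow_le_pow_right₀ (by norm_num) hi
          linarith
        have h3 : 0 ≤ 4 / size p i := by positivity
        linarith
      · rw [add_zero, ← hsz]
        exact M.prob_edge_ge_le hi (by rintro rfl; omega) (by rw [hamPath_adj]; omega)
    have h1 := M.prob_advance_le hc hR hi hiq hab.1 hab.2 hoff hy (Or.inl rfl) ha
    have h2 := M.prob_advance_le hc hR hi hiq hab.1 hab.2 hoff hy (Or.inr rfl) hb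
    refine (measureReal_union_le _ _).trans ((add_le_add h1 h2).trans (le_of_eq ?_))
    simp only [hg]
    split_ifs
    · field_simp
      ring
    · field_simp
      ring
  · rw [Finset.sum_add_distrib]
    have h1 := sum_laterPairs_le x ℓ hg0
    have h2 := sum_laterPairs_fst_le x ℓ hg0
    have h3 : ∑ j ∈ Finset.range n, (j : ℝ) * g j ≤ blockConst c * (2 * size p (i + c) ^ 2) := by
      calc _ = blockConst c * ∑ j ∈ Finset.range n, (j : ℝ) * decay (size p (i + c)) j := by
            rw [Finset.mul_sum]
            exact Finset.sum_congr rfl fun j _ => by simp only [hg]; ring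
        _ ≤ _ := by
            have := sum_mul_decay_le hs1 n
            gcongr
    have h4 : ∑ j ∈ Finset.range n, g j ≤ blockConst c * (2 * size p (i + c)) := by
      rw [← Finset.mul_sum]
      have := sum_decay_le hs1 n
      gcongr
    have h5 : (1 : ℝ) ≤ 2 ^ c := one_le_pow₀ (by norm_num)
    calc _ ≤ 16 / size p i ^ 2 * (blockConst c * (2 * size p (i + c) ^ 2)) +
          4 / size p i * (blockConst c * (2 * size p (i + c))) := by
          refine add_le_add ?_ ?_
          · rw [← Finset.mul_sum]
            exact mul_le_mul_of_nonneg_left (h1.trans h3) (by positivity)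
          · rw [← Finset.mul_sum]
            exact mul_le_mul_of_nonneg_left (h2.trans h4) (by positivity)
      _ = blockConst c * (32 * (2 ^ c) ^ 2 + 8 * 2 ^ c) := by
          rw [size_add]
          field_simp
          ring
      _ ≤ blockConst c * (40 * (2 ^ c) ^ 2) := by
          gcongr
          nlinarith
      _ = _ := by ring

end PathModel

end StochSort

/-! ### The probability of a comparison during a search -/

namespace StochSort

/-- A bound on the probability that a candidate in position `ℓ + a` leads to a comparison with the
vertex in position `ℓ + b`, in round `r` of the search for the vertex in position `ℓ`. -/
noncomputable def searchBound (p : ℝ) (c r a b : ℕ) : ℝ :=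
  p ^ 2 * (if b < a then 216 * decay (4 * 2 ^ c / p) a + blockConst c * decay (size p 1) a else 0) +
  p ^ 2 * ((4 * p * a + 4) / 2 ^ (r - 1) * (216 * decay (4 * 2 ^ c / p) a) *
    (blockConst c * decay (size p r) b)) +
  p ^ 2 * (blockConst c * (4 * (size p 1 / size p r) ^ 2 *
    ((size p r / (size p r + a)) ^ 2 * (size p r / (size p r + b)) ^ 2)))

theorem one_le_candidateScale {p : ℝ} (hp : 0 < p) (hp1 : p ≤ 1) (c : ℕ) : 1 ≤ 4 * 2 ^ c / p := by
  have h2c : (1 : ℝ) ≤ 2 ^ c := one_le_pow₀ (by norm_num)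
  rw [le_div_iff₀ hp]
  linarith

theorem searchBound_terms_nonneg {p : ℝ} (hp : 0 < p) (hp1 : p ≤ 1) (c r a b : ℕ) :
    0 ≤ p ^ 2 * (if b < a then 216 * decay (4 * 2 ^ c / p) a + blockConst c * decay (size p 1) a
      else 0) ∧
    0 ≤ p ^ 2 * ((4 * p * a + 4) / 2 ^ (r - 1) * (216 * decay (4 * 2 ^ c / p) a) *
      (blockConst c * decay (size p r) b)) ∧
    0 ≤ p ^ 2 * (blockConst c * (4 * (size p 1 / size p r) ^ 2 *
      ((size p r / (size p r + a)) ^ 2 * (size p r / (size p r + b)) ^ 2))) := by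
  have h1 := decay_nonneg (one_le_candidateScale hp hp1 c) a
  have h2 := decay_nonneg (one_le_size hp hp1 1) a
  have h3 := decay_nonneg (one_le_size hp hp1 r) b
  have hC := blockConst_pos c
  refine ⟨?_, by positivity, by positivity⟩
  split_ifs <;> positivity

/-- Each bound decays in only one of the two distances. The inequality min(s^4, t^4) ≤ s² t² yields
a product that can be summed over both, and since `a` exceeds `size p r`, the decay in `a` can be
expressed at that scale. -/
theorem min_decay_le {p : ℝ} (hp : 0 < p) {c r a b : ℕ} (hc : 8 ≤ c)
    (ha : size p (r + c) / 16 < a) :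
    min (decay (size p 1) a) (decay (size p r) b) ≤ 4 * (size p 1 / size p r) ^ 2 *
      ((size p r / (size p r + a)) ^ 2 * (size p r / (size p r + b)) ^ 2) := by
  have hs := size_pos hp r
  have hs1 := size_pos hp 1
  have h2c : (2 : ℝ) ^ 8 ≤ 2 ^ c := pow_le_pow_right₀ (by norm_num) hc
  have hra : size p r ≤ a := by
    rw [size_add] at ha
    nlinarith
  have ha0 : (0 : ℝ) < a := hs.trans_le hra
  have h1 : size p 1 / (size p 1 + a) ≤
      2 * (size p 1 / size p r) * (size p r / (size p r + a)) := by
    have : 2 * (size p 1 / size p r) * (size p r / (size p r + a)) =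
        2 * size p 1 / (size p r + a) := by field_simp
    rw [this, div_le_div_iff₀ (by positivity) (by positivity)]
    nlinarith
  have h2 : 0 ≤ size p 1 / (size p 1 + a) := by positivity
  have h3 : 0 ≤ size p r / (size p r + b) := by positivity
  have h4 : min (decay (size p 1) a) (decay (size p r) b) ≤
      (size p 1 / (size p 1 + a)) ^ 2 * (size p r / (size p r + b)) ^ 2 := by
    unfold decay
    generalize size p 1 / (size p 1 + a) = s at *
    generalize size p r / (size p r + b) = t at *
    rcases le_total s t with h | h
    · refine (min_le_left _ _).trans ?_
      calc s ^ 4 = s ^ 2 * s ^ 2 := by ring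
        _ ≤ s ^ 2 * t ^ 2 := by gcongr
    · refine (min_le_right _ _).trans ?_
      calc t ^ 4 = t ^ 2 * t ^ 2 := by ring
        _ ≤ s ^ 2 * t ^ 2 := by gcongr
  refine h4.trans ?_
  calc _ ≤ (2 * (size p 1 / size p r) * (size p r / (size p r + a))) ^ 2 *
        (size p r / (size p r + b)) ^ 2 := by gcongr
    _ = _ := by ring

namespace PathModel

variable {n : ℕ} {Ω β : Type*} [MeasurableSpace Ω] {μ : Measure Ω} {Z : Sym2 (Fin n) → Ω → β}
  {x : Equiv.Perm (Fin n)} {adj : Ω → Fin n → Fin n → Bool} {E : Ω → ℕ → Fin n → Fin n → Bool}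
  {q : ℕ} {p : ℝ} {c ℓ : ℕ} {R : ℕ → ℕ}

theorem det_survives (M : PathModel μ Z x adj E q p) (r : ℕ) (y : Fin n) :
    DeterminedBy Z {e | ∃ s t, pos x s < pos x t ∧ pos x t ≤ pos x y ∧ e = s(s, t)}
      fun ω => Survives x (adj ω) (E ω) q ℓ r y := by
  refine DeterminedBy.const_imp fun _ => DeterminedBy.all fun u => DeterminedBy.const_imp fun _ =>
    DeterminedBy.const_imp fun hu => DeterminedBy.imp ((M.adj_det u y).mono ?_) ?_
  · rintro e rfl
    exact ⟨u, y, hu, le_rfl, rfl⟩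
  · have h1 := (M.det_exists_edge (r - 1) ℓ u).mono
      (T := {e | ∃ s t, pos x s < pos x t ∧ pos x t ≤ pos x y ∧ e = s(s, t)}) (by
        rintro e ⟨s, hs, rfl⟩
        exact ⟨s, u, hs, hu.le, rfl⟩)
    intro ω ω' hω
    have := h1 ω ω' hω
    simp only [tsub_le_iff_right] at this
    exact this

variable [IsProbabilityMeasure μ] [DiscreteMeasurableSpace Ω]

/-- The summands of `searchBound` cover three cases: `u` before the candidate `y`, where bounding
the event for `y` suffices; `u` after a near `y`, where the events for `y` and `u` concern disjoint
pairs; and `u` after a far `y`, where the minimum of two separate bounds is used. -/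
theorem prob_search_le (M : PathModel μ Z x adj E q p) (hc : 8 ≤ c)
    (hR : ∀ k, 1 ≤ k → k ≤ q → R k ≤ ℓ ∧ (ℓ : ℝ) - R k ≤ size p k / 32 + 2) {r : ℕ} (hr : 1 ≤ r)
    {y₀ y u z : Fin n} (hy₀ : pos x y₀ + 1 = ℓ) (hy : ℓ < pos x y) (hu : ℓ ≤ pos x u) (huy : u ≠ y)
    (hz : z = y ∨ pos x z = ℓ) (huz : u ≠ z) (hoff : ¬ (hamPath x).Adj u z) :
    μ.real {ω | (adj ω y₀ y = true ∧ adj ω u z = true) ∧ Unblocked x (E ω) q c R ℓ 1 y ∧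
      Survives x (adj ω) (E ω) q ℓ r y ∧ Unblocked x (E ω) q c R ℓ r u} ≤
      searchBound p c r (pos x y - ℓ) (pos x u - ℓ) := by
  have hp := M.p_pos
  have hp1 := M.p_le_one
  have hC := blockConst_pos c
  have hne : pos x u ≠ pos x y := fun h => huy (pos_injective x h)
  have hcast : ((pos x y - ℓ : ℕ) : ℝ) = (pos x y : ℝ) - ℓ := Nat.cast_sub hy.le
  obtain ⟨hT1, hT2, hT3⟩ := searchBound_terms_nonneg hp hp1 c r (pos x y - ℓ) (pos x u - ℓ)
  have hzlt : ℓ ≤ pos x z := by rcases hz with rfl | hz <;> omega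
  have hzy : pos x z ≤ pos x y := by rcases hz with rfl | hz <;> omega
  set F : Ω → Prop := fun ω => adj ω y₀ y = true ∧ adj ω u z = true with hFdef
  have hF : DeterminedBy Z {s(y₀, y), s(u, z)} F :=
    ((M.adj_det y₀ y).mono (by simp)).and ((M.adj_det u z).mono (by simp))
  have hPF : μ.real {ω | F ω} = p ^ 2 := by
    have hdisj : Disjoint ({s(y₀, y)} : Set (Sym2 (Fin n))) {s(u, z)} := by
      rw [Set.disjoint_singleton]
      intro he
      rw [Sym2.eq_iff] at he
      rcases he with ⟨h1, h2⟩ | ⟨h1, h2⟩ <;> subst_vars <;> omega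
    rw [M.indep _ _ _ _ hdisj (M.adj_det y₀ y) (M.adj_det u z),
      M.adj_eq u z huz hoff, M.adj_eq y₀ y (by rintro rfl; omega) (by rw [hamPath_adj]; omega)]
    ring
  have hmono : ∀ A : Ω → Prop, (∀ ω, F ω → Unblocked x (E ω) q c R ℓ 1 y →
      Survives x (adj ω) (E ω) q ℓ r y → Unblocked x (E ω) q c R ℓ r u → A ω) →
      μ.real {ω | F ω ∧ Unblocked x (E ω) q c R ℓ 1 y ∧
      Survives x (adj ω) (E ω) q ℓ r y ∧ Unblocked x (E ω) q c R ℓ r u} ≤ μ.real {ω | A ω} :=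
    fun A hA => measureReal_mono (fun ω hω => hA ω hω.1 hω.2.1 hω.2.2.1 hω.2.2.2)
      (measure_ne_top _ _)
  -- the candidate itself is in level `1`
  have hcand : μ.real {ω | F ω ∧ Unblocked x (E ω) q c R ℓ 1 y} ≤
      p ^ 2 * (blockConst c * decay (size p 1) (pos x y - ℓ)) := by
    rw [← hPF]
    refine M.prob_unblocked_le hc le_rfl hR hy.le u hF fun t ht1 ht2 ht3 => ?_
    have ht1' : ℓ < pos x t := by
      have h0 := size_pos hp (1 + c)
      have : (ℓ : ℝ) < pos x t := by linarith
      exact_mod_cast this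
    rw [Set.disjoint_left]
    rintro e (rfl | rfl) (he | ⟨s, hs, he⟩) <;> rw [Sym2.eq_iff] at he <;>
      rcases he with ⟨h1, h2⟩ | ⟨h1, h2⟩ <;> subst_vars <;>
      first | omega | exact absurd rfl ht3 | (rcases hz with rfl | hz <;> omega)
  -- The threshold makes near candidates precede all the vertices that are used to block `u` from
  -- level `r`.
  by_cases hnear : (pos x y : ℝ) - ℓ ≤ size p (r + c) / 16
  · have hsurv : ∀ {G : Ω → Prop} {S₀ : Set (Sym2 (Fin n))}, DeterminedBy Z S₀ G →
        (∀ t, ℓ ≤ pos x t → pos x t + 1 < pos x y → t ≠ u → Disjoint S₀ (blockingPairs x y t)) →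
        μ.real {ω | G ω ∧ Survives x (adj ω) (E ω) q ℓ r y} ≤
          μ.real {ω | G ω} * (216 * decay (4 * 2 ^ c / p) (pos x y - ℓ)) :=
      fun hG hS => M.prob_survives_le hy hnear u hG hS
    have hdF : ∀ t, ℓ ≤ pos x t → pos x t + 1 < pos x y → t ≠ u →
        Disjoint ({s(y₀, y), s(u, z)} : Set (Sym2 (Fin n))) (blockingPairs x y t) := by
      intro t ht1 ht2 ht3
      rw [Set.disjoint_left]
      rintro e (rfl | rfl) (he | ⟨s, hs, he⟩) <;> rw [Sym2.eq_iff] at he <;>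
        rcases he with ⟨h1, h2⟩ | ⟨h1, h2⟩ <;> subst_vars <;>
        first | omega | exact absurd rfl ht3 | (rcases hz with rfl | hz <;> omega)
    have hd0 := decay_nonneg (one_le_candidateScale hp hp1 c) (pos x y - ℓ)
    rcases lt_or_gt_of_ne hne with hlt | hgt
    · have h1 := (hmono _ fun ω h1 _ h2 _ => ⟨h1, h2⟩).trans (hsurv hF hdF)
      rw [hPF] at h1
      refine h1.trans ?_
      have h2 := decay_nonneg (one_le_size hp hp1 1) (pos x y - ℓ)
      have h3 : p ^ 2 * (216 * decay (4 * 2 ^ c / p) (pos x y - ℓ)) ≤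
          p ^ 2 * (if pos x u - ℓ < pos x y - ℓ then 216 * decay (4 * 2 ^ c / p) (pos x y - ℓ) +
            blockConst c * decay (size p 1) (pos x y - ℓ) else 0) := by
        rw [if_pos (by omega)]
        have : 0 ≤ blockConst c * decay (size p 1) (pos x y - ℓ) := by positivity
        gcongr
        linarith
      unfold searchBound
      linarith
    · have hbase : μ.real {ω | F ω ∧ Survives x (adj ω) (E ω) q ℓ r y} ≤
          p ^ 2 * ((4 * p * (pos x y - ℓ : ℕ) + 4) / 2 ^ (r - 1) *
            (216 * decay (4 * 2 ^ c / p) (pos x y - ℓ))) := by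
        by_cases hr2 : 2 ≤ r
        -- The path predecessor `y'` is always adjacent to `y`, so `y` survives only if an edge of
        -- some `E k` with `k ≥ r - 1` keeps `y'` out. The resulting factor 1 / 2^(r-1) compensates
        -- for the roughly `size p r` vertices `u` in level `r`.
        · obtain ⟨y', hy'⟩ := exists_pos_eq x (k := pos x y - 1) (by
            have := (x.symm y).isLt
            simp only [pos]
            omega)
          set B : Ω → Prop := fun ω => ∃ k' s, r - 1 ≤ k' ∧ k' ≤ q ∧ ℓ ≤ pos x s ∧
            pos x s < pos x y' ∧ E ω k' s y' = true with hB
          have hBdet : DeterminedBy Z (earlierPairs x y') B := M.det_exists_edge (r - 1) ℓ y'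
          have hPB := M.prob_exists_edge_le (k := r - 1) (by omega) y' (a := ℓ) (by omega)
          have hdisj : Disjoint ({s(y₀, y), s(u, z)} : Set (Sym2 (Fin n))) (earlierPairs x y') := by
            rw [Set.disjoint_left]
            rintro e (rfl | rfl) ⟨s, hs, he⟩ <;> rw [Sym2.eq_iff] at he <;>
              rcases he with ⟨h1, h2⟩ | ⟨h1, h2⟩ <;> subst_vars <;> omega
          have h1 := hsurv (G := fun ω => F ω ∧ B ω)
            (S₀ := {s(y₀, y), s(u, z)} ∪ earlierPairs x y')
            ((hF.mono Set.subset_union_left).and (hBdet.mono Set.subset_union_right)) (by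
              intro t ht1 ht2 ht3
              rw [Set.disjoint_union_left]
              refine ⟨hdF t ht1 ht2 ht3, ?_⟩
              rw [Set.disjoint_left]
              rintro e ⟨s', hs', rfl⟩ (he | ⟨s, hs, he⟩) <;> rw [Sym2.eq_iff] at he <;>
                rcases he with ⟨h1, h2⟩ | ⟨h1, h2⟩ <;> subst_vars <;> omega)
          rw [M.indep _ _ _ _ hdisj hF hBdet, hPF] at h1
          have hsub : {ω | F ω ∧ Survives x (adj ω) (E ω) q ℓ r y} ⊆
              {ω | (F ω ∧ B ω) ∧ Survives x (adj ω) (E ω) q ℓ r y} := by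
            rintro ω ⟨h2, h3⟩
            refine ⟨⟨h2, ?_⟩, h3⟩
            obtain ⟨k, s, h5, h6, h7, h8, h9⟩ := h3 hr2 y' (by omega) (by omega)
              ((M.valid ω).path _ _ (by omega))
            exact ⟨k, s, by omega, h6, h7, h8, h9⟩
          refine (measureReal_mono hsub (measure_ne_top _ _)).trans (h1.trans ?_)
          rw [mul_assoc]
          have h2 : (4 * p * ((pos x y' : ℝ) - ℓ) + 4) / 2 ^ (r - 1) ≤
              (4 * p * (pos x y - ℓ : ℕ) + 4) / 2 ^ (r - 1) := by
            have : (pos x y' : ℝ) ≤ pos x y := by exact_mod_cast (by omega : pos x y' ≤ pos x y)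
            rw [hcast]
            gcongr
          gcongr
          exact hPB.trans h2
        · have h1 := hsurv hF hdF
          rw [hPF] at h1
          refine h1.trans ?_
          have h2 : 1 ≤ (4 * p * (pos x y - ℓ : ℕ) + 4) / 2 ^ (r - 1) := by
            rw [show r - 1 = 0 by omega, pow_zero, div_one]
            have : 0 ≤ 4 * p * (pos x y - ℓ : ℕ) := by positivity
            linarith
          exact mul_le_mul_of_nonneg_left (le_mul_of_one_le_left (by positivity) h2) (by positivity)
      have h1 := M.prob_unblocked_le hc hr hR hu y
        (F := fun ω => F ω ∧ Survives x (adj ω) (E ω) q ℓ r y)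
        ((hF.mono Set.subset_union_left).and ((M.det_survives r y).mono Set.subset_union_right)) (by
          intro t ht1 ht2 ht3
          have ht : pos x y < pos x t := by
            have : (pos x y : ℝ) < pos x t := by linarith
            exact_mod_cast this
          rw [Set.disjoint_left]
          rintro e ((rfl | rfl) | ⟨s', t', hs', ht', rfl⟩) (he | ⟨s, hs, he⟩) <;>
            rw [Sym2.eq_iff] at he <;> rcases he with ⟨h1, h2⟩ | ⟨h1, h2⟩ <;> subst_vars <;> omega)
      have h2 := decay_nonneg (one_le_size hp hp1 r) (pos x u - ℓ)
      have h3 := (hmono _ fun ω h1 _ h2 h3 => ⟨⟨h1, h2⟩, h3⟩).trans (h1.trans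
        (mul_le_mul_of_nonneg_right hbase (by positivity)))
      refine h3.trans ?_
      unfold searchBound
      unfold blockConst at *
      rw [mul_assoc]
      linarith
  · push Not at hnear
    rw [← hcast] at hnear
    have h1 := (hmono _ fun ω h1 h2 _ _ => ⟨h1, h2⟩).trans hcand
    rcases lt_or_gt_of_ne hne with hlt | hgt
    · refine h1.trans ?_
      have h2 := decay_nonneg (one_le_candidateScale hp hp1 c) (pos x y - ℓ)
      have h3 : p ^ 2 * (blockConst c * decay (size p 1) (pos x y - ℓ)) ≤
          p ^ 2 * (if pos x u - ℓ < pos x y - ℓ then 216 * decay (4 * 2 ^ c / p) (pos x y - ℓ) +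
            blockConst c * decay (size p 1) (pos x y - ℓ) else 0) := by
        rw [if_pos (by omega)]
        gcongr
        linarith
      unfold searchBound
      linarith
    · have h2 : μ.real {ω | F ω ∧ Unblocked x (E ω) q c R ℓ r u} ≤
          p ^ 2 * (blockConst c * decay (size p r) (pos x u - ℓ)) := by
        rw [← hPF]
        refine M.prob_unblocked_le hc hr hR hu y hF fun t ht1 ht2 ht3 => ?_
        have ht1' : ℓ < pos x t := by
          have h0 := size_pos hp (r + c)
          have : (ℓ : ℝ) < pos x t := by linarith
          exact_mod_cast this
        rw [Set.disjoint_left]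
        rintro e (rfl | rfl) (he | ⟨s, hs, he⟩) <;> rw [Sym2.eq_iff] at he <;>
          rcases he with ⟨h1, h2⟩ | ⟨h1, h2⟩ <;> subst_vars <;> omega
      have h3 := (hmono _ fun ω h1 _ _ h2 => ⟨h1, h2⟩).trans h2
      have h4 := le_min h1 h3
      rw [← mul_min_of_nonneg _ _ (by positivity), ← mul_min_of_nonneg _ _ hC.le] at h4
      have h5 := min_decay_le hp hc hnear (b := pos x u - ℓ)
      refine h4.trans ((mul_le_mul_of_nonneg_left (mul_le_mul_of_nonneg_left h5 hC.le)
        (by positivity)).trans ?_)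
      unfold searchBound
      linarith

end PathModel

end StochSort

/-! ### Expected cost of a search round -/

namespace StochSort

theorem sum_sum_pos_le {n : ℕ} (x : Equiv.Perm (Fin n)) (ℓ : ℕ) (G : ℕ → ℕ → ℝ)
    (hG : ∀ a b, 0 ≤ G a b) :
    ∑ y ∈ Finset.univ.filter (fun v => ℓ ≤ pos x v),
      ∑ u ∈ Finset.univ.filter (fun v => ℓ ≤ pos x v), G (pos x y - ℓ) (pos x u - ℓ) ≤
      ∑ a ∈ Finset.range n, ∑ b ∈ Finset.range n, G a b :=
  (Finset.sum_le_sum fun y _ => sum_pos_le x ℓ (G (pos x y - ℓ)) (hG _)).trans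
    (sum_pos_le x ℓ (fun a => ∑ b ∈ Finset.range n, G a b) fun a =>
      Finset.sum_nonneg fun b _ => hG a b)

/-- The constant in the bound on the cost of one round of a search. -/
noncomputable def searchConst (c : ℕ) : ℝ :=
  6912 * (2 ^ c) ^ 2 + 72 * blockConst c + 138240 * (2 ^ c) ^ 2 * blockConst c

theorem searchConst_pos (c : ℕ) : 0 < searchConst c := by
  have := blockConst_pos c
  unfold searchConst
  positivity

theorem searchBound_nonneg {p : ℝ} (hp : 0 < p) (hp1 : p ≤ 1) (c r a b : ℕ) :
    0 ≤ searchBound p c r a b := by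
  obtain ⟨h1, h2, h3⟩ := searchBound_terms_nonneg hp hp1 c r a b
  unfold searchBound
  linarith

/-- Up to constants depending on `c`, the three sums are p² (1/p)², then p² · 2^(-r) · (1/p) · s_r,
and p² (s_1/s_r)² s_r². In each of them `r` cancels. -/
theorem sum_sum_searchBound_le {p : ℝ} (hp : 0 < p) (hp1 : p ≤ 1) (c : ℕ) {r : ℕ} (hr : 1 ≤ r)
    (n : ℕ) :
    ∑ a ∈ Finset.range n, ∑ b ∈ Finset.range n, searchBound p c r a b ≤ searchConst c := by
  have hC := blockConst_pos c
  have h2c : (1 : ℝ) ≤ 2 ^ c := one_le_pow₀ (by norm_num)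
  have hσ := one_le_candidateScale hp hp1 c
  have hs1 := one_le_size hp hp1 1
  have hsr := one_le_size hp hp1 r
  have hsr0 := size_pos hp r
  have hs10 := size_pos hp 1
  have hpos : ∀ a : ℕ, 0 ≤ decay (4 * 2 ^ c / p) a := decay_nonneg hσ
  simp only [searchBound, Finset.sum_add_distrib, ← Finset.mul_sum]
  have e1 : p ^ 2 * ∑ a ∈ Finset.range n, ∑ b ∈ Finset.range n, (if b < a then
      216 * decay (4 * 2 ^ c / p) a + blockConst c * decay (size p 1) a else 0) ≤
      6912 * (2 ^ c) ^ 2 + 8 * blockConst c := by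
    have h1 : ∀ a ∈ Finset.range n, ∑ b ∈ Finset.range n, (if b < a then
        216 * decay (4 * 2 ^ c / p) a + blockConst c * decay (size p 1) a else 0) =
        216 * (a * decay (4 * 2 ^ c / p) a) + blockConst c * (a * decay (size p 1) a) := by
      intro a ha
      rw [Finset.mem_range] at ha
      rw [← Finset.sum_filter, Finset.sum_const, nsmul_eq_mul,
        show (Finset.range n).filter (fun b => b < a) = Finset.range a by ext b; simp; omega,
        Finset.card_range]
      ring
    rw [Finset.sum_congr rfl h1, Finset.sum_add_distrib, ← Finset.mul_sum, ← Finset.mul_sum]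
    have h2 := sum_mul_decay_le hσ n
    have h3 := sum_mul_decay_le hs1 n
    calc _ ≤ p ^ 2 * (216 * (2 * (4 * 2 ^ c / p) ^ 2) + blockConst c * (2 * size p 1 ^ 2)) := by
          gcongr
      _ = _ := by
          unfold size
          field_simp
          ring
  have e2 : p ^ 2 * ∑ a ∈ Finset.range n, (4 * p * a + 4) / 2 ^ (r - 1) *
      (216 * decay (4 * 2 ^ c / p) a) * (blockConst c * ∑ b ∈ Finset.range n, decay (size p r) b) ≤
      138240 * (2 ^ c) ^ 2 * blockConst c := by
    rw [← Finset.sum_mul]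
    have h1 : ∑ a ∈ Finset.range n, (4 * p * a + 4) / 2 ^ (r - 1) *
        (216 * decay (4 * 2 ^ c / p) a) = 864 / 2 ^ (r - 1) *
        (p * ∑ a ∈ Finset.range n, a * decay (4 * 2 ^ c / p) a +
          ∑ a ∈ Finset.range n, decay (4 * 2 ^ c / p) a) := by
      rw [Finset.mul_sum, ← Finset.sum_add_distrib, Finset.mul_sum]
      exact Finset.sum_congr rfl fun a _ => by ring
    have h2 := sum_mul_decay_le hσ n
    have h3 := sum_decay_le hσ n
    have h4 := sum_decay_le hsr n
    have h5 : 0 ≤ ∑ b ∈ Finset.range n, decay (size p r) b :=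
      Finset.sum_nonneg fun b _ => decay_nonneg hsr b
    rw [h1]
    obtain ⟨r, rfl⟩ : ∃ r', r = r' + 1 := ⟨r - 1, by omega⟩
    rw [Nat.add_sub_cancel]
    calc _ ≤ p ^ 2 * (864 / 2 ^ r * (p * (2 * (4 * 2 ^ c / p) ^ 2) + 2 * (4 * 2 ^ c / p)) *
          (blockConst c * (2 * size p (r + 1)))) := by gcongr
      _ = 864 * blockConst c * 4 * (32 * (2 ^ c) ^ 2 + 8 * 2 ^ c) := by
          unfold size
          rw [pow_succ]
          field_simp
          ring
      _ ≤ 864 * blockConst c * 4 * (32 * (2 ^ c) ^ 2 + 8 * (2 ^ c) ^ 2) := by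
          gcongr
          nlinarith
      _ = _ := by ring
  have e3 : p ^ 2 * (blockConst c * (4 * (size p 1 / size p r) ^ 2 *
      ∑ a ∈ Finset.range n, (size p r / (size p r + a)) ^ 2 *
        ∑ b ∈ Finset.range n, (size p r / (size p r + b)) ^ 2)) ≤ 64 * blockConst c := by
    rw [← Finset.sum_mul]
    have h1 := sum_ratio_sq_le hsr n
    have h2 : 0 ≤ ∑ b ∈ Finset.range n, (size p r / (size p r + b)) ^ 2 :=
      Finset.sum_nonneg fun b _ => by positivity
    calc _ ≤ p ^ 2 * (blockConst c * (4 * (size p 1 / size p r) ^ 2 *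
          ((2 * size p r) * (2 * size p r)))) := by gcongr
      _ = _ := by
          rw [div_pow]
          field_simp
          unfold size
          field_simp
          norm_num
  unfold searchConst
  linarith

namespace PathModel

variable {n : ℕ} {Ω β : Type*} [MeasurableSpace Ω] {μ : Measure Ω} {Z : Sym2 (Fin n) → Ω → β}
  {x : Equiv.Perm (Fin n)} {adj : Ω → Fin n → Fin n → Bool} {E : Ω → ℕ → Fin n → Fin n → Bool}
  {q : ℕ} {p : ℝ} {c ℓ : ℕ} {R : ℕ → ℕ}

variable [IsProbabilityMeasure μ] [DiscreteMeasurableSpace Ω]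

theorem pairMass_search_le (M : PathModel μ Z x adj E q p) (hc : 8 ≤ c)
    (hR : ∀ k, 1 ≤ k → k ≤ q → R k ≤ ℓ ∧ (ℓ : ℝ) - R k ≤ size p k / 32 + 2) {r : ℕ} (hr : 1 ≤ r) :
    pairMass μ x (fun ω => SearchPair x (adj ω) (E ω) q c R ℓ r) ≤ 2 * searchConst c := by
  have hp := M.p_pos
  have hp1 := M.p_le_one
  have hC := searchConst_pos c
  by_cases hex : ∃ y₀ z₀, pos x y₀ + 1 = ℓ ∧ pos x z₀ = ℓ
  swap
  · have h0 : pairMass μ x (fun ω => SearchPair x (adj ω) (E ω) q c R ℓ r) = 0 := by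
      refine Finset.sum_eq_zero fun e _ => ?_
      have : {ω | SearchPair x (adj ω) (E ω) q c R ℓ r e} = ∅ := by
        ext ω
        simp only [Set.mem_ofPred_eq, Set.mem_empty_iff_false, iff_false]
        rintro ⟨y, hy, ⟨y₀, hy₀, -⟩, -⟩
        obtain ⟨z₀, hz₀⟩ := exists_pos_eq x (k := ℓ) (hy.trans (pos_lt x y))
        exact hex ⟨y₀, z₀, hy₀, hz₀⟩
      rw [this, measureReal_empty]
    rw [h0]
    positivity
  obtain ⟨y₀, z₀, hy₀, hz₀⟩ := hex
  set V := Finset.univ.filter fun v => ℓ ≤ pos x v with hV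
  -- The third entry of a triple is only a tag: `y₀` means that the comparison is with the candidate
  -- itself, `z₀` that it is with the vertex in position `ℓ`.
  refine (pairMass_le
    ((V ×ˢ (V ×ˢ {y₀, z₀}) : Finset (Fin n × Fin n × Fin n)).filter fun a =>
      ℓ < pos x a.1 ∧ a.2.1 ≠ a.1 ∧ a.2.1 ≠ (if a.2.2 = y₀ then a.1 else z₀))
    (fun a => s(a.2.1, if a.2.2 = y₀ then a.1 else z₀))
    (fun a ω => (adj ω y₀ a.1 = true ∧ adj ω a.2.1 (if a.2.2 = y₀ then a.1 else z₀) = true) ∧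
      Unblocked x (E ω) q c R ℓ 1 a.1 ∧ Survives x (adj ω) (E ω) q ℓ r a.1 ∧
      Unblocked x (E ω) q c R ℓ r a.2.1)
    (fun a => searchBound p c r (pos x a.1 - ℓ) (pos x a.2.1 - ℓ)) ?_ ?_ ?_).trans ?_
  · rintro ω e ⟨y, hy, ⟨y', hy', h1⟩, h2, h3, u, z, rfl, hz, huy, h4, hu, h5⟩
    obtain rfl : y' = y₀ := pos_injective x (by omega)
    have huz : u ≠ z := by
      rintro rfl
      exact (M.valid ω).irrefl u h4
    have hne : z₀ ≠ y' := by rintro rfl; omega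
    rcases hz with rfl | hz
    · refine ⟨(z, u, y'), ?_, by simp, ⟨h1, by simpa using h4⟩, h2, h3, h5⟩
      simp [hV, hy, hy.le, hu, huy]
    · obtain rfl : z = z₀ := pos_injective x (by omega)
      refine ⟨(y, u, z), ?_, by simp [hne], ⟨h1, by simpa [hne] using h4⟩, h2, h3, h5⟩
      simp [hV, hy, hy.le, hu, huy, hne, huz]
  · exact fun a _ => searchBound_nonneg hp hp1 c r _ _
  · rintro ⟨y, u, w⟩ ha hoff
    simp only [Finset.mem_filter, Finset.mem_product, hV, Finset.mem_univ, true_and] at ha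
    obtain ⟨⟨-, hu, -⟩, hy, huy, huz⟩ := ha
    refine M.prob_search_le hc hR hr hy₀ hy hu huy ?_ huz (mem_offPath.1 hoff)
    split_ifs
    · exact Or.inl rfl
    · exact Or.inr hz₀
  · refine (Finset.sum_le_sum_of_subset_of_nonneg (Finset.filter_subset _ _) fun a _ _ =>
      searchBound_nonneg hp hp1 c r _ _).trans ?_
    rw [Finset.sum_product]
    simp only [Finset.sum_product, Finset.sum_const, nsmul_eq_mul, ← Finset.mul_sum]
    have h1 : ((({y₀, z₀} : Finset (Fin n)).card : ℕ) : ℝ) ≤ 2 := by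
      exact_mod_cast Finset.card_le_two
    have h2 := (sum_sum_pos_le x ℓ _ (searchBound_nonneg hp hp1 c r)).trans
      (sum_sum_searchBound_le hp hp1 c hr n)
    exact mul_le_mul h1 h2 (Finset.sum_nonneg fun a _ => Finset.sum_nonneg fun b _ =>
      searchBound_nonneg hp hp1 c r _ _) (by norm_num)

end PathModel

end StochSort

/-! ### The total expected cost -/

namespace StochSort

section pairMass

variable {n : ℕ} {Ω : Type*} [MeasurableSpace Ω] {μ : Measure Ω} {x : Equiv.Perm (Fin n)}

theorem pairMass_or_le (Q Q' : Ω → Sym2 (Fin n) → Prop) :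
    pairMass μ x (fun ω e => Q ω e ∨ Q' ω e) ≤ pairMass μ x Q + pairMass μ x Q' := by
  unfold pairMass
  rw [← Finset.sum_add_distrib]
  exact Finset.sum_le_sum fun e _ => measureReal_union_le _ _

variable [IsProbabilityMeasure μ]

theorem pairMass_mono {Q Q' : Ω → Sym2 (Fin n) → Prop} (h : ∀ ω e, Q ω e → Q' ω e) :
    pairMass μ x Q ≤ pairMass μ x Q' :=
  Finset.sum_le_sum fun e _ => measureReal_mono (fun ω => h ω e) (measure_ne_top _ _)

theorem pairMass_exists_le {ι : Type*} (I : Finset ι) (Q : ι → Ω → Sym2 (Fin n) → Prop) :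
    pairMass μ x (fun ω e => ∃ a ∈ I, Q a ω e) ≤ ∑ a ∈ I, pairMass μ x (Q a) := by
  unfold pairMass
  rw [Finset.sum_comm]
  refine Finset.sum_le_sum fun e _ => ?_
  refine (measureReal_mono (fun ω hω => ?_) (measure_ne_top _ _)).trans
    (measureReal_biUnion_finset_le I fun a => {ω | Q a ω e})
  obtain ⟨a, ha, h⟩ := hω
  simp only [Set.mem_iUnion]
  exact ⟨a, ha, h⟩

theorem card_compl_offPath_le (x : Equiv.Perm (Fin n)) : (offPath x)ᶜ.card ≤ n := by
  classical
  have h : (offPath x)ᶜ ⊆ (Finset.univ.filter fun uv : Fin n × Fin n =>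
      pos x uv.1 + 1 = pos x uv.2).image fun uv => s(uv.1, uv.2) := by
    intro e
    induction e using Sym2.ind with
    | _ u v =>
      rw [Finset.mem_compl, mem_offPath, not_not, hamPath_adj, Finset.mem_image]
      rintro (h | h)
      · exact ⟨(u, v), by simpa using h, rfl⟩
      · exact ⟨(v, u), by simpa using h, Sym2.eq_swap⟩
  refine (Finset.card_le_card h).trans (Finset.card_image_le.trans ?_)
  conv_rhs => rw [← Fintype.card_fin n, ← Finset.card_univ]
  refine Finset.card_le_card_of_injOn (fun uv => uv.1) (fun _ _ => Finset.mem_univ _) ?_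
  rintro ⟨u, v⟩ h1 ⟨u', v'⟩ h2 (rfl : u = u')
  simp only [Finset.coe_filter, Finset.mem_univ, true_and, Set.mem_ofPred_eq] at h1 h2
  rw [pos_injective x (h1.symm.trans h2)]

/-- The pairs in `F` and the edges of the path are counted with certainty; only the remaining pairs
are estimated by expectation. -/
theorem integral_card_le [Finite Ω] [MeasurableSingletonClass Ω] (A : Ω → Finset (Sym2 (Fin n)))
    (Q : Ω → Sym2 (Fin n) → Prop) {N : ℕ}
    (hA : ∀ ω, ∃ F : Finset (Sym2 (Fin n)), F.card ≤ N ∧ ∀ e ∈ A ω, e ∈ F ∨ Q ω e) :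
    ∫ ω, ((A ω).card : ℝ) ∂μ ≤ N + n + pairMass μ x Q := by
  classical
  have hpt : ∀ ω, ((A ω).card : ℝ) ≤
      N + n + ∑ e ∈ offPath x, {ω | Q ω e}.indicator (1 : Ω → ℝ) ω := by
    intro ω
    obtain ⟨F, hF, h⟩ := hA ω
    have hsub : A ω ⊆ F ∪ (offPath x)ᶜ ∪ (offPath x).filter fun e => Q ω e := by
      intro e he
      simp only [Finset.mem_union, Finset.mem_compl, Finset.mem_filter]
      have := h e he
      tauto
    have h1 : (A ω).card ≤ N + n + ((offPath x).filter fun e => Q ω e).card :=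
      (Finset.card_le_card hsub).trans ((Finset.card_union_le _ _).trans
        (add_le_add ((Finset.card_union_le _ _).trans
          (add_le_add hF (card_compl_offPath_le x))) le_rfl))
    have h2 : ∑ e ∈ offPath x, {ω | Q ω e}.indicator (1 : Ω → ℝ) ω =
        (((offPath x).filter fun e => Q ω e).card : ℝ) := by
      rw [Finset.card_filter]
      push_cast
      exact Finset.sum_congr rfl fun e _ => by simp [Set.indicator_apply]
    rw [h2]
    exact_mod_cast h1
  refine (integral_mono (Integrable.of_finite) (Integrable.of_finite) hpt).trans (le_of_eq ?_)
  rw [integral_add (Integrable.of_finite) (Integrable.of_finite),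
    integral_finsetSum _ fun e _ => Integrable.of_finite]
  simp only [integral_const, probReal_univ, smul_eq_mul, one_mul, pairMass]
  congr 1
  exact Finset.sum_congr rfl fun e _ => integral_indicator_one (Set.toFinite _).measurableSet

end pairMass

/-- The constant in the bound on the expected number of comparisons. -/
noncomputable def totalConst (c : ℕ) : ℝ := 172 * (blockConst c * (2 ^ c) ^ 2) + 2 * searchConst c

theorem totalConst_pos (c : ℕ) : 0 < totalConst c := by
  have := blockConst_pos c
  have := searchConst_pos c
  unfold totalConst
  positivity

namespace PathModel

variable {n : ℕ} {Ω β : Type*} [MeasurableSpace Ω] {μ : Measure Ω} {Z : Sym2 (Fin n) → Ω → β}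
  {x : Equiv.Perm (Fin n)} {adj : Ω → Fin n → Fin n → Bool} {E : Ω → ℕ → Fin n → Fin n → Bool}
  {q c : ℕ}

/-- The reversed order has the same path, and the probabilistic conditions refer to unordered pairs
and to that path only. -/
theorem reverse {p : ℝ} (M : PathModel μ Z x adj E q p) :
    PathModel μ Z (reverseOrder x) adj E q p where
  p_pos := M.p_pos
  p_le_one := M.p_le_one
  n_le := M.n_le
  valid := fun ω => (M.valid ω).reverse
  E_symm := M.E_symm
  indep := M.indep
  adj_det := M.adj_det
  E_det := M.E_det
  adj_eq := by rw [hamPath_reverseOrder]; exact M.adj_eq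
  E_le := by rw [hamPath_reverseOrder]; exact M.E_le
  E_le' := M.E_le'
  le_E := M.le_E

variable [IsProbabilityMeasure μ] [DiscreteMeasurableSpace Ω] {p : unitInterval}

theorem pairMass_comparedAt_le (M : PathModel μ Z x adj E q p) (hc : 8 ≤ c) (ℓ : ℕ) :
    pairMass μ x (fun ω => ComparedAt x (adj ω) (E ω) q c (schedule q p) ℓ) ≤
      ∑ i ∈ (Finset.Icc 1 q).filter (fun i => ℓ = 0 ∨ i ≤ schedule q p ℓ),
        4 * (blockConst c * (2 ^ c) ^ 2) * min (size p i) n +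
      (q + 1) * (40 * (blockConst c * (2 ^ c) ^ 2) + 2 * searchConst c) := by
  have hp := M.p_pos
  have hC := blockConst_pos c
  have hS := searchConst_pos c
  have h2c : (1 : ℝ) ≤ 2 ^ c := one_le_pow₀ (by norm_num)
  set R : ℕ → ℕ := fun k => lastRebuild (schedule q p) k (ℓ - 1) with hRdef
  have hR : ∀ k, 1 ≤ k → k ≤ q → R k ≤ ℓ ∧ (ℓ : ℝ) - R k ≤ size p k / 32 + 2 := by
    intro k hk hkq
    refine ⟨(lastRebuild_le _ _ _).trans (Nat.sub_le _ _), ?_⟩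
    exact sub_lastRebuild_le (show (0 : unitInterval) < p from hp) hk hkq ℓ
  have h1 : pairMass μ x (fun ω => ComparedAt x (adj ω) (E ω) q c (schedule q p) ℓ) ≤
      pairMass μ x (fun ω e => (∃ i ∈ (Finset.Icc 1 q).filter
          (fun i => ℓ = 0 ∨ i ≤ schedule q p ℓ), RebuildPair x (E ω) q c R ℓ i e) ∨
        ((∃ i ∈ Finset.Icc 1 q, AdvancePair x (E ω) q c R ℓ i e) ∨
        ∃ r ∈ Finset.Icc 1 (q + 1), SearchPair x (adj ω) (E ω) q c R ℓ r e)) := by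
    refine pairMass_mono fun ω e h => ?_
    rcases h with ⟨i, h1, h2, h3, h4⟩ | ⟨i, h1, h2, h3⟩ | ⟨r, h1, h2, h3⟩
    · exact Or.inl ⟨i, by simp [h1, h2, h3], h4⟩
    · exact Or.inr (Or.inl ⟨i, by simp [h1, h2], h3⟩)
    · exact Or.inr (Or.inr ⟨r, by simp [h1, h2], h3⟩)
  refine h1.trans ((pairMass_or_le _ _).trans (add_le_add ?_ ?_))
  · refine (pairMass_exists_le _ _).trans (Finset.sum_le_sum fun i hi => ?_)
    simp only [Finset.mem_filter, Finset.mem_Icc] at hi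
    have hs1 := one_le_size hp M.p_le_one (i + c)
    have hs := size_pos hp i
    refine (M.pairMass_rebuild_le hc hR hi.1.1 hi.1.2).trans ?_
    rw [mul_min_of_nonneg _ _ (by positivity)]
    refine le_min ?_ ?_
    · have := sum_mul_decay_le hs1 n
      calc _ ≤ 2 / size p i * (blockConst c * (2 * size p (i + c) ^ 2)) := by gcongr
        _ = _ := by
          rw [size_add]
          field_simp
          ring
    · have := sum_mul_decay_le' hs1 n
      calc _ ≤ 2 / size p i * (blockConst c * (n * (2 * size p (i + c)))) := by gcongr
        _ = 4 * (blockConst c * 2 ^ c) * n := by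
          rw [size_add]
          field_simp
          ring
        _ ≤ _ := by
          gcongr
          nlinarith
  · refine (pairMass_or_le _ _).trans ?_
    have h2 : pairMass μ x (fun ω e => ∃ i ∈ Finset.Icc 1 q, AdvancePair x (E ω) q c R ℓ i e) ≤
        q * (40 * (blockConst c * (2 ^ c) ^ 2)) := by
      refine (pairMass_exists_le _ _).trans ((Finset.sum_le_card_nsmul _ _
        (40 * (blockConst c * (2 ^ c) ^ 2)) fun i hi => ?_).trans (le_of_eq (by simp)))
      rw [Finset.mem_Icc] at hi
      exact (M.pairMass_advance_le hc hR hi.1 hi.2).trans (le_of_eq (by ring))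
    have h3 : pairMass μ x (fun ω e => ∃ r ∈ Finset.Icc 1 (q + 1),
        SearchPair x (adj ω) (E ω) q c R ℓ r e) ≤ (q + 1) * (2 * searchConst c) := by
      refine (pairMass_exists_le _ _).trans ((Finset.sum_le_card_nsmul _ _
        (2 * searchConst c) fun r hr => ?_).trans (le_of_eq (by simp)))
      rw [Finset.mem_Icc] at hr
      exact M.pairMass_search_le hc hR hr.1
    have h4 : 0 ≤ 40 * (blockConst c * (2 ^ c) ^ 2) := by positivity
    linarith

theorem pairMass_compared_le (M : PathModel μ Z x adj E q p) (hc : 8 ≤ c) :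
    pairMass μ x (fun ω e => ∃ ℓ, ℓ ≤ n ∧ ComparedAt x (adj ω) (E ω) q c (schedule q p) ℓ e) ≤
      (n + 1) * ((q + 1) * totalConst c) := by
  have hp := M.p_pos
  have hC := blockConst_pos c
  have hS := searchConst_pos c
  set D := blockConst c * (2 ^ c) ^ 2 with hD
  have hD0 : 0 < D := by positivity
  have h1 : pairMass μ x (fun ω e => ∃ ℓ, ℓ ≤ n ∧
      ComparedAt x (adj ω) (E ω) q c (schedule q p) ℓ e) ≤
      ∑ ℓ ∈ Finset.range (n + 1), pairMass μ x (fun ω =>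
        ComparedAt x (adj ω) (E ω) q c (schedule q p) ℓ) := by
    refine (pairMass_mono fun ω e h => ?_).trans (pairMass_exists_le (Finset.range (n + 1))
      fun ℓ ω => ComparedAt x (adj ω) (E ω) q c (schedule q p) ℓ)
    obtain ⟨ℓ, hℓ, h⟩ := h
    exact ⟨ℓ, by simp; omega, h⟩
  refine h1.trans ((Finset.sum_le_sum fun ℓ _ => M.pairMass_comparedAt_le hc ℓ).trans ?_)
  rw [Finset.sum_add_distrib, Finset.sum_const, Finset.card_range, nsmul_eq_mul]
  have h2 : ∑ ℓ ∈ Finset.range (n + 1), ∑ i ∈ (Finset.Icc 1 q).filter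
      (fun i => ℓ = 0 ∨ i ≤ schedule q p ℓ), 4 * D * min (size p i) n ≤
      q * (132 * D * (n + 1)) := by
    simp only [Finset.sum_filter]
    rw [Finset.sum_comm]
    refine (Finset.sum_le_card_nsmul _ _ (132 * D * (n + 1)) fun i hi => ?_).trans
      (le_of_eq (by simp))
    rw [Finset.mem_Icc] at hi
    have hs := size_pos hp i
    -- The first build is split off, where the minimum is bounded by `n`. In the remaining sum it is
    -- bounded by `size p i`, which cancels against the number of rebuilds.
    rw [Finset.sum_range_succ', if_pos (Or.inl rfl)]
    have h3 : ∑ ℓ ∈ Finset.range n, (if ℓ + 1 = 0 ∨ i ≤ schedule q p (ℓ + 1) then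
        4 * D * min (size p i) n else 0) ≤ 128 * D * (n + 1) := by
      have h4 : ∑ ℓ ∈ Finset.range n, (if ℓ + 1 = 0 ∨ i ≤ schedule q p (ℓ + 1) then
          4 * D * min (size p i) (n : ℝ) else 0) = ∑ ℓ ∈ (Finset.Icc 1 n).filter
            (fun ℓ => i ≤ schedule q p ℓ), 4 * D * min (size p i) (n : ℝ) := by
        rw [Finset.sum_filter, Finset.range_eq_Ico, ← Finset.Ico_add_one_right_eq_Icc,
          ← Finset.sum_Ico_add' _ 0 n 1]
        exact Finset.sum_congr rfl fun ℓ _ => by simp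
      rw [h4, Finset.sum_const, nsmul_eq_mul]
      have h5 := card_rebuild_le (show (0 : unitInterval) < p from hp) hi.1 hi.2 n
      change _ ≤ 32 * ((n : ℝ) + 1) / size p i at h5
      calc _ ≤ 32 * ((n : ℝ) + 1) / size p i * (4 * D * size p i) := by
            gcongr
            exact min_le_left _ _
        _ = _ := by field_simp; ring
    have h6 : 4 * D * min (size p i) n ≤ 4 * D * (n + 1) := by
      gcongr
      exact (min_le_right _ _).trans (by linarith)
    linarith
  have h7 : (q : ℝ) * (132 * D * (n + 1)) ≤ (n + 1) * ((q + 1) * (132 * D)) := by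
    have : 0 ≤ 132 * D * ((n : ℝ) + 1) := by positivity
    linarith
  have h8 : ((n + 1 : ℕ) : ℝ) * ((q + 1) * (40 * D + 2 * searchConst c)) +
      (n + 1) * ((q + 1) * (132 * D)) = (n + 1) * ((q + 1) * totalConst c) := by
    rw [totalConst, ← hD]
    push_cast
    ring
  linarith

variable [Finite Ω]

theorem integral_card_asked_sortPrefix_le (M : PathModel μ Z x adj E q p) (hc : 8 ≤ c) {m : ℕ}
    (hm : m ≤ n) :
    ∫ ω, (((sortPrefix (adj ω) (E ω) q c (schedule q p) m).asked (precedes x)).card : ℝ) ∂μ ≤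
      2 * n + (n + 1) * ((q + 1) * totalConst c) := by
  refine (integral_card_le (x := x) _ (fun ω e => ∃ ℓ, ℓ ≤ n ∧
    ComparedAt x (adj ω) (E ω) q c (schedule q p) ℓ e) (N := n) fun ω => ?_).trans ?_
  · obtain ⟨-, F, h1, -, h2⟩ := sortPrefix_spec (M.valid ω) (by omega : 1 ≤ c)
      (schedule_le q p) hm
    exact ⟨F, h1, h2⟩
  · have := M.pairMass_compared_le hc
    linarith

/-- The two halves share their edge sets and are dependent, but a union bound and linearity of
expectation need no independence. -/
theorem integral_card_asked_sortAll_le (M : PathModel μ Z x adj E q p) (hc : 8 ≤ c) :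
    ∫ ω, (((sortAll (adj ω) (E ω) q c (schedule q p)).asked (precedes x)).card : ℝ) ∂μ ≤
      (4 * totalConst c + 4) * n * (q + 1) := by
  rcases Nat.eq_zero_or_pos n with rfl | hn
  · have h : ∀ ω, ((sortAll (adj ω) (E ω) q c (schedule q p)).asked (precedes x)).card = 0 := by
      intro ω
      rw [Finset.card_eq_zero, Finset.eq_empty_iff_forall_notMem]
      exact fun e => isEmptyElim e
    simp [h]
  · have h1 := M.integral_card_asked_sortPrefix_le hc (m := (n + 1) / 2) (by omega)
    have h2 := M.reverse.integral_card_asked_sortPrefix_le hc (m := n / 2) (by omega)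
    have h3 : ∫ ω, (((sortAll (adj ω) (E ω) q c (schedule q p)).asked (precedes x)).card : ℝ) ∂μ ≤
        ∫ ω, ((((sortPrefix (adj ω) (E ω) q c (schedule q p) ((n + 1) / 2)).asked
            (precedes x)).card : ℝ) +
          ((sortPrefix (adj ω) (E ω) q c (schedule q p) (n / 2)).asked
            (precedes (reverseOrder x))).card) ∂μ := by
      refine integral_mono Integrable.of_finite Integrable.of_finite fun ω => ?_
      simp only [asked_sortAll]
      exact_mod_cast Finset.card_union_le _ _
    rw [integral_add Integrable.of_finite Integrable.of_finite] at h3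
    have hT := totalConst_pos c
    have hn' : (1 : ℝ) ≤ n := by exact_mod_cast hn
    have hq : (0 : ℝ) ≤ q := by positivity
    have h4 : ((n : ℝ) + 1) * ((q + 1) * totalConst c) ≤ 2 * n * ((q + 1) * totalConst c) := by
      gcongr
      linarith
    have h5 : (4 : ℝ) * n ≤ 4 * n * (q + 1) := le_mul_of_one_le_right (by positivity) (by linarith)
    nlinarith

end PathModel

end StochSort

/-! ### The random graph and the random choices form a path model -/

namespace StochSort

open ProbabilityTheory

/-- This is what α is chosen for: the event on which the tuples are conditioned has the edge
probability `p`. -/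
theorem pi_setProb_exists {q : ℕ} (hq : 1 ≤ q) (p : unitInterval) :
    (Measure.pi fun i => bernoulliMeasure true false (setProb q p i)).real {t | ∃ i, t i = true} =
      p := by
  have h1 : {t : Fin q → Bool | ∃ i, t i = true} = (Set.univ.pi fun _ => {false})ᶜ := by
    ext t
    simp [Set.mem_pi]
  have h2 : (Measure.pi fun i => bernoulliMeasure true false (setProb q p i)).real
      (Set.univ.pi fun _ => {false}) = 1 - (p : ℝ) := by
    rw [← prod_alpha hq p, measureReal_def, Measure.pi_pi, ENNReal.toReal_prod]
    refine Finset.prod_congr rfl fun i _ => ?_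
    rw [← measureReal_def, bernoulliMeasure_real_apply _ (Set.toFinite _).measurableSet]
    simp [setProb]
  rw [h1, probReal_compl_eq_one_sub (Set.toFinite _).measurableSet, h2]
  ring

theorem isProbabilityMeasure_tupleLaw {q : ℕ} (hq : 1 ≤ q) {p : unitInterval} (hp : 0 < p) :
    IsProbabilityMeasure (tupleLaw q p) := by
  refine cond_isProbabilityMeasure fun h => ?_
  have h1 := pi_setProb_exists hq p
  rw [measureReal_def, h] at h1
  have : (0 : ℝ) < p := hp
  simp at h1
  linarith

/-- Conditioning divides α p / 2^i by `p`. The factor `p` returns for pairs off the path, which must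
first be edges, but not for path edges. -/
theorem tupleLaw_real_apply {q : ℕ} (hq : 1 ≤ q) {p : unitInterval} (hp : 0 < p) (j : Fin q) :
    (tupleLaw q p).real {t | t j = true} = alpha q p / 2 ^ (j.val + 1) := by
  have hp' : (0 : ℝ) < p := hp
  rw [tupleLaw, measureReal_def, cond_apply (Set.toFinite _).measurableSet, ENNReal.toReal_mul,
    ENNReal.toReal_inv, ← measureReal_def, ← measureReal_def, pi_setProb_exists hq p,
    show {t : Fin q → Bool | ∃ i, t i = true} ∩ {t | t j = true} =
      (fun t : Fin q → Bool => t j) ⁻¹' {true} by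
        ext t
        simp only [Set.mem_inter_iff, Set.mem_ofPred_eq, Set.mem_preimage, Set.mem_singleton_iff]
        exact ⟨fun h => h.2, fun h => ⟨⟨j, h⟩, h⟩⟩,
    measureReal_def, (measurePreserving_eval _ j).measure_preimage
      (Set.toFinite _).measurableSet.nullMeasurableSet, ← measureReal_def,
    bernoulliMeasure_real_apply _ (Set.toFinite _).measurableSet]
  simp [setProb]
  field_simp

open unitInterval in
/-- The edge indicators of the binomial random graph are independent. -/
theorem map_binomialRandom_eq_pi (n : ℕ) (p : unitInterval) :
    (SimpleGraph.binomialRandom (Fin n) p).map (fun G e => e ∈ G.edgeSet) =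
      Measure.pi fun e : Sym2 (Fin n) =>
        toNNReal p • Measure.dirac (¬ e.IsDiag) + toNNReal (σ p) • Measure.dirac False := by
  rw [SimpleGraph.binomialRandom_eq_map, Measure.map_map (by fun_prop) (by fun_prop)]
  have h : (fun (G : SimpleGraph (Fin n)) e => e ∈ G.edgeSet) ∘ SimpleGraph.fromEdgeSet
      =ᵐ[setBernoulli Sym2.diagSetᶜ p] fun S e => e ∈ S := by
    filter_upwards [setBernoulli_ae_subset] with S hS
    funext e
    have := @hS e
    simp only [Set.mem_compl_iff, Sym2.mem_diagSet] at this
    simp only [Function.comp_apply, SimpleGraph.edgeSet_fromEdgeSet, Set.mem_sdiff,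
      Sym2.mem_diagSet, eq_iff_iff]
    tauto
  rw [Measure.map_congr h, setBernoulli_eq_map, Measure.map_map (by fun_prop) (by fun_prop),
    Measure.infinitePi_eq_pi]
  exact Measure.map_id

/-- The probability space of the random graph and the random choices of the algorithm. -/
abbrev Sample (n q : ℕ) : Type := SimpleGraph (Fin n) × (Sym2 (Fin n) → Fin q → Bool)

/-- The joint law of the random graph and the random choices of the algorithm. -/
noncomputable def sampleLaw (n q : ℕ) (p : unitInterval) : Measure (Sample n q) :=
  (SimpleGraph.binomialRandom (Fin n) p).prod (coinLaw n q p)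

/-- Everything that is random at the vertex pair `e`. -/
def pairData {n q : ℕ} (e : Sym2 (Fin n)) (ω : Sample n q) : Prop × (Fin q → Bool) :=
  (e ∈ ω.1.edgeSet, ω.2 e)

instance (n : ℕ) : DiscreteMeasurableSpace (SimpleGraph (Fin n)) where
  forall_measurableSet s := by
    have h := SimpleGraph.measurable_edgeSet (V := Fin n)
    have : s = SimpleGraph.edgeSet ⁻¹' (SimpleGraph.edgeSet '' s) :=
      (SimpleGraph.edgeSet_injective.preimage_image s).symm
    rw [this]
    exact h (Set.toFinite _).measurableSet

section

variable {n q : ℕ} {p : unitInterval}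

theorem isProbabilityMeasure_coinLaw (hq : 1 ≤ q) (hp : 0 < p) :
    IsProbabilityMeasure (coinLaw n q p) := by
  have := isProbabilityMeasure_tupleLaw hq hp
  unfold coinLaw
  infer_instance

theorem isProbabilityMeasure_sampleLaw (hq : 1 ≤ q) (hp : 0 < p) :
    IsProbabilityMeasure (sampleLaw n q p) := by
  have := isProbabilityMeasure_coinLaw (n := n) hq hp
  unfold sampleLaw
  infer_instance

open unitInterval in
-- The space is finite, so the joint law is checked on singletons, where the products for the graph
-- and for the tuples are regrouped pair by pair.
theorem iIndepFun_pairData (hq : 1 ≤ q) (hp : 0 < p) :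
    iIndepFun (pairData (n := n) (q := q)) (sampleLaw n q p) := by
  have := isProbabilityMeasure_tupleLaw hq hp
  have := isProbabilityMeasure_coinLaw (n := n) hq hp
  have := isProbabilityMeasure_sampleLaw (n := n) hq hp
  set ν : Sym2 (Fin n) → Measure Prop := fun e =>
    toNNReal p • Measure.dirac (¬ e.IsDiag) + toNNReal (σ p) • Measure.dirac False with hν
  have hν1 : ∀ e, IsProbabilityMeasure (ν e) := by
    intro e
    constructor
    simp [hν]
  have hmap : (sampleLaw n q p).map (fun ω e => pairData e ω) =
      Measure.pi fun e => (ν e).prod (tupleLaw q p) := by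
    refine Measure.ext_of_singleton fun z => ?_
    rw [Measure.map_apply .of_discrete (Set.toFinite _).measurableSet, Measure.pi_singleton,
      show (fun ω e => pairData e ω) ⁻¹' {z} =
        ((fun (G : SimpleGraph (Fin n)) e => e ∈ G.edgeSet) ⁻¹' {fun e => (z e).1}) ×ˢ
          {fun e => (z e).2} by
        ext ω
        simp [pairData, funext_iff, Prod.ext_iff, forall_and],
      sampleLaw, Measure.prod_prod, ← Measure.map_apply .of_discrete (Set.toFinite _).measurableSet,
      map_binomialRandom_eq_pi, coinLaw, Measure.pi_singleton, Measure.pi_singleton,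
      ← Finset.prod_mul_distrib]
    refine Finset.prod_congr rfl fun e _ => ?_
    rw [← Measure.prod_prod, Set.singleton_prod_singleton]
  rw [iIndepFun_iff_map_fun_eq_pi_map fun e => Measurable.of_discrete.aemeasurable, hmap]
  congr 1
  funext e
  rw [← (measurePreserving_eval (fun e => (ν e).prod (tupleLaw q p)) e).map_eq, ← hmap,
    Measure.map_map .of_discrete .of_discrete]
  rfl

theorem sampleLaw_real_and_of_determinedBy (hq : 1 ≤ q) (hp : 0 < p) {S T : Set (Sym2 (Fin n))}
    {A B : Sample n q → Prop} (hST : Disjoint S T) (hA : DeterminedBy pairData S A)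
    (hB : DeterminedBy pairData T B) :
    (sampleLaw n q p).real {ω | A ω ∧ B ω} =
      (sampleLaw n q p).real {ω | A ω} * (sampleLaw n q p).real {ω | B ω} := by
  classical
  have hind := (iIndepFun_pairData (n := n) hq hp).indepFun_finset S.toFinset T.toFinset
    (by simpa using hST) fun e => .of_discrete
  -- An event determined by the pairs in `U` is the preimage of its image under restriction of the
  -- data to `U`; all sets being finite, measurability is automatic.
  have key : ∀ {U : Set (Sym2 (Fin n))} {C : Sample n q → Prop}, DeterminedBy pairData U C →
      {ω | C ω} = (fun ω (e : U.toFinset) => pairData (e : Sym2 (Fin n)) ω) ⁻¹'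
        ((fun ω (e : U.toFinset) => pairData (e : Sym2 (Fin n)) ω) '' {ω | C ω}) := by
    intro U C hC
    refine (Set.subset_preimage_image _ _).antisymm ?_
    rintro ω ⟨ω', hω', h⟩
    refine (hC ω' ω fun e he => ?_).1 hω'
    exact congrFun h ⟨e, by simpa using he⟩
  have h1 := hind.measure_inter_preimage_eq_mul _ _
    (Set.toFinite ((fun ω (e : S.toFinset) =>
      pairData (e : Sym2 (Fin n)) ω) '' {ω | A ω})).measurableSet
    (Set.toFinite ((fun ω (e : T.toFinset) =>
      pairData (e : Sym2 (Fin n)) ω) '' {ω | B ω})).measurableSet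
  rw [← key hA, ← key hB] at h1
  rw [measureReal_def, measureReal_def, measureReal_def, ← ENNReal.toReal_mul, ← h1]
  rfl

open unitInterval in
theorem binomialRandom_real_adj {u v : Fin n} (huv : u ≠ v) :
    (SimpleGraph.binomialRandom (Fin n) p).real {G | G.Adj u v} = p := by
  set ν : Sym2 (Fin n) → Measure Prop := fun e =>
    toNNReal p • Measure.dirac (¬ e.IsDiag) + toNNReal (σ p) • Measure.dirac False with hν
  have hν1 : ∀ e, IsProbabilityMeasure (ν e) := by
    intro e
    constructor
    simp [hν]
  have h1 : {G : SimpleGraph (Fin n) | G.Adj u v} =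
      (fun G e => e ∈ G.edgeSet) ⁻¹' ((fun z : Sym2 (Fin n) → Prop => z s(u, v)) ⁻¹' {True}) := by
    ext G
    simp
  rw [h1, measureReal_def, ← Measure.map_apply .of_discrete (Set.toFinite _).measurableSet,
    map_binomialRandom_eq_pi]
  rw [(measurePreserving_eval ν s(u, v)).measure_preimage
    (Set.toFinite _).measurableSet.nullMeasurableSet]
  simp [hν, huv]

theorem coinLaw_real_apply (hq : 1 ≤ q) (hp : 0 < p) (e : Sym2 (Fin n)) (j : Fin q) :
    (coinLaw n q p).real {T | T e j = true} = alpha q p / 2 ^ (j.val + 1) := by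
  have := isProbabilityMeasure_tupleLaw hq hp
  rw [← tupleLaw_real_apply hq hp j, measureReal_def, measureReal_def, coinLaw,
    ← (measurePreserving_eval (fun _ : Sym2 (Fin n) => tupleLaw q p) e).measure_preimage
      (Set.toFinite _).measurableSet.nullMeasurableSet]
  rfl

theorem sampleLaw_real_adj (hq : 1 ≤ q) (hp : 0 < p) {u v : Fin n} (huv : u ≠ v) :
    (sampleLaw n q p).real {ω | ω.1.Adj u v} = p := by
  have := isProbabilityMeasure_coinLaw (n := n) hq hp
  rw [← binomialRandom_real_adj huv, show {ω : Sample n q | ω.1.Adj u v} =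
    {G | G.Adj u v} ×ˢ Set.univ by ext; simp, sampleLaw, measureReal_prod_prod, probReal_univ,
    mul_one]

theorem sampleLaw_real_mem (hq : 1 ≤ q) (hp : 0 < p) (e : Sym2 (Fin n)) (j : Fin q) :
    (sampleLaw n q p).real {ω | ω.2 e j = true} = alpha q p / 2 ^ (j.val + 1) := by
  have := isProbabilityMeasure_coinLaw (n := n) hq hp
  rw [← coinLaw_real_apply hq hp e j, show {ω : Sample n q | ω.2 e j = true} =
    Set.univ ×ˢ {T | T e j = true} by ext; simp, sampleLaw, measureReal_prod_prod, probReal_univ,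
    one_mul]

theorem sampleLaw_real_adj_and_mem (hq : 1 ≤ q) (hp : 0 < p) {u v : Fin n} (huv : u ≠ v)
    (j : Fin q) :
    (sampleLaw n q p).real {ω | ω.1.Adj u v ∧ ω.2 s(u, v) j = true} =
      p * (alpha q p / 2 ^ (j.val + 1)) := by
  have := isProbabilityMeasure_coinLaw (n := n) hq hp
  rw [← coinLaw_real_apply hq hp s(u, v) j, ← binomialRandom_real_adj huv,
    show {ω : Sample n q | ω.1.Adj u v ∧ ω.2 s(u, v) j = true} =
    {G | G.Adj u v} ×ˢ {T | T s(u, v) j = true} by ext; simp, sampleLaw, measureReal_prod_prod]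

theorem edgeSets_eq_true {G : SimpleGraph (Fin n)} {T : Sym2 (Fin n) → Fin q → Bool} {u v : Fin n}
    (j : Fin q) :
    edgeSets G T (j.val + 1) u v = true ↔ G.Adj u v ∧ T s(u, v) j = true := by
  simp [edgeSets, Fin.val_inj]

/-- The random graph with the planted path and its random edge sets. -/
theorem pathModel_sampleLaw (hp : 0 < p) (x : Equiv.Perm (Fin n)) :
    PathModel (sampleLaw n (numSets n p) p) pairData x
      (fun ω u v => @decide ((ω.1 ⊔ hamPath x).Adj u v) (Classical.propDecidable _))
      (fun ω => edgeSets (ω.1 ⊔ hamPath x) ω.2) (numSets n p) p := by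
  have hp0 : (0 : ℝ) < p := hp
  have hp1 : (p : ℝ) ≤ 1 := p.2.2
  set q := numSets n p with hqdef
  have hq : 1 ≤ q := one_le_numSets n p
  have := isProbabilityMeasure_sampleLaw (n := n) hq hp
  obtain ⟨hα1, hα2⟩ := alpha_mem q p
  have hadj : ∀ u v, DeterminedBy (pairData (n := n) (q := q)) {s(u, v)}
      fun ω => (ω.1 ⊔ hamPath x).Adj u v := by
    intro u v ω ω' h
    have h1 := congrArg Prod.fst (h s(u, v) rfl)
    simp only [pairData, SimpleGraph.mem_edgeSet] at h1
    simp only [SimpleGraph.sup_adj, h1]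
  have hoff : ∀ {u v}, u ≠ v → ¬ (hamPath x).Adj u v → ∀ j : Fin q,
      (sampleLaw n q p).real {ω | edgeSets (ω.1 ⊔ hamPath x) ω.2 (j.val + 1) u v = true} =
        p * (alpha q p / 2 ^ (j.val + 1)) := by
    intro u v huv hnot j
    rw [← sampleLaw_real_adj_and_mem hq hp huv j]
    simp only [edgeSets_eq_true, SimpleGraph.sup_adj, hnot, or_false]
  have hon : ∀ {u v}, (hamPath x).Adj u v → ∀ j : Fin q,
      (sampleLaw n q p).real {ω | edgeSets (ω.1 ⊔ hamPath x) ω.2 (j.val + 1) u v = true} =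
        alpha q p / 2 ^ (j.val + 1) := by
    intro u v h j
    rw [← sampleLaw_real_mem hq hp s(u, v) j]
    simp only [edgeSets_eq_true, SimpleGraph.sup_adj, h, or_true, true_and]
  have hindex : ∀ {k}, 1 ≤ k → k ≤ q → ∃ j : Fin q, k = j.val + 1 :=
    fun {k} hk hkq => ⟨⟨k - 1, by omega⟩, by simp only; omega⟩
  refine
  { p_pos := hp0
    p_le_one := hp1
    n_le := le_targetSize_numSets hp n
    valid := fun ω => validInput ω.2 le_sup_right
    E_symm := ?_
    indep := fun S T A B hST hA hB => sampleLaw_real_and_of_determinedBy hq hp hST hA hB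
    adj_det := fun u v => by simpa only [decide_eq_true_eq] using hadj u v
    E_det := ?_
    adj_eq := ?_
    E_le := ?_
    E_le' := ?_
    le_E := ?_ }
  · intro ω k u v
    rw [Bool.eq_iff_iff]
    simp only [edgeSets, decide_eq_true_eq, SimpleGraph.adj_comm _ u v, Sym2.eq_swap (a := u)]
  · intro k u v
    simp only [edgeSets, decide_eq_true_eq]
    refine (hadj u v).and (DeterminedBy.ex fun j => DeterminedBy.const_and fun _ => ?_)
    intro ω ω' h
    have h1 := congrArg Prod.snd (h s(u, v) rfl)
    simp only [pairData] at h1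
    simp only [h1]
  · intro u v huv hnot
    simp only [decide_eq_true_eq, SimpleGraph.sup_adj, hnot, or_false]
    exact sampleLaw_real_adj hq hp huv
  · intro k u v hk hkq huv hnot
    obtain ⟨j, rfl⟩ := hindex hk hkq
    rw [hoff huv hnot, mul_div_assoc', mul_comm]
    gcongr
  · intro k u v hk hkq huv
    obtain ⟨j, rfl⟩ := hindex hk hkq
    by_cases h : (hamPath x).Adj u v
    · rw [hon h]
      gcongr
    · rw [hoff huv h]
      calc (p : ℝ) * (alpha q p / 2 ^ (j.val + 1)) ≤ 1 * (2 / 2 ^ (j.val + 1)) := by gcongr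
        _ = _ := one_mul _
  · intro k u v hk hkq huv
    obtain ⟨j, rfl⟩ := hindex hk hkq
    by_cases h : (hamPath x).Adj u v
    · rw [hon h]
      gcongr
      linarith
    · rw [hoff huv h, mul_div_assoc']
      gcongr
      nlinarith

end

end StochSort

open StochSort in
theorem theorem3 :
    ∃ c₀ : ℕ, ∀ c : ℕ, c₀ ≤ c → ∃ K : ℝ, ∀ (n : ℕ) (p : unitInterval), 0 < p →
      ∀ x : Equiv.Perm (Fin n),
        (∀ (G : SimpleGraph (Fin n)) (T : Sym2 (Fin n) → Fin (numSets n p) → Bool),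
          hamPath x ≤ G →
            (stochasticSort c p G T).output (precedes x) = List.ofFn x ∧
            ∀ e ∈ (stochasticSort c p G T).asked (precedes x), e ∈ G.edgeSet) ∧
        expectedComparisons c n p x ≤ K * (n * max 1 (Real.log (p * n))) := by
  -- The value 8 comes from the blocking estimate, where 2^c / 32 ≥ 8 is required. The last factor 4
  -- is that of q + 1 ≤ 4 max(1, log(pn)).
  refine ⟨8, fun c hc => ⟨(4 * totalConst c + 4) * 4, fun n p hp x =>
    ⟨fun G T hG => stochasticSort_correct (by omega) T hG, ?_⟩⟩⟩
  have := isProbabilityMeasure_sampleLaw (n := n) (one_le_numSets n p) hp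
  have h1 := (pathModel_sampleLaw hp x).integral_card_asked_sortAll_le hc
  have h2 := numSets_add_one_le (p := p) n
  have h3 := totalConst_pos c
  refine le_trans h1 ?_
  calc (4 * totalConst c + 4) * n * (numSets n p + 1)
      ≤ (4 * totalConst c + 4) * n * (4 * max 1 (Real.log (p * n))) := by gcongr
    _ = _ := by ring
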